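/- Throughout, $\hat\otimes$ is the minimal (spatial) tensor product. A unital $\sigma$-$C^*$-algebra is a unital topological $*$-algebra isomorphic to the inverse limit $\varprojlim_n A_n$, taken in topological $*$-algebras, of a sequence of $C^*$-algebras. A $\sigma$-$C^*$-quantum group is a unital $\sigma$-$C^*$-algebra $A$ with a unital (automatically continuous) $*$-homomorphism $\Delta:A\to A\hat\otimes A$ such that $(\Delta\hat\otimes\mathrm{id})\Delta=(\mathrm{id}\hat\otimes\Delta)\Delta$ and such that the linear spans of $\Delta(A)(A\hat\otimes 1)$ and $\Delta(A)(1\hat\otimes A)$ are dense in $A\hat\otimes A$. A $C^*$-compact quantum group is a unital $C^*$-algebra with a $\Delta$ satisfying these conditions. (1) Every $C^*$-compact quantum group is a $\sigma$-$C^*$-quantum group. (2) Let $\{(A_n,\Delta_n),\theta_n:A_n\to A_{n-1}\}$ be a sequence of $C^*$-compact quantum groups and surjective unital $*$-homomorphisms with $(\theta_n\hat\otimes\theta_n)\Delta_n=\Delta_{n-1}\theta_n$ for all $n$, and let $A=\varprojlim_n A_n$ with projections $p_n:A\to A_n$. Then the maps $p_n\hat\otimes p_n$ identify $A\hat\otimes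 A$ with $\varprojlim_n A_n\hat\otimes A_n$, there is a unique unital $*$-homomorphism $\Delta=\varprojlim_n\Delta_n:A\to A\hat\otimes A$ with $(p_n\hat\otimes p_n)\Delta=\Delta_np_n$ for all $n$, and $(A,\Delta)$ is a $\sigma$-$C^*$-quantum group. (3) Let $q\in(0,1)$, and let $C(SU_q(n))$ be the universal unital $C^*$-algebra generated by $u^n_{ij}$, $1\le i,j\le n$, with the relations $$\sum_k u^n_{ik}(u^n_{jk})^*=\delta_{ij}1,\qquad \sum_k (u^n_{ki})^*u^n_{kj}=\delta_{ij}1,\qquad \sum_{i_1,\dots,i_n}E_{i_1\cdots i_n}u^n_{j_1i_1}\cdots u^n_{j_ni_n}=E_{j_1\cdots j_n}1,$$ where $E_{i_1\cdots i_n}=0$ if $i_1,\dots,i_n$ are not distinct and $E_{i_1\cdots i_n}=(-q)^{\ell}$ otherwise, $\ell$ being the number of pairs $a<b$ with $i_a>i_b$. This $C^*$-algebra exists. For $n\ge2$ it is a $C^*$-compact quantum group with $\Delta_n(u^n_{ij})=\sum_k u^n_{ik}\otimes u^n_{kj}$. For $n\ge3$ there is a surjective unital $*$-homomorphism $\theta_n:C(SU_q(n))\to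 C(SU_q(n-1))$ with $\theta_n(u^n_{ij})=u^{n-1}_{ij}$ if $i,j\le n-1$ and $\theta_n(u^n_{ij})=\delta_{ij}1$ otherwise, and $(\theta_n\hat\otimes\theta_n)\Delta_n=\Delta_{n-1}\theta_n$. Consequently $C(SU_q(\infty))=\varprojlim_{n\ge2}C(SU_q(n))$ with $\Delta=\varprojlim_n\Delta_n$ is a $\sigma$-$C^*$-quantum group. -/

import Mathlib

open scoped TensorProduct

namespace SigmaCStar

open UniformSpace (Completion)
open UniformSpace.Completion

universe u v w

noncomputable section

set_option linter.unusedSectionVars false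

/-! ### Completions of topological star algebras -/

section StarCompletion

variable {F : Type u} [Ring F] [UniformSpace F] [IsUniformAddGroup F] [StarRing F]
  [ContinuousStar F]

theorem uniformContinuous_star : UniformContinuous (star : F → F) :=
  uniformContinuous_addMonoidHom_of_continuous (f := (starAddEquiv : F ≃+ F).toAddMonoidHom)
    continuous_star

instance completionStar : Star (Completion F) := ⟨Completion.map star⟩

theorem coe_star (a : F) : ((star a : F) : Completion F) = star (a : Completion F) :=
  (Completion.map_coe uniformContinuous_star a).symm

instance completionContinuousStar : ContinuousStar (Completion F) := ⟨Completion.continuous_map⟩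

variable [IsTopologicalRing F]

instance completionStarRing : StarRing (Completion F) where
  star_involutive x := Completion.induction_on x
    (isClosed_eq (continuous_star.comp continuous_star) continuous_id)
    fun a => by rw [← coe_star, ← coe_star, star_star]
  star_mul x y := Completion.induction_on₂ x y
    (isClosed_eq (by fun_prop) (by fun_prop))
    fun a b => by rw [← coe_mul, ← coe_star, star_mul, coe_mul, coe_star, coe_star]
  star_add x y := Completion.induction_on₂ x y
    (isClosed_eq (by fun_prop) (by fun_prop))
    fun a b => by rw [← coe_add, ← coe_star, star_add, coe_add, coe_star, coe_star]

variable [Algebra ℂ F] [StarModule ℂ F] [UniformContinuousConstSMul ℂ F]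

instance completionStarModule : StarModule ℂ (Completion F) where
  star_smul c x := Completion.induction_on x
    (isClosed_eq (continuous_star.comp (continuous_const_smul c))
      (continuous_star.const_smul (star c)))
    fun a => by rw [← coe_smul, ← coe_star, star_smul, coe_smul, coe_star]

end StarCompletion

/-! ### The completion of a star algebra with respect to a family of representations -/

section Reps

variable {F : Type u} [Ring F] [StarRing F] [Algebra ℂ F] [StarModule ℂ F]
  {ι : Type v} {H : ι → Type w} [∀ i, NormedAddCommGroup (H i)]
  [∀ i, InnerProductSpace ℂ (H i)] [∀ i, CompleteSpace (H i)]

/-- The star algebra `F`, to be equipped with the coarsest topology that makes all the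
`*`-representations `f i` on Hilbert spaces norm continuous. -/
@[nolint unusedArguments]
def WithReps (_f : ∀ i, F →⋆ₐ[ℂ] (H i →L[ℂ] H i)) : Type u := F

variable (f : ∀ i, F →⋆ₐ[ℂ] (H i →L[ℂ] H i))

instance : Ring (WithReps f) := inferInstanceAs (Ring F)
instance : StarRing (WithReps f) := inferInstanceAs (StarRing F)
instance : Algebra ℂ (WithReps f) := inferInstanceAs (Algebra ℂ F)
instance : StarModule ℂ (WithReps f) := inferInstanceAs (StarModule ℂ F)

/-- The identity map `F → WithReps f`. -/
def toReps : F →⋆ₐ[ℂ] WithReps f := StarAlgHom.id ℂ F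

/-- The representation `f i`, seen on `WithReps f`. -/
def evalRep (i : ι) : WithReps f →⋆ₐ[ℂ] (H i →L[ℂ] H i) := f i

instance : UniformSpace (WithReps f) := ⨅ i, UniformSpace.comap (evalRep f i) inferInstance

instance : IsUniformAddGroup (WithReps f) :=
  isUniformAddGroup_iInf fun i => IsUniformAddGroup.comap (evalRep f i)

theorem continuous_evalRep (i : ι) : Continuous (evalRep f i) := by
  rw [continuous_iff_le_induced, UniformSpace.toTopologicalSpace_iInf]
  exact iInf_le _ i

theorem continuous_withReps_iff {X : Type*} [TopologicalSpace X] {g : X → WithReps f} :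
    Continuous g ↔ ∀ i, Continuous fun x => evalRep f i (g x) := by
  refine ⟨fun h i => (continuous_evalRep f i).comp h, fun h => ?_⟩
  rw [UniformSpace.toTopologicalSpace_iInf, continuous_iInf_rng]
  exact fun i => continuous_induced_rng.2 (h i)

instance : IsTopologicalRing (WithReps f) where
  continuous_add := continuous_add
  continuous_mul := (continuous_withReps_iff f).2 fun i => by
    simp only [map_mul]
    exact ((continuous_evalRep f i).comp continuous_fst).mul
      ((continuous_evalRep f i).comp continuous_snd)
  continuous_neg := continuous_neg

instance : ContinuousStar (WithReps f) where
  continuous_star := (continuous_withReps_iff f).2 fun i => by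
    simp only [map_star]
    exact (continuous_evalRep f i).star

instance : UniformContinuousConstSMul ℂ (WithReps f) where
  uniformContinuous_const_smul c :=
    uniformContinuous_addMonoidHom_of_continuous (f := DistribSMul.toAddMonoidHom (WithReps f) c)
      ((continuous_withReps_iff f).2 fun i => by
        simp only [DistribSMul.toAddMonoidHom_apply, map_smul]
        exact (continuous_evalRep f i).const_smul c)

/-- The Hausdorff completion of `F` for the topology given by the seminorms `x ↦ ‖f i x‖`. -/
def RepCompletion : Type u := Completion (WithReps f)

instance : UniformSpace (RepCompletion f) := inferInstanceAs (UniformSpace (Completion _))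
instance : CompleteSpace (RepCompletion f) := inferInstanceAs (CompleteSpace (Completion _))
instance : T0Space (RepCompletion f) := inferInstanceAs (T0Space (Completion _))
instance : Ring (RepCompletion f) := inferInstanceAs (Ring (Completion (WithReps f)))
instance : StarRing (RepCompletion f) := inferInstanceAs (StarRing (Completion (WithReps f)))
instance : Algebra ℂ (RepCompletion f) := inferInstanceAs (Algebra ℂ (Completion (WithReps f)))
instance : StarModule ℂ (RepCompletion f) :=
  inferInstanceAs (StarModule ℂ (Completion (WithReps f)))
instance : IsUniformAddGroup (RepCompletion f) :=
  inferInstanceAs (IsUniformAddGroup (Completion (WithReps f)))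
instance : IsTopologicalRing (RepCompletion f) :=
  inferInstanceAs (IsTopologicalRing (Completion (WithReps f)))
instance : ContinuousStar (RepCompletion f) :=
  inferInstanceAs (ContinuousStar (Completion (WithReps f)))

/-- The canonical map of `F` into its completion. -/
def RepCompletion.of : F →⋆ₐ[ℂ] RepCompletion f where
  toFun x := ((toReps f x : WithReps f) : Completion (WithReps f))
  map_one' := by rw [map_one]; exact coe_one _
  map_mul' x y := by rw [map_mul]; exact coe_mul _ _
  map_zero' := by rw [map_zero]; exact coe_zero
  map_add' x y := by rw [map_add]; exact coe_add _ _
  commutes' _ := rfl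
  map_star' x := by rw [map_star]; exact coe_star _

theorem RepCompletion.dense_range_of : DenseRange (RepCompletion.of f) :=
  Completion.denseRange_coe (α := WithReps f)

variable {G : Type u} [Ring G] [StarRing G] [Algebra ℂ G] [StarModule ℂ G]
  {κ : Type v} {K : κ → Type w} [∀ i, NormedAddCommGroup (K i)]
  [∀ i, InnerProductSpace ℂ (K i)] [∀ i, CompleteSpace (K i)]
  (g : ∀ i, G →⋆ₐ[ℂ] (K i →L[ℂ] K i))

/-- A `*`-homomorphism that is continuous for the two topologies extends to the completions. -/
def RepCompletion.map (h : F →⋆ₐ[ℂ] G)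
    (hc : ∀ j, Continuous fun x : WithReps f => g j (h x)) :
    RepCompletion f →⋆ₐ[ℂ] RepCompletion g :=
  let h' : WithReps f →⋆ₐ[ℂ] WithReps g := h
  have hc' : Continuous h' := (continuous_withReps_iff g).2 hc
  have hu : UniformContinuous h' :=
    uniformContinuous_addMonoidHom_of_continuous (f := (h' : WithReps f →+ WithReps g)) hc'
  { mapRingHom (h' : WithReps f →+* WithReps g) hc' with
    commutes' := fun c => by
      change Completion.map h' ((algebraMap ℂ (WithReps f) c : WithReps f) : Completion _) = _
      rw [Completion.map_coe hu, AlgHomClass.commutes]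
      rfl
    map_star' := fun x => by
      change Completion.map h' (star x : Completion (WithReps f)) = 
        star (Completion.map h' x : Completion (WithReps g))
      refine Completion.induction_on x (isClosed_eq
        (Completion.continuous_map.comp continuous_star) Completion.continuous_map.star)
        fun a => ?_
      rw [← coe_star, Completion.map_coe hu, Completion.map_coe hu, map_star, coe_star] }

theorem RepCompletion.continuous_map (h : F →⋆ₐ[ℂ] G)
    (hc : ∀ j, Continuous fun x : WithReps f => g j (h x)) :
    Continuous (RepCompletion.map f g h hc) :=
  Completion.continuous_map

theorem RepCompletion.map_of (h : F →⋆ₐ[ℂ] G)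
    (hc : ∀ j, Continuous fun x : WithReps f => g j (h x)) (x : F) :
    RepCompletion.map f g h hc (RepCompletion.of f x) = RepCompletion.of g (h x) :=
  Completion.map_coe (uniformContinuous_addMonoidHom_of_continuous
    (f := ((show WithReps f →⋆ₐ[ℂ] WithReps g from h) : WithReps f →+ WithReps g))
    ((continuous_withReps_iff g).2 hc)) _

end Reps

/-! ### Homomorphisms out of algebraic tensor products -/

section LiftCommute

variable {A B : Type u} [Ring A] [StarRing A] [Algebra ℂ A] [StarModule ℂ A]
  [Ring B] [StarRing B] [Algebra ℂ B] [StarModule ℂ B]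
  {C : Type v} [Semiring C] [StarRing C] [Algebra ℂ C]

/-- The `*`-homomorphism `a ⊗ b ↦ φ(a) ψ(b)` given by two `*`-homomorphisms with commuting
ranges. -/
def liftCommute (φ : A →⋆ₐ[ℂ] C) (ψ : B →⋆ₐ[ℂ] C) (h : ∀ a b, Commute (φ a) (ψ b)) :
    A ⊗[ℂ] B →⋆ₐ[ℂ] C :=
  { Algebra.TensorProduct.lift (φ : A →ₐ[ℂ] C) (ψ : B →ₐ[ℂ] C) h with
    map_star' := fun x => by
      change Algebra.TensorProduct.lift (φ : A →ₐ[ℂ] C) (ψ : B →ₐ[ℂ] C) h (star x) =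
        star (Algebra.TensorProduct.lift (φ : A →ₐ[ℂ] C) (ψ : B →ₐ[ℂ] C) h x)
      induction x using TensorProduct.induction_on with
      | zero => rw [star_zero, map_zero, star_zero]
      | add x y hx hy => rw [star_add, map_add, hx, hy, map_add, star_add]
      | tmul a b =>
        rw [TensorProduct.star_tmul, Algebra.TensorProduct.lift_tmul,
          Algebra.TensorProduct.lift_tmul, star_mul]
        simp only [StarAlgHom.coe_toAlgHom, map_star]
        rw [← star_mul, ← star_mul, (h a b).eq] }

theorem liftCommute_tmul (φ : A →⋆ₐ[ℂ] C) (ψ : B →⋆ₐ[ℂ] C) (h : ∀ a b, Commute (φ a) (ψ b))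
    (a : A) (b : B) : liftCommute φ ψ h (a ⊗ₜ b) = φ a * ψ b :=
  Algebra.TensorProduct.lift_tmul (φ : A →ₐ[ℂ] C) (ψ : B →ₐ[ℂ] C) h a b

end LiftCommute

/-! ### Tensor products of operators and of representations on Hilbert spaces -/

section Hilbert

variable (H : Type u) [NormedAddCommGroup H] [InnerProductSpace ℂ H] [CompleteSpace H]
  (K : Type u) [NormedAddCommGroup K] [InnerProductSpace ℂ K] [CompleteSpace K]

/-- The Hilbert space tensor product. -/
abbrev HilbertTensor : Type u := Completion (H ⊗[ℂ] K)

variable {H K}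

/-- The operator `S ⊗ T` on the Hilbert space tensor product. -/
def opTensor (S : H →L[ℂ] H) (T : K →L[ℂ] K) : HilbertTensor H K →L[ℂ] HilbertTensor H K :=
  (TensorProduct.mapL S T).completion

theorem opTensor_coe (S : H →L[ℂ] H) (T : K →L[ℂ] K) (x : H ⊗[ℂ] K) :
    opTensor S T (x : HilbertTensor H K) = (TensorProduct.mapL S T x : H ⊗[ℂ] K) :=
  ContinuousLinearMap.completion_apply_coe _ _

theorem clm_ext {S T : HilbertTensor H K →L[ℂ] HilbertTensor H K}
    (h : ∀ x : H ⊗[ℂ] K, S (x : HilbertTensor H K) = T (x : HilbertTensor H K)) : S = T :=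
  ContinuousLinearMap.ext fun y => Completion.induction_on y
    (isClosed_eq S.continuous T.continuous) h

theorem opTensor_one : opTensor (1 : H →L[ℂ] H) (1 : K →L[ℂ] K) = 1 :=
  clm_ext fun x => by
    rw [opTensor_coe, one_apply_eq_self]
    exact congrArg _ (by simp [ContinuousLinearMap.one_def])

theorem opTensor_mul (S S' : H →L[ℂ] H) (T T' : K →L[ℂ] K) :
    opTensor (S * S') (T * T') = opTensor S T * opTensor S' T' :=
  clm_ext fun x => by
    rw [mul_apply_eq_comp, opTensor_coe, opTensor_coe, opTensor_coe,
      TensorProduct.mapL_mul, mul_apply_eq_comp]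

theorem inner_mapL (S : H →L[ℂ] H) (T : K →L[ℂ] K) (x y : H ⊗[ℂ] K) :
    inner ℂ (TensorProduct.mapL (star S) (star T) x) y
      = inner ℂ x (TensorProduct.mapL S T y) := by
  induction x using TensorProduct.induction_on with
  | zero => simp
  | add x x' hx hx' => simp only [map_add, inner_add_left, hx, hx']
  | tmul a b =>
    induction y using TensorProduct.induction_on with
    | zero => simp
    | add y y' hy hy' => simp only [map_add, inner_add_right, hy, hy']
    | tmul c d =>
      simp [ContinuousLinearMap.star_eq_adjoint, ContinuousLinearMap.adjoint_inner_left]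

theorem opTensor_star (S : H →L[ℂ] H) (T : K →L[ℂ] K) :
    opTensor (star S) (star T) = star (opTensor S T) := by
  rw [ContinuousLinearMap.star_eq_adjoint (opTensor S T), ContinuousLinearMap.eq_adjoint_iff]
  intro x y
  refine Completion.induction_on₂ x y (isClosed_eq ?_ ?_) fun a b => ?_
  · exact ((opTensor (star S) (star T)).continuous.comp continuous_fst).inner continuous_snd
  · exact continuous_fst.inner ((opTensor S T).continuous.comp continuous_snd)
  · rw [opTensor_coe, opTensor_coe, Completion.inner_coe, Completion.inner_coe, inner_mapL]

variable (H K) in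
/-- The amplification `S ↦ S ⊗ 1`. -/
def ampLeft : (H →L[ℂ] H) →⋆ₐ[ℂ] (HilbertTensor H K →L[ℂ] HilbertTensor H K) where
  toFun S := opTensor S 1
  map_one' := opTensor_one
  map_mul' S S' := by rw [← opTensor_mul, one_mul]
  map_zero' := clm_ext fun x => by rw [opTensor_coe]; simp
  map_add' S S' := clm_ext fun x => by
    rw [_root_.add_apply, opTensor_coe, opTensor_coe, opTensor_coe,
      TensorProduct.mapL_add_left, _root_.add_apply, coe_add]
  commutes' c := clm_ext fun x => by
    rw [opTensor_coe, Algebra.algebraMap_eq_smul_one, Algebra.algebraMap_eq_smul_one,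
      TensorProduct.mapL_smul_left, _root_.smul_apply,
      _root_.smul_apply, one_apply_eq_self, coe_smul]
    simp [ContinuousLinearMap.one_def]
  map_star' S := by rw [← opTensor_star, star_one]

variable (H K) in
/-- The amplification `T ↦ 1 ⊗ T`. -/
def ampRight : (K →L[ℂ] K) →⋆ₐ[ℂ] (HilbertTensor H K →L[ℂ] HilbertTensor H K) where
  toFun T := opTensor 1 T
  map_one' := opTensor_one
  map_mul' S S' := by rw [← opTensor_mul, one_mul]
  map_zero' := clm_ext fun x => by rw [opTensor_coe]; simp
  map_add' S S' := clm_ext fun x => by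
    rw [_root_.add_apply, opTensor_coe, opTensor_coe, opTensor_coe,
      TensorProduct.mapL_add_right, _root_.add_apply, coe_add]
  commutes' c := clm_ext fun x => by
    rw [opTensor_coe, Algebra.algebraMap_eq_smul_one, Algebra.algebraMap_eq_smul_one,
      TensorProduct.mapL_smul_right, _root_.smul_apply,
      _root_.smul_apply, one_apply_eq_self, coe_smul]
    simp [ContinuousLinearMap.one_def]
  map_star' S := by rw [← opTensor_star, star_one]

theorem ampLeft_mul_ampRight (S : H →L[ℂ] H) (T : K →L[ℂ] K) :
    ampLeft H K S * ampRight H K T = opTensor S T := by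
  change opTensor S 1 * opTensor 1 T = _
  rw [← opTensor_mul, mul_one, one_mul]

theorem ampRight_mul_ampLeft (S : H →L[ℂ] H) (T : K →L[ℂ] K) :
    ampRight H K T * ampLeft H K S = opTensor S T := by
  change opTensor 1 T * opTensor S 1 = _
  rw [← opTensor_mul, mul_one, one_mul]

variable {A B : Type u} [Ring A] [StarRing A] [Algebra ℂ A] [StarModule ℂ A]
  [Ring B] [StarRing B] [Algebra ℂ B] [StarModule ℂ B]

/-- The tensor product `π ⊗ ρ` of two `*`-representations, `(π ⊗ ρ)(a ⊗ b) = π(a) ⊗ ρ(b)`. -/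
def tensorRep (π : A →⋆ₐ[ℂ] (H →L[ℂ] H)) (ρ : B →⋆ₐ[ℂ] (K →L[ℂ] K)) :
    A ⊗[ℂ] B →⋆ₐ[ℂ] (HilbertTensor H K →L[ℂ] HilbertTensor H K) :=
  liftCommute (C := HilbertTensor H K →L[ℂ] HilbertTensor H K) ((ampLeft H K).comp π) ((ampRight H K).comp ρ)
    fun a b => (ampLeft_mul_ampRight (π a) (ρ b)).trans (ampRight_mul_ampLeft (π a) (ρ b)).symm

theorem tensorRep_tmul (π : A →⋆ₐ[ℂ] (H →L[ℂ] H)) (ρ : B →⋆ₐ[ℂ] (K →L[ℂ] K)) (a : A) (b : B) :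
    tensorRep π ρ (a ⊗ₜ b) = opTensor (π a) (ρ b) :=
  (liftCommute_tmul (C := HilbertTensor H K →L[ℂ] HilbertTensor H K) _ _ _ a b).trans (ampLeft_mul_ampRight (π a) (ρ b))

end Hilbert

section AlgMap

variable {A B C D : Type u}
  [Ring A] [StarRing A] [Algebra ℂ A] [StarModule ℂ A]
  [Ring B] [StarRing B] [Algebra ℂ B] [StarModule ℂ B]
  [Ring C] [StarRing C] [Algebra ℂ C] [StarModule ℂ C]
  [Ring D] [StarRing D] [Algebra ℂ D] [StarModule ℂ D]

/-- The homomorphism `a ↦ a ⊗ 1`. -/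
def inclLeft : A →⋆ₐ[ℂ] A ⊗[ℂ] B where
  __ := (Algebra.TensorProduct.includeLeft : A →ₐ[ℂ] A ⊗[ℂ] B)
  map_star' a := by
    change (star a ⊗ₜ[ℂ] (1 : B)) = star (a ⊗ₜ[ℂ] (1 : B))
    rw [TensorProduct.star_tmul, star_one]

/-- The homomorphism `b ↦ 1 ⊗ b`. -/
def inclRight : B →⋆ₐ[ℂ] A ⊗[ℂ] B where
  __ := (Algebra.TensorProduct.includeRight : B →ₐ[ℂ] A ⊗[ℂ] B)
  map_star' b := by
    change ((1 : A) ⊗ₜ[ℂ] star b) = star ((1 : A) ⊗ₜ[ℂ] b)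
    rw [TensorProduct.star_tmul, star_one]

/-- The homomorphism `a ⊗ b ↦ f(a) ⊗ g(b)` between algebraic tensor products. -/
def algMap (f : A →⋆ₐ[ℂ] C) (g : B →⋆ₐ[ℂ] D) : A ⊗[ℂ] B →⋆ₐ[ℂ] C ⊗[ℂ] D where
  __ := Algebra.TensorProduct.map (f : A →ₐ[ℂ] C) (g : B →ₐ[ℂ] D)
  map_star' x := by
    change Algebra.TensorProduct.map (f : A →ₐ[ℂ] C) (g : B →ₐ[ℂ] D) (star x)
      = star (Algebra.TensorProduct.map (f : A →ₐ[ℂ] C) (g : B →ₐ[ℂ] D) x)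
    induction x using TensorProduct.induction_on with
    | zero => rw [star_zero, map_zero, star_zero]
    | add x y hx hy => rw [star_add, map_add, hx, hy, map_add, star_add]
    | tmul a b => simp [TensorProduct.star_tmul, map_star]

theorem algMap_tmul (f : A →⋆ₐ[ℂ] C) (g : B →⋆ₐ[ℂ] D) (a : A) (b : B) :
    algMap f g (a ⊗ₜ b) = f a ⊗ₜ g b := rfl

theorem tensorRep_algMap {H K : Type u} [NormedAddCommGroup H] [InnerProductSpace ℂ H]
    [CompleteSpace H] [NormedAddCommGroup K] [InnerProductSpace ℂ K] [CompleteSpace K]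
    (π : C →⋆ₐ[ℂ] (H →L[ℂ] H)) (ρ : D →⋆ₐ[ℂ] (K →L[ℂ] K))
    (f : A →⋆ₐ[ℂ] C) (g : B →⋆ₐ[ℂ] D) (x : A ⊗[ℂ] B) :
    tensorRep π ρ (algMap f g x) = tensorRep (π.comp f) (ρ.comp g) x := by
  induction x using TensorProduct.induction_on with
  | zero => rw [map_zero, map_zero, map_zero]
  | add x y hx hy => rw [map_add, map_add, hx, hy, map_add]
  | tmul a b => rw [algMap_tmul, tensorRep_tmul, tensorRep_tmul]; rfl

end AlgMap

/-! ### The minimal tensor product of topological star algebras -/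

section MinTensor

/-- A continuous unital `*`-representation of a topological star algebra on a Hilbert space. -/
structure Rep (A : Type u) [Ring A] [StarRing A] [Algebra ℂ A] [TopologicalSpace A] where
  H : Type u
  [normed : NormedAddCommGroup H]
  [inner : InnerProductSpace ℂ H]
  [complete : CompleteSpace H]
  π : A →⋆ₐ[ℂ] (H →L[ℂ] H)
  continuous_π : Continuous π

attribute [instance] Rep.normed Rep.inner Rep.complete

variable (A B C D : Type u)
  [Ring A] [StarRing A] [Algebra ℂ A] [StarModule ℂ A] [TopologicalSpace A]
  [Ring B] [StarRing B] [Algebra ℂ B] [StarModule ℂ B] [TopologicalSpace B]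
  [Ring C] [StarRing C] [Algebra ℂ C] [StarModule ℂ C] [TopologicalSpace C]
  [Ring D] [StarRing D] [Algebra ℂ D] [StarModule ℂ D] [TopologicalSpace D]

/-- The representations `π ⊗ ρ` of the algebraic tensor product `A ⊗ B`. -/
abbrev pairRep (p : Rep A × Rep B) :
    A ⊗[ℂ] B →⋆ₐ[ℂ] (HilbertTensor p.1.H p.2.H →L[ℂ] HilbertTensor p.1.H p.2.H) :=
  tensorRep p.1.π p.2.π

/-- The minimal (spatial) tensor product: the Hausdorff completion of the algebraic tensor product
for the topology given by the seminorms `x ↦ ‖(π ⊗ ρ) x‖`, where `π` and `ρ` run through the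
continuous `*`-representations of the factors on Hilbert spaces. If `A` and `B` are C⋆-algebras
this is the topology of the minimal C⋆-norm, as `‖x‖_min = ‖(π ⊗ ρ) x‖` for faithful `π`, `ρ`, and
`‖(π ⊗ ρ) x‖ ≤ ‖x‖_min` for all `π`, `ρ`. -/
abbrev MinTensor : Type u :=
  RepCompletion (F := A ⊗[ℂ] B) (H := fun p : Rep A × Rep B => HilbertTensor p.1.H p.2.H)
    (pairRep A B)

/-- The representations `(π ⊗ ρ) ⊗ σ` of the algebraic tensor product `(A ⊗ B) ⊗ C`. -/
abbrev tripleRep (p : Rep A × Rep B × Rep C) :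
    (A ⊗[ℂ] B) ⊗[ℂ] C →⋆ₐ[ℂ]
      (HilbertTensor (HilbertTensor p.1.H p.2.1.H) p.2.2.H →L[ℂ]
        HilbertTensor (HilbertTensor p.1.H p.2.1.H) p.2.2.H) :=
  tensorRep (tensorRep p.1.π p.2.1.π) p.2.2.π

/-- The minimal (spatial) tensor product of three factors. -/
abbrev MinTensor₃ : Type u := RepCompletion (tripleRep A B C)

variable {A B C D}

/-- The elementary tensor `a ⊗ b`. -/
def tmul (a : A) (b : B) : MinTensor A B := RepCompletion.of (pairRep A B) (a ⊗ₜ b)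

theorem continuous_tensorRep {H K : Type u} [NormedAddCommGroup H] [InnerProductSpace ℂ H]
    [CompleteSpace H] [NormedAddCommGroup K] [InnerProductSpace ℂ K] [CompleteSpace K]
    (π : A →⋆ₐ[ℂ] (H →L[ℂ] H)) (hπ : Continuous π) (ρ : B →⋆ₐ[ℂ] (K →L[ℂ] K))
    (hρ : Continuous ρ) : Continuous fun x : WithReps (pairRep A B) => tensorRep π ρ x :=
  continuous_evalRep (pairRep A B) (⟨H, π, hπ⟩, ⟨K, ρ, hρ⟩)

theorem continuous_ampLeft (H K : Type u) [NormedAddCommGroup H] [InnerProductSpace ℂ H]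
    [CompleteSpace H] [NormedAddCommGroup K] [InnerProductSpace ℂ K] [CompleteSpace K] :
    Continuous (ampLeft H K) :=
  map_continuous (ampLeft H K)

theorem continuous_ampRight (H K : Type u) [NormedAddCommGroup H] [InnerProductSpace ℂ H]
    [CompleteSpace H] [NormedAddCommGroup K] [InnerProductSpace ℂ K] [CompleteSpace K] :
    Continuous (ampRight H K) :=
  map_continuous (ampRight H K)

/-- The tensor product `f ⊗ g` of two continuous `*`-homomorphisms. -/
def MinTensor.map (f : A →⋆ₐ[ℂ] C) (hf : Continuous f) (g : B →⋆ₐ[ℂ] D) (hg : Continuous g) :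
    MinTensor A B →⋆ₐ[ℂ] MinTensor C D :=
  RepCompletion.map (pairRep A B) (pairRep C D) (algMap f g) fun j =>
    (continuous_tensorRep (j.1.π.comp f) (j.1.continuous_π.comp hf) (j.2.π.comp g)
      (j.2.continuous_π.comp hg)).congr fun x => (tensorRep_algMap j.1.π j.2.π f g x).symm

theorem MinTensor.map_tmul (f : A →⋆ₐ[ℂ] C) (hf : Continuous f) (g : B →⋆ₐ[ℂ] D)
    (hg : Continuous g) (a : A) (b : B) :
    MinTensor.map f hf g hg (tmul a b) = tmul (f a) (g b) :=
  RepCompletion.map_of _ _ _ _ _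

variable (A B C)

/-- The homomorphism `x ↦ x ⊗ 1` from `A ⊗ B` to `A ⊗ B ⊗ C`. -/
def leg₁₂ : MinTensor A B →⋆ₐ[ℂ] MinTensor₃ A B C :=
  RepCompletion.map (pairRep A B) (tripleRep A B C) inclLeft fun j => by
    refine ((continuous_ampLeft (HilbertTensor j.1.H j.2.1.H) j.2.2.H).comp
      (continuous_tensorRep j.1.π j.1.continuous_π j.2.1.π j.2.1.continuous_π)).congr fun x => ?_
    refine Eq.trans ?_ (tensorRep_tmul (tensorRep j.1.π j.2.1.π) j.2.2.π _ _).symm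
    rw [map_one]
    rfl

/-- The homomorphism `x ↦ 1 ⊗ x` from `B ⊗ C` to `A ⊗ B ⊗ C`. -/
def leg₂₃ : MinTensor B C →⋆ₐ[ℂ] MinTensor₃ A B C :=
  RepCompletion.map (pairRep B C) (tripleRep A B C) (algMap inclRight (StarAlgHom.id ℂ C))
    fun j => by
      have hc : Continuous fun b : B => (tensorRep j.1.π j.2.1.π) (inclRight b) := by
        refine ((continuous_ampRight j.1.H j.2.1.H).comp j.2.1.continuous_π).congr fun b => ?_
        refine Eq.trans ?_ (tensorRep_tmul j.1.π j.2.1.π _ _).symm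
        rw [map_one]
        rfl
      refine (continuous_tensorRep (A := B) (B := C) ((tensorRep j.1.π j.2.1.π).comp inclRight) hc
        j.2.2.π j.2.2.continuous_π).congr fun x => ?_
      exact (tensorRep_algMap (tensorRep j.1.π j.2.1.π) j.2.2.π inclRight
        (StarAlgHom.id ℂ C) x).symm

/-- The homomorphism `a ↦ a ⊗ 1 ⊗ 1`. -/
def leg₁ : A →⋆ₐ[ℂ] MinTensor₃ A B C :=
  (RepCompletion.of (tripleRep A B C)).comp (inclLeft.comp inclLeft)

/-- The homomorphism `c ↦ 1 ⊗ 1 ⊗ c`. -/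
def leg₃ : C →⋆ₐ[ℂ] MinTensor₃ A B C :=
  (RepCompletion.of (tripleRep A B C)).comp inclRight

variable {A B C}

theorem leg₁₂_of (x : A ⊗[ℂ] B) :
    leg₁₂ A B C (RepCompletion.of _ x) = RepCompletion.of (tripleRep A B C) (x ⊗ₜ 1) :=
  RepCompletion.map_of _ _ _ _ _

theorem leg₂₃_of (x : B ⊗[ℂ] C) :
    leg₂₃ A B C (RepCompletion.of _ x) =
      RepCompletion.of (tripleRep A B C) (algMap inclRight (StarAlgHom.id ℂ C) x) :=
  RepCompletion.map_of _ _ _ _ _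

theorem leg₁₂_commute_leg₃ (x : MinTensor A B) (c : C) :
    Commute (leg₁₂ A B C x) (leg₃ A B C c) := by
  have hcont : Continuous (leg₁₂ A B C) := RepCompletion.continuous_map _ _ _ _
  refine (RepCompletion.dense_range_of (pairRep A B)).induction_on
    (p := fun x => Commute (leg₁₂ A B C x) (leg₃ A B C c)) x
    (isClosed_eq (hcont.mul continuous_const) (continuous_const.mul hcont)) fun a => ?_
  rw [leg₁₂_of, leg₃]
  refine Commute.map (f := RepCompletion.of (tripleRep A B C)) (x := a ⊗ₜ[ℂ] (1 : C))
    (y := (1 : A ⊗[ℂ] B) ⊗ₜ[ℂ] c) ?_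
  simp [Commute, SemiconjBy, Algebra.TensorProduct.tmul_mul_tmul]

theorem leg₁_commute_leg₂₃ (a : A) (x : MinTensor B C) :
    Commute (leg₁ A B C a) (leg₂₃ A B C x) := by
  have hcont : Continuous (leg₂₃ A B C) := RepCompletion.continuous_map _ _ _ _
  refine (RepCompletion.dense_range_of (pairRep B C)).induction_on
    (p := fun x => Commute (leg₁ A B C a) (leg₂₃ A B C x)) x
    (isClosed_eq (continuous_const.mul hcont) (hcont.mul continuous_const)) fun y => ?_
  rw [leg₂₃_of, leg₁]
  refine Commute.map (f := RepCompletion.of (tripleRep A B C))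
    (x := (a ⊗ₜ[ℂ] (1 : B)) ⊗ₜ[ℂ] (1 : C)) ?_
  induction y using TensorProduct.induction_on with
  | zero => rw [map_zero]; exact Commute.zero_right _
  | add y z hy hz => rw [map_add]; exact hy.add_right hz
  | tmul b c =>
    change Commute _ (((1 : A) ⊗ₜ[ℂ] b) ⊗ₜ[ℂ] c)
    simp [Commute, SemiconjBy, Algebra.TensorProduct.tmul_mul_tmul]

/-- The homomorphism `a ⊗ b ↦ Δ(a) ⊗ b` on the algebraic tensor product. -/
def comulIdAlg (Δ : A →⋆ₐ[ℂ] MinTensor A A) : A ⊗[ℂ] A →⋆ₐ[ℂ] MinTensor₃ A A A :=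
  liftCommute ((leg₁₂ A A A).comp Δ) (leg₃ A A A) fun a b => leg₁₂_commute_leg₃ (Δ a) b

/-- The homomorphism `a ⊗ b ↦ a ⊗ Δ(b)` on the algebraic tensor product. -/
def idComulAlg (Δ : A →⋆ₐ[ℂ] MinTensor A A) : A ⊗[ℂ] A →⋆ₐ[ℂ] MinTensor₃ A A A :=
  liftCommute (leg₁ A A A) ((leg₂₃ A A A).comp Δ) fun a b => leg₁_commute_leg₂₃ a (Δ b)

/-- The map `Δ ⊗ id`: the extension of `a ⊗ b ↦ Δ(a) ⊗ b` by continuity. -/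
def comulId (Δ : A →⋆ₐ[ℂ] MinTensor A A) : MinTensor A A → MinTensor₃ A A A :=
  Completion.extension (α := WithReps (pairRep A A)) (comulIdAlg Δ)

/-- The map `id ⊗ Δ`: the extension of `a ⊗ b ↦ a ⊗ Δ(b)` by continuity. -/
def idComul (Δ : A →⋆ₐ[ℂ] MinTensor A A) : MinTensor A A → MinTensor₃ A A A :=
  Completion.extension (α := WithReps (pairRep A A)) (idComulAlg Δ)

end MinTensor

/-! ### σ-C⋆-algebras and quantum groups -/

section QuantumGroup

/-- The inverse limit, in the category of topological star algebras, of a sequence of C⋆-algebras: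
the algebra of all coherent sequences with the topology of the product. -/
def inverseLimit {A : ℕ → Type u} [∀ n, CStarAlgebra (A n)] (θ : ∀ n, A (n + 1) →⋆ₐ[ℂ] A n) :
    StarSubalgebra ℂ (∀ n, A n) where
  carrier := {a | ∀ n, θ n (a (n + 1)) = a n}
  mul_mem' ha hb n := by simp [ha n, hb n]
  add_mem' ha hb n := by simp [ha n, hb n]
  algebraMap_mem' c n := by simp [Pi.algebraMap_apply, AlgHomClass.commutes]
  star_mem' ha n := by simp [map_star, ha n]

/-- The canonical projection of the inverse limit. -/
def proj {A : ℕ → Type u} [∀ n, CStarAlgebra (A n)] (θ : ∀ n, A (n + 1) →⋆ₐ[ℂ] A n) (n : ℕ) :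
    inverseLimit θ →⋆ₐ[ℂ] A n where
  toFun a := a.1 n
  map_one' := rfl
  map_mul' _ _ := rfl
  map_zero' := rfl
  map_add' _ _ := rfl
  commutes' _ := rfl
  map_star' _ := rfl

theorem continuous_proj {A : ℕ → Type u} [∀ n, CStarAlgebra (A n)]
    (θ : ∀ n, A (n + 1) →⋆ₐ[ℂ] A n) (n : ℕ) : Continuous (proj θ n) :=
  (continuous_apply n).comp continuous_subtype_val

variable (A : Type u) [Ring A] [StarRing A] [Algebra ℂ A] [StarModule ℂ A] [TopologicalSpace A]

/-- A unital σ-C⋆-algebra: a topological star algebra isomorphic to the inverse limit of a sequence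
of C⋆-algebras. -/
def IsSigmaCStarAlgebra : Prop :=
  ∃ (B : ℕ → Type u) (_ : ∀ n, CStarAlgebra (B n)) (θ : ∀ n, B (n + 1) →⋆ₐ[ℂ] B n)
    (e : A ≃⋆ₐ[ℂ] inverseLimit θ), Continuous e ∧ Continuous e.symm

variable {A}

/-- The axioms of a comultiplication: coassociativity `(Δ ⊗ id)Δ = (id ⊗ Δ)Δ`, and density of the
linear spans of `Δ(A)(A ⊗ 1)` and of `Δ(A)(1 ⊗ A)` in `A ⊗ A`. -/
def IsComultiplication (Δ : A →⋆ₐ[ℂ] MinTensor A A) : Prop :=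
  (∀ a, comulId Δ (Δ a) = idComul Δ (Δ a)) ∧
  Dense (Submodule.span ℂ {x | ∃ a b, x = Δ a * tmul b 1} : Set (MinTensor A A)) ∧
  Dense (Submodule.span ℂ {x | ∃ a b, x = Δ a * tmul 1 b} : Set (MinTensor A A))

/-- `(A, Δ)` is a C⋆-compact quantum group. -/
def IsCompactQuantumGroup (A : Type u) [CStarAlgebra A] (Δ : A →⋆ₐ[ℂ] MinTensor A A) : Prop :=
  IsComultiplication Δ

/-- `(A, Δ)` is a σ-C⋆-quantum group. Continuity of `Δ`, which is automatic for `*`-homomorphisms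
out of a σ-C⋆-algebra, is made explicit. -/
def IsSigmaCStarQuantumGroup (A : Type u) [Ring A] [StarRing A] [Algebra ℂ A]
    [StarModule ℂ A] [TopologicalSpace A] (Δ : A →⋆ₐ[ℂ] MinTensor A A) : Prop :=
  IsSigmaCStarAlgebra A ∧ Continuous Δ ∧ IsComultiplication Δ

section Systems

variable {A : ℕ → Type u} [∀ n, CStarAlgebra (A n)] (θ : ∀ n, A (n + 1) →⋆ₐ[ℂ] A n)

/-- Continuity of the connecting homomorphisms, which is automatic. -/
theorem continuous_connecting (n : ℕ) : Continuous (θ n) :=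
  AddMonoidHomClass.continuous_of_bound (θ n) 1 fun x => by
    simpa using NonUnitalStarAlgHom.norm_apply_le (θ n) x

/-- The connecting homomorphism `θ_n ⊗ θ_n`. -/
def tensorConnecting (n : ℕ) :
    MinTensor (A (n + 1)) (A (n + 1)) →⋆ₐ[ℂ] MinTensor (A n) (A n) :=
  MinTensor.map (θ n) (continuous_connecting θ n) (θ n) (continuous_connecting θ n)

/-- The homomorphism `p_n ⊗ p_n`, where `p_n` is the projection of the inverse limit. -/
def tensorProj (n : ℕ) :
    MinTensor (inverseLimit θ) (inverseLimit θ) →⋆ₐ[ℂ] MinTensor (A n) (A n) :=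
  MinTensor.map (proj θ n) (continuous_proj θ n) (proj θ n) (continuous_proj θ n)

/-- The homomorphisms `Δ_n` form a morphism of inverse systems `{A_n} → {A_n ⊗ A_n}`. -/
def IsSystemMorphism (Δ : ∀ n, A n →⋆ₐ[ℂ] MinTensor (A n) (A n)) : Prop :=
  ∀ n a, tensorConnecting θ n (Δ (n + 1) a) = Δ n (θ n a)

/-- The homomorphism `Δlim` is the inverse limit of the homomorphisms `Δ_n`. -/
def IsLimitHom (Δ : ∀ n, A n →⋆ₐ[ℂ] MinTensor (A n) (A n))
    (Δlim : inverseLimit θ →⋆ₐ[ℂ] MinTensor (inverseLimit θ) (inverseLimit θ)) : Prop :=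
  ∀ n a, tensorProj θ n (Δlim a) = Δ n (proj θ n a)

/-- The canonical map identifies `A ⊗ A`, where `A` is the inverse limit of the `A_n`, with the
inverse limit of the `A_n ⊗ A_n`: it is a homeomorphism onto the coherent sequences. -/
def TensorIsInverseLimit : Prop :=
  Topology.IsEmbedding (fun x n => tensorProj θ n x :
      MinTensor (inverseLimit θ) (inverseLimit θ) → ∀ n, MinTensor (A n) (A n)) ∧
    Set.range (fun x n => tensorProj θ n x :
      MinTensor (inverseLimit θ) (inverseLimit θ) → ∀ n, MinTensor (A n) (A n)) =
        {y | ∀ n, tensorConnecting θ n (y (n + 1)) = y n}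

end Systems

end QuantumGroup

/-! ### The universal C⋆-algebra `C(SU_q(n))` -/

section FreeStar

/-- The free unital `*`-algebra on a set `X`: the free algebra on two copies of `X`, the second one
for the formal adjoints. -/
def FreeStar (X : Type) : Type := FreeAlgebra ℂ (X ⊕ X)

variable {X : Type}

instance : Ring (FreeStar X) := inferInstanceAs (Ring (FreeAlgebra ℂ (X ⊕ X)))
instance : Algebra ℂ (FreeStar X) := inferInstanceAs (Algebra ℂ (FreeAlgebra ℂ (X ⊕ X)))

/-- The generators and their formal adjoints. -/
def FreeStar.ι (x : X ⊕ X) : FreeStar X := FreeAlgebra.ι ℂ x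

/-- The opposite algebra of `FreeStar X` with the conjugate scalar multiplication. -/
def FreeStarConj (X : Type) : Type := (FreeStar X)ᵐᵒᵖ

instance : Ring (FreeStarConj X) := inferInstanceAs (Ring (FreeStar X)ᵐᵒᵖ)

instance : Algebra ℂ (FreeStarConj X) :=
  ((algebraMap ℂ (FreeStar X)ᵐᵒᵖ).comp (starRingEnd ℂ)).toAlgebra'
    fun c x => Algebra.commutes (A := (FreeStar X)ᵐᵒᵖ) (starRingEnd ℂ c) x

/-- The involution, as a homomorphism into the conjugate opposite algebra. -/
def freeStarHom (X : Type) : FreeStar X →ₐ[ℂ] FreeStarConj X :=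
  (FreeAlgebra.lift ℂ fun x => (MulOpposite.op (FreeStar.ι x.swap) : (FreeStar X)ᵐᵒᵖ) :
    FreeAlgebra ℂ (X ⊕ X) →ₐ[ℂ] FreeStarConj X)

instance : Star (FreeStar X) := ⟨fun x => MulOpposite.unop (freeStarHom X x)⟩

theorem freeStar_star_mul (x y : FreeStar X) : star (x * y) = star y * star x :=
  congrArg MulOpposite.unop (map_mul (freeStarHom X) x y)

theorem freeStar_star_add (x y : FreeStar X) : star (x + y) = star x + star y :=
  congrArg MulOpposite.unop (map_add (freeStarHom X) x y)

theorem freeStar_star_algebraMap (c : ℂ) :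
    star (algebraMap ℂ (FreeStar X) c) = algebraMap ℂ (FreeStar X) (star c) :=
  congrArg MulOpposite.unop ((freeStarHom X).commutes c)

theorem freeStar_star_ι (x : X ⊕ X) :
    star (FreeStar.ι x) = FreeStar.ι x.swap :=
  congrArg (MulOpposite.unop (α := FreeStar X)) (FreeAlgebra.lift_ι_apply (A := FreeStarConj X)
    (fun x : X ⊕ X => (MulOpposite.op (FreeStar.ι x.swap) : (FreeStar X)ᵐᵒᵖ)) x)

theorem freeStar_induction {P : FreeStar X → Prop} (hc : ∀ c, P (algebraMap ℂ (FreeStar X) c))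
    (hι : ∀ x, P (FreeStar.ι x))
    (hm : ∀ x y, P x → P y → P (x * y)) (ha : ∀ x y, P x → P y → P (x + y)) (x : FreeStar X) :
    P x :=
  FreeAlgebra.induction (motive := P) ℂ (X ⊕ X) hc hι hm ha x

instance : StarRing (FreeStar X) where
  star_involutive x := by
    induction x using freeStar_induction with
    | hc c => rw [freeStar_star_algebraMap, freeStar_star_algebraMap, star_star]
    | hι x => rw [freeStar_star_ι, freeStar_star_ι, Sum.swap_swap]
    | hm x y hx hy => rw [freeStar_star_mul, freeStar_star_mul, hx, hy]
    | ha x y hx hy => rw [freeStar_star_add, freeStar_star_add, hx, hy]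
  star_mul := freeStar_star_mul
  star_add := freeStar_star_add

instance : StarModule ℂ (FreeStar X) where
  star_smul c x := by
    rw [Algebra.smul_def, star_mul, freeStar_star_algebraMap, Algebra.smul_def,
      Algebra.commutes]

/-- The generator belonging to `x`. -/
def FreeStar.gen (x : X) : FreeStar X := FreeStar.ι (Sum.inl x)

/-- The `*`-homomorphism that maps the generators to given elements of a star algebra. -/
def FreeStar.lift {B : Type*} [Ring B] [StarRing B] [Algebra ℂ B] [StarModule ℂ B] (v : X → B) :
    FreeStar X →⋆ₐ[ℂ] B where
  __ := (FreeAlgebra.lift ℂ (Sum.elim v fun x => star (v x)) : FreeAlgebra ℂ (X ⊕ X) →ₐ[ℂ] B)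
  map_star' x := by
    let φ : FreeStar X →ₐ[ℂ] B :=
      (FreeAlgebra.lift ℂ (Sum.elim v fun x => star (v x)) : FreeAlgebra ℂ (X ⊕ X) →ₐ[ℂ] B)
    have hφ : ∀ x, φ (FreeStar.ι x) =
      Sum.elim v (fun x => star (v x)) x := FreeAlgebra.lift_ι_apply _
    change φ (star x) = star (φ x)
    induction x using freeStar_induction with
    | hc c =>
      rw [freeStar_star_algebraMap, AlgHom.commutes, AlgHom.commutes, algebraMap_star_comm]
    | hι x => rw [freeStar_star_ι, hφ, hφ]; cases x <;> simp
    | hm x y hx hy => rw [star_mul, map_mul, map_mul, star_mul, hx, hy]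
    | ha x y hx hy => rw [star_add, map_add, map_add, star_add, hx, hy]

theorem FreeStar.lift_ι {B : Type*} [Ring B] [StarRing B] [Algebra ℂ B] [StarModule ℂ B]
    (v : X → B) (x : X ⊕ X) :
    FreeStar.lift v (FreeStar.ι x) = Sum.elim v (fun x => star (v x)) x :=
  FreeAlgebra.lift_ι_apply (Sum.elim v fun x => star (v x)) x

theorem FreeStar.lift_gen {B : Type*} [Ring B] [StarRing B] [Algebra ℂ B] [StarModule ℂ B]
    (v : X → B) (x : X) : FreeStar.lift v (FreeStar.gen x) = v x :=
  FreeAlgebra.lift_ι_apply (Sum.elim v fun x => star (v x)) (Sum.inl x)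

end FreeStar

section SUq

/-- The number of inversions of a tuple. -/
def inversions {n : ℕ} (i : Fin n → Fin n) : ℕ :=
  (Finset.univ.filter fun p : Fin n × Fin n => p.1 < p.2 ∧ i p.2 < i p.1).card

open Classical in
/-- The coefficient `E_{i₁ … iₙ}`: zero unless the indices are distinct, and then `(-q)^ℓ` with `ℓ`
the number of inversions. -/
def coeffE (q : ℝ) {n : ℕ} (i : Fin n → Fin n) : ℂ :=
  if Function.Injective i then ((-q : ℝ) : ℂ) ^ inversions i else 0

/-- The defining relations of `C(SU_q(n))` for a matrix `u` of elements of a unital star algebra. -/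
structure SUqRelations (q : ℝ) {n : ℕ} {B : Type*} [Ring B] [StarRing B] [Algebra ℂ B]
    (u : Fin n → Fin n → B) : Prop where
  mul_star : ∀ i j, ∑ k, u i k * star (u j k) = if i = j then 1 else 0
  star_mul : ∀ i j, ∑ k, star (u k i) * u k j = if i = j then 1 else 0
  det : ∀ j : Fin n → Fin n,
    ∑ i : Fin n → Fin n, coeffE q i • (List.ofFn fun k => u (j k) (i k)).prod =
      coeffE q j • (1 : B)

theorem SUqRelations.norm_le_one {q : ℝ} {n : ℕ} {B : Type*} [CStarAlgebra B]
    {u : Fin n → Fin n → B} (h : SUqRelations q u) (i j : Fin n) : ‖u i j‖ ≤ 1 := by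
  let _ := CStarAlgebra.spectralOrder B
  let _ := CStarAlgebra.spectralOrderedRing B
  have h1 : u i j * star (u i j) ≤ 1 := by
    have := h.mul_star i i
    rw [if_pos rfl] at this
    rw [← this]
    exact Finset.single_le_sum (f := fun k => u i k * star (u i k))
      (fun k _ => mul_star_self_nonneg _) (Finset.mem_univ j)
  have h2 := CStarAlgebra.norm_le_norm_of_nonneg_of_le (mul_star_self_nonneg (u i j)) h1
  rw [CStarRing.norm_self_mul_star] at h2
  have h3 : ‖(1 : B)‖ ≤ 1 := by
    rcases subsingleton_or_nontrivial B with _ | _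
    · rw [Subsingleton.elim (1 : B) 0, norm_zero]; exact zero_le_one
    · rw [CStarRing.norm_one]
  nlinarith [norm_nonneg (u i j)]

variable (q : ℝ) (n : ℕ)

/-- The free `*`-algebra on the generators `u_{ij}`, to be equipped with the universal
C⋆-seminorm. -/
@[nolint unusedArguments]
def PreSUq (_q : ℝ) (n : ℕ) : Type := FreeStar (Fin n × Fin n)

instance : Ring (PreSUq q n) := inferInstanceAs (Ring (FreeStar (Fin n × Fin n)))
instance : StarRing (PreSUq q n) := inferInstanceAs (StarRing (FreeStar (Fin n × Fin n)))
instance : Algebra ℂ (PreSUq q n) := inferInstanceAs (Algebra ℂ (FreeStar (Fin n × Fin n)))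
instance : StarModule ℂ (PreSUq q n) :=
  inferInstanceAs (StarModule ℂ (FreeStar (Fin n × Fin n)))

variable {q n}

/-- The `*`-homomorphism on the free `*`-algebra that maps the generators to the entries of `u`. -/
def PreSUq.eval {B : Type*} [Ring B] [StarRing B] [Algebra ℂ B] [StarModule ℂ B]
    (u : Fin n → Fin n → B) : PreSUq q n →⋆ₐ[ℂ] B :=
  FreeStar.lift fun p : Fin n × Fin n => u p.1 p.2

variable (q n)

/-- The norms `‖u(x)‖` of an element of the free `*`-algebra in all families `u` of elements of
C⋆-algebras that satisfy the relations. -/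
def suqNorms (x : PreSUq q n) : Set ℝ :=
  {r | ∃ (B : Type) (_ : CStarAlgebra B) (u : Fin n → Fin n → B), SUqRelations q u ∧
    r = ‖PreSUq.eval (q := q) u x‖}

/-- The universal C⋆-seminorm on the free `*`-algebra. -/
def suqSeminorm (x : PreSUq q n) : ℝ := sSup (suqNorms q n x)

variable {q n}

theorem exists_norm_bound (x : FreeStar (Fin n × Fin n)) :
    ∃ C : ℝ, ∀ (B : Type) (_ : CStarAlgebra B) (u : Fin n → Fin n → B),
      SUqRelations q u → ‖FreeStar.lift (fun p : Fin n × Fin n => u p.1 p.2) x‖ ≤ C := by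
  induction x using freeStar_induction with
  | hc c =>
    refine ⟨‖c‖, fun B _ u _ => ?_⟩
    rw [AlgHomClass.commutes, Algebra.algebraMap_eq_smul_one]
    refine (norm_smul_le _ _).trans (mul_le_of_le_one_right (norm_nonneg _) ?_)
    rcases subsingleton_or_nontrivial B with _ | _
    · rw [Subsingleton.elim (1 : B) 0, norm_zero]; exact zero_le_one
    · rw [CStarRing.norm_one]
  | hι x =>
    refine ⟨1, fun B _ u hu => ?_⟩
    rw [FreeStar.lift_ι]
    rcases x with x | x
    · exact hu.norm_le_one _ _
    · exact (norm_star _).le.trans (hu.norm_le_one _ _)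
  | hm x y hx hy =>
    obtain ⟨C, hC⟩ := hx
    obtain ⟨D, hD⟩ := hy
    refine ⟨C * D, fun B _ u hu => ?_⟩
    rw [map_mul]
    exact (norm_mul_le _ _).trans (mul_le_mul (hC B _ u hu) (hD B _ u hu) (norm_nonneg _)
      ((norm_nonneg _).trans (hC B _ u hu)))
  | ha x y hx hy =>
    obtain ⟨C, hC⟩ := hx
    obtain ⟨D, hD⟩ := hy
    refine ⟨C + D, fun B _ u hu => ?_⟩
    rw [map_add]
    exact (norm_add_le _ _).trans (add_le_add (hC B _ u hu) (hD B _ u hu))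

theorem suqNorms_bddAbove (x : PreSUq q n) : BddAbove (suqNorms q n x) := by
  obtain ⟨C, hC⟩ := exists_norm_bound (q := q) (n := n) x
  exact ⟨C, by rintro r ⟨B, _, u, hu, rfl⟩; exact hC B _ u hu⟩

theorem norm_le_suqSeminorm {B : Type} [CStarAlgebra B] {u : Fin n → Fin n → B}
    (hu : SUqRelations q u) (x : PreSUq q n) :
    ‖PreSUq.eval (q := q) u x‖ ≤ suqSeminorm q n x :=
  le_csSup (suqNorms_bddAbove x) ⟨B, _, u, hu, rfl⟩

theorem suqSeminorm_nonneg (x : PreSUq q n) : 0 ≤ suqSeminorm q n x :=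
  Real.sSup_nonneg (by rintro r ⟨B, _, u, -, rfl⟩; exact norm_nonneg _)

theorem suqSeminorm_le {x : PreSUq q n} {C : ℝ} (hC : 0 ≤ C)
    (h : ∀ (B : Type) (_ : CStarAlgebra B) (u : Fin n → Fin n → B), SUqRelations q u →
      ‖PreSUq.eval (q := q) u x‖ ≤ C) : suqSeminorm q n x ≤ C :=
  Real.sSup_le (by rintro r ⟨B, _, u, hu, rfl⟩; exact h B _ u hu) hC

variable (q n)

/-- The universal seminorm as a ring seminorm. -/
def suqRingSeminorm : RingSeminorm (PreSUq q n) where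
  toFun := suqSeminorm q n
  map_zero' := le_antisymm
    (suqSeminorm_le le_rfl fun B _ u _ => by rw [map_zero, norm_zero]) (suqSeminorm_nonneg _)
  add_le' x y := suqSeminorm_le (add_nonneg (suqSeminorm_nonneg _) (suqSeminorm_nonneg _))
    fun B _ u hu => by
      rw [map_add]
      exact (norm_add_le _ _).trans
        (add_le_add (norm_le_suqSeminorm hu x) (norm_le_suqSeminorm hu y))
  neg' x := by
    refine le_antisymm ?_ ?_ <;> refine suqSeminorm_le (suqSeminorm_nonneg _) fun B _ u hu => ?_
    · rw [map_neg, norm_neg]; exact norm_le_suqSeminorm hu x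
    · refine le_trans (le_of_eq ?_) (norm_le_suqSeminorm hu (-x)); rw [map_neg, norm_neg]
  mul_le' x y := suqSeminorm_le (mul_nonneg (suqSeminorm_nonneg _) (suqSeminorm_nonneg _))
    fun B _ u hu => by
      rw [map_mul]
      exact (norm_mul_le _ _).trans (mul_le_mul (norm_le_suqSeminorm hu x)
        (norm_le_suqSeminorm hu y) (norm_nonneg _) (suqSeminorm_nonneg _))

instance : SeminormedRing (PreSUq q n) where
  __ := (suqRingSeminorm q n).toAddGroupSeminorm.toSeminormedAddCommGroup
  __ := (inferInstance : Ring (PreSUq q n))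
  norm_mul_le := (suqRingSeminorm q n).mul_le'

theorem norm_preSUq (x : PreSUq q n) : ‖x‖ = suqSeminorm q n x := rfl

instance : NormedAlgebra ℂ (PreSUq q n) where
  norm_smul_le c x := suqSeminorm_le (mul_nonneg (norm_nonneg _) (norm_nonneg _))
    fun B _ u hu => by
      rw [map_smul, norm_smul]
      exact mul_le_mul_of_nonneg_left (norm_le_suqSeminorm hu x) (norm_nonneg _)

theorem norm_star_preSUq (x : PreSUq q n) : ‖star x‖ ≤ ‖x‖ :=
  suqSeminorm_le (norm_nonneg _) fun B _ u hu => by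
    refine le_trans (le_of_eq ?_) (norm_le_suqSeminorm hu x)
    rw [← norm_star]
    exact congrArg _ ((map_star _ _).symm.trans (congrArg _ (star_star _)))

instance : NormedStarGroup (PreSUq q n) := ⟨norm_star_preSUq q n⟩

theorem norm_mul_self_preSUq (x : PreSUq q n) : ‖x‖ * ‖x‖ ≤ ‖star x * x‖ := by
  have : ‖x‖ ≤ √ ‖star x * x‖ := suqSeminorm_le (Real.sqrt_nonneg _) fun B _ u hu => by
    refine Real.le_sqrt_of_sq_le ?_
    rw [sq, ← CStarRing.norm_star_mul_self, ← map_star, ← map_mul]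
    exact norm_le_suqSeminorm hu _
  calc ‖x‖ * ‖x‖ ≤ √ ‖star x * x‖ * √ ‖star x * x‖ :=
        mul_le_mul this this (norm_nonneg _) (Real.sqrt_nonneg _)
    _ = _ := Real.mul_self_sqrt (norm_nonneg _)

instance : CStarRing (Completion (PreSUq q n)) where
  norm_mul_self_le x := Completion.induction_on x
    (isClosed_le (continuous_norm.mul continuous_norm)
      (continuous_norm.comp (continuous_star.mul continuous_id))) fun a => by
      rw [← coe_star, ← coe_mul, norm_coe, norm_coe]
      exact norm_mul_self_preSUq q n a

/-- The C⋆-algebra `C(SU_q(n))`: the universal C⋆-algebra given by the relations, constructed as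
the Hausdorff completion of the free `*`-algebra for the universal C⋆-seminorm. -/
def CSUq : Type := Completion (PreSUq q n)

instance : NormedRing (CSUq q n) := inferInstanceAs (NormedRing (Completion (PreSUq q n)))
instance : StarRing (CSUq q n) := inferInstanceAs (StarRing (Completion (PreSUq q n)))
instance : CompleteSpace (CSUq q n) := inferInstanceAs (CompleteSpace (Completion (PreSUq q n)))
instance : NormedAlgebra ℂ (CSUq q n) where
  __ := (inferInstanceAs (Algebra ℂ (Completion (PreSUq q n))) : Algebra ℂ (CSUq q n))
  norm_smul_le := norm_smul_le (α := ℂ) (β := Completion (PreSUq q n))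
instance : StarModule ℂ (CSUq q n) := inferInstanceAs (StarModule ℂ (Completion (PreSUq q n)))
instance : CStarRing (CSUq q n) := inferInstanceAs (CStarRing (Completion (PreSUq q n)))
instance : CStarAlgebra (CSUq q n) where

/-- The generators `u_{ij}` of `C(SU_q(n))`. -/
def CSUq.gen (i j : Fin n) : CSUq q n :=
  ((show PreSUq q n from FreeStar.gen (i, j)) : Completion (PreSUq q n))

end SUq

end

end SigmaCStar

open SigmaCStar

open scoped TensorProduct

namespace SigmaCStar

open UniformSpace (Completion)
open UniformSpace.Completion

universe u v w

noncomputable section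

set_option linter.unusedSectionVars false

/-! ### Extension of homomorphisms to completions -/

section CompletionLift

variable {F : Type u} [Ring F] [UniformSpace F] [IsUniformAddGroup F] [StarRing F]
  [ContinuousStar F] [IsTopologicalRing F] [Algebra ℂ F] [UniformContinuousConstSMul ℂ F]
  {C : Type v} [Ring C] [UniformSpace C] [IsUniformAddGroup C] [StarRing C] [ContinuousStar C]
  [IsTopologicalRing C] [Algebra ℂ C] [CompleteSpace C] [T0Space C]

/-! A minimal tensor product embeds into the product of the operator algebras of its defining
representations `π ⊗ ρ`, and so does the triple product. Equality, continuity and convergence can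
therefore be tested one representation at a time. In particular every `*`-homomorphism from a
C⋆-algebra into such a completion is continuous, because homomorphisms between C⋆-algebras are
contractive. With the constant inverse system this gives the statement on C⋆-compact quantum groups.

For an inverse limit `A` of C⋆-algebras with surjective connecting maps, the decisive fact is that a
continuous representation of `A` on a Hilbert space factors through some projection `p_n`
(`exists_rep_factor`). Otherwise there are elements of `ker p_n` with images of norm one, and these
tend to zero in `A`. Hence each defining seminorm of `A ⊗ A` is pulled back along some `p_n ⊗ p_n`,
and the canonical map into the product of the `A_n ⊗ A_n` is uniformly inducing. Its range is
complete, hence closed, and it is dense in the coherent sequences because each `p_n ⊗ p_n` has dense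
range (`IsLimitCone.range_squares`). This identifies `A ⊗ A` with the limit and yields `Δ` with its
uniqueness and continuity. Coassociativity and the density axioms are then checked at a single
level. Since `Δ ⊗ id` and `id ⊗ Δ` bracket triple tensor products differently, the former is
compared with the latter through the associativity unitary of Hilbert spaces.

For `C(SU_q(n))` the universal norm makes every relation valid in all models valid in the
completion. Products of solutions with commuting entries are solutions, which gives `Δ_n`. If `u` is
a solution then so is `diag(u, 1)`, which gives `θ_n`. The density axioms rest on the identities
`u_ij ⊗ 1 = ∑ Δ(u_ik)(1 ⊗ u_jk^*)` and `1 ⊗ u_ij^* = ∑ Δ(u_kj^*)(u_ki ⊗ 1)`. The elements `a` with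
`a ⊗ 1` in the span of `Δ(A)(1 ⊗ A)` form an algebra that contains all `u_ij`. It is not visibly
closed under adjoints, but the quantum determinant writes `u_ij^*` as a polynomial in the entries
(`SUqRelations.star_mem_adjoin`, where `q ≠ 0` enters), so the algebra is dense. The other span is
treated in the same way with the roles of the entries and their adjoints exchanged. -/

theorem uniformContinuous_starAlgHom (h : F →⋆ₐ[ℂ] C) (hc : Continuous h) :
    UniformContinuous h :=
  uniformContinuous_addMonoidHom_of_continuous (f := (h : F →+ C)) hc

/-- The extension of a continuous `*`-homomorphism to the completion. -/
def completionLift (h : F →⋆ₐ[ℂ] C) (hc : Continuous h) : Completion F →⋆ₐ[ℂ] C where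
  __ := extensionHom (h : F →+* C) hc
  commutes' c := by
    change Completion.extension h ((algebraMap ℂ F c : F) : Completion F) = _
    rw [extension_coe (uniformContinuous_starAlgHom h hc), AlgHomClass.commutes]
  map_star' x := by
    change Completion.extension h (star x) = star (Completion.extension h x)
    refine Completion.induction_on x (isClosed_eq
      (continuous_extension.comp continuous_star) continuous_extension.star) fun a => ?_
    have hu := uniformContinuous_starAlgHom h hc
    rw [← coe_star, extension_coe hu, extension_coe hu, map_star]

theorem completionLift_coe (h : F →⋆ₐ[ℂ] C) (hc : Continuous h) (x : F) :
    completionLift h hc (x : Completion F) = h x :=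
  extension_coe (uniformContinuous_starAlgHom h hc) x

theorem continuous_completionLift (h : F →⋆ₐ[ℂ] C) (hc : Continuous h) :
    Continuous (completionLift h hc) :=
  continuous_extension

end CompletionLift

/-- Homomorphisms of C⋆-algebras are continuous. -/
theorem continuous_cstarHom {A B : Type*} [CStarAlgebra A] [CStarAlgebra B] (φ : A →⋆ₐ[ℂ] B) :
    Continuous φ :=
  AddMonoidHomClass.continuous_of_bound φ 1 fun x => by
    simpa using NonUnitalStarAlgHom.norm_apply_le φ x

/-! ### The representations of `RepCompletion` -/

namespace RepCompletion

variable {F : Type u} [Ring F] [StarRing F] [Algebra ℂ F] [StarModule ℂ F]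
  {ι : Type v} {H : ι → Type w} [∀ i, NormedAddCommGroup (H i)]
  [∀ i, InnerProductSpace ℂ (H i)] [∀ i, CompleteSpace (H i)]
  (f : ∀ i, F →⋆ₐ[ℂ] (H i →L[ℂ] H i))

/-- The extension of a continuous `*`-homomorphism on `F` to the completion. -/
def lift {C : Type*} [Ring C] [UniformSpace C] [IsUniformAddGroup C] [StarRing C]
    [ContinuousStar C] [IsTopologicalRing C] [Algebra ℂ C] [CompleteSpace C] [T0Space C]
    (h : F →⋆ₐ[ℂ] C) (hc : Continuous fun x : WithReps f => h x) : RepCompletion f →⋆ₐ[ℂ] C :=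
  completionLift (show WithReps f →⋆ₐ[ℂ] C from h) hc

section lift

variable {C : Type*} [Ring C] [UniformSpace C] [IsUniformAddGroup C] [StarRing C]
    [ContinuousStar C] [IsTopologicalRing C] [Algebra ℂ C] [CompleteSpace C] [T0Space C]
    (h : F →⋆ₐ[ℂ] C) (hc : Continuous fun x : WithReps f => h x)

theorem lift_of (x : F) : lift f h hc (of f x) = h x :=
  completionLift_coe (show WithReps f →⋆ₐ[ℂ] C from h) hc x

theorem continuous_lift : Continuous (lift f h hc) :=
  continuous_completionLift (show WithReps f →⋆ₐ[ℂ] C from h) hc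

end lift

theorem eq_of_eq_on_range {X : Type*} [TopologicalSpace X] [T2Space X] {g g' : RepCompletion f → X}
    (hg : Continuous g) (hg' : Continuous g') (h : ∀ x, g (of f x) = g' (of f x)) : g = g' :=
  (dense_range_of f).equalizer hg hg' (funext h)

/-- The representation `f i` of the completion. -/
def rep (i : ι) : RepCompletion f →⋆ₐ[ℂ] (H i →L[ℂ] H i) :=
  lift f (f i) (continuous_evalRep f i)

theorem rep_of (i : ι) (x : F) : rep f i (of f x) = f i x := lift_of _ _ _ _

theorem continuous_rep (i : ι) : Continuous (rep f i) := continuous_lift _ _ _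

theorem isUniformInducing_evalRep :
    IsUniformInducing fun (x : WithReps f) i => evalRep f i x := by
  refine isUniformInducing_iff_uniformSpace.2 ?_
  change UniformSpace.comap _ (Pi.uniformSpace _) = (⨅ i, UniformSpace.comap (evalRep f i) _)
  rw [Pi.uniformSpace_eq, UniformSpace.comap_iInf]
  exact iInf_congr fun i => (UniformSpace.comap_comap ..).symm

/-- The uniformity of `WithReps f` is by definition the initial one for the representations, and an
inducing map extends to an inducing map on the completion. Everything that is later tested
representation by representation rests on this. -/
theorem isUniformInducing_rep : IsUniformInducing fun (x : RepCompletion f) i => rep f i x := by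
  have h := Completion.isUniformInducing_extension (isUniformInducing_evalRep f)
  -- The extension of the joint map agrees with the family of extended representations, since both
  -- are continuous and agree on the dense image of `F`.
  refine cast (congrArg _ ?_) h
  symm
  refine eq_of_eq_on_range f (continuous_pi fun i => continuous_rep f i)
    continuous_extension fun x => ?_
  refine Eq.trans ?_ (extension_coe (isUniformInducing_evalRep f).uniformContinuous _).symm
  exact funext fun i => rep_of f i x

theorem isEmbedding_rep : Topology.IsEmbedding fun (x : RepCompletion f) i => rep f i x :=
  (isUniformInducing_rep f).isUniformEmbedding.isEmbedding

variable {f} in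
theorem ext_rep {x y : RepCompletion f} (h : ∀ i, rep f i x = rep f i y) : x = y :=
  (isEmbedding_rep f).injective (funext h)

variable {f} in
theorem continuous_iff_rep {X : Type*} [TopologicalSpace X] {g : X → RepCompletion f} :
    Continuous g ↔ ∀ i, Continuous fun x => rep f i (g x) := by
  rw [(isEmbedding_rep f).continuous_iff, continuous_pi_iff]
  rfl

/-- Every `*`-homomorphism from a C⋆-algebra is continuous. -/
theorem continuous_of_cstarAlgebra {A : Type*} [CStarAlgebra A] (g : A →⋆ₐ[ℂ] RepCompletion f) :
    Continuous g :=
  -- Each coordinate is a homomorphism between C⋆-algebras, hence contractive.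
  continuous_iff_rep.2 fun i => continuous_cstarHom ((rep f i).comp g)

end RepCompletion

/-! ### Associativity of the Hilbert space tensor product -/

section HilbertAssoc

variable {H₁ H₂ H₃ : Type u} [NormedAddCommGroup H₁] [InnerProductSpace ℂ H₁]
  [NormedAddCommGroup H₂] [InnerProductSpace ℂ H₂]
  [NormedAddCommGroup H₃] [InnerProductSpace ℂ H₃]

/-- The closure of the range is a subspace, so it is enough to reach elementary tensors. These are
limits of images because `(a, b) ↦ a ⊗ b` is jointly continuous. -/
theorem denseRange_mapIsometry {K₁ K₂ : Type u} [NormedAddCommGroup K₁] [InnerProductSpace ℂ K₁]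
    [NormedAddCommGroup K₂] [InnerProductSpace ℂ K₂] (f : H₁ →ₗᵢ[ℂ] K₁) (g : H₂ →ₗᵢ[ℂ] K₂)
    (hf : DenseRange f) (hg : DenseRange g) : DenseRange (TensorProduct.mapIsometry f g) := by
  let R : Submodule ℂ (K₁ ⊗[ℂ] K₂) :=
    (LinearMap.range (TensorProduct.mapIsometry f g).toLinearMap).topologicalClosure
  have hR : IsClosed (R : Set (K₁ ⊗[ℂ] K₂)) := Submodule.isClosed_topologicalClosure _
  have hcont : Continuous fun p : K₁ × K₂ => p.1 ⊗ₜ[ℂ] p.2 :=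
    (TensorProduct.mkL ℂ K₁ K₂).continuous₂
  have key : ∀ x, x ∈ R := fun x => by
    induction x using TensorProduct.induction_on with
    | zero => exact R.zero_mem
    | add x y hx hy => exact R.add_mem hx hy
    | tmul a b =>
      have hd : DenseRange (Prod.map f g) := hf.prodMap hg
      refine hd.induction_on (p := fun p : K₁ × K₂ => p.1 ⊗ₜ[ℂ] p.2 ∈ R) (a, b)
        (hR.preimage hcont) fun p => ?_
      exact Submodule.le_topologicalClosure _ ⟨p.1 ⊗ₜ p.2, TensorProduct.map_tmul _ _ _ _⟩
  exact fun x => key x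

variable (H₁ H₂ H₃) in
/-- The embedding of the algebraic tensor product `(H₁ ⊗ H₂) ⊗ H₃`. -/
def hilbertTensorLeft : (H₁ ⊗[ℂ] H₂) ⊗[ℂ] H₃ →ₗᵢ[ℂ] HilbertTensor (HilbertTensor H₁ H₂) H₃ :=
  toComplₗᵢ.comp (TensorProduct.mapIsometry toComplₗᵢ LinearIsometry.id)

variable (H₁ H₂ H₃) in
/-- The embedding of the algebraic tensor product `H₁ ⊗ (H₂ ⊗ H₃)`. -/
def hilbertTensorRight : H₁ ⊗[ℂ] (H₂ ⊗[ℂ] H₃) →ₗᵢ[ℂ] HilbertTensor H₁ (HilbertTensor H₂ H₃) :=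
  toComplₗᵢ.comp (TensorProduct.mapIsometry LinearIsometry.id toComplₗᵢ)

theorem denseRange_hilbertTensorLeft : DenseRange (hilbertTensorLeft H₁ H₂ H₃) :=
  (denseRange_coe (α := HilbertTensor H₁ H₂ ⊗[ℂ] H₃)).comp
    (denseRange_mapIsometry _ _ denseRange_coe Function.surjective_id.denseRange)
    (continuous_coe _)

theorem denseRange_hilbertTensorRight : DenseRange (hilbertTensorRight H₁ H₂ H₃) :=
  (denseRange_coe (α := H₁ ⊗[ℂ] HilbertTensor H₂ H₃)).comp
    (denseRange_mapIsometry _ _ Function.surjective_id.denseRange denseRange_coe)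
    (continuous_coe _)

theorem norm_hilbertTensorRight_assoc (x : (H₁ ⊗[ℂ] H₂) ⊗[ℂ] H₃) :
    ‖(hilbertTensorRight H₁ H₂ H₃).toLinearMap (TensorProduct.assoc ℂ H₁ H₂ H₃ x)‖ =
      ‖(hilbertTensorLeft H₁ H₂ H₃).toLinearMap x‖ := by
  change ‖hilbertTensorRight H₁ H₂ H₃ (TensorProduct.assocIsometry ℂ H₁ H₂ H₃ x)‖ =
    ‖hilbertTensorLeft H₁ H₂ H₃ x‖
  rw [LinearIsometry.norm_map, LinearIsometry.norm_map, LinearIsometryEquiv.norm_map]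

variable (H₁ H₂ H₃) in
/-- The associativity isomorphism of the Hilbert space tensor product. -/
def hilbertAssoc :
    HilbertTensor (HilbertTensor H₁ H₂) H₃ ≃ₗᵢ[ℂ] HilbertTensor H₁ (HilbertTensor H₂ H₃) :=
  (TensorProduct.assoc ℂ H₁ H₂ H₃).extendOfIsometry
    (hilbertTensorLeft H₁ H₂ H₃).toLinearMap (hilbertTensorRight H₁ H₂ H₃).toLinearMap
    denseRange_hilbertTensorLeft denseRange_hilbertTensorRight norm_hilbertTensorRight_assoc

theorem hilbertAssoc_apply (x : (H₁ ⊗[ℂ] H₂) ⊗[ℂ] H₃) :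
    hilbertAssoc H₁ H₂ H₃ (hilbertTensorLeft H₁ H₂ H₃ x) =
      hilbertTensorRight H₁ H₂ H₃ (TensorProduct.assoc ℂ H₁ H₂ H₃ x) :=
  LinearEquiv.extendOfIsometry_eq _ _ _ denseRange_hilbertTensorLeft
    denseRange_hilbertTensorRight norm_hilbertTensorRight_assoc x

variable [CompleteSpace H₁] [CompleteSpace H₂] [CompleteSpace H₃]

theorem opTensor_hilbertTensorLeft (S : H₁ →L[ℂ] H₁) (T : H₂ →L[ℂ] H₂) (R : H₃ →L[ℂ] H₃)
    (a : H₁) (b : H₂) (c : H₃) :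
    opTensor (opTensor S T) R (hilbertTensorLeft H₁ H₂ H₃ ((a ⊗ₜ b) ⊗ₜ c)) =
      hilbertTensorLeft H₁ H₂ H₃ ((S a ⊗ₜ T b) ⊗ₜ R c) := by
  refine (opTensor_coe (opTensor S T) R
    (((a ⊗ₜ[ℂ] b : H₁ ⊗[ℂ] H₂) : HilbertTensor H₁ H₂) ⊗ₜ[ℂ] c)).trans ?_
  refine congrArg _ (Eq.trans (TensorProduct.map_tmul _ _ _ _) ?_)
  exact congrArg (· ⊗ₜ[ℂ] R c) (opTensor_coe S T (a ⊗ₜ b))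

theorem opTensor_hilbertTensorRight (S : H₁ →L[ℂ] H₁) (T : H₂ →L[ℂ] H₂) (R : H₃ →L[ℂ] H₃)
    (a : H₁) (b : H₂) (c : H₃) :
    opTensor S (opTensor T R) (hilbertTensorRight H₁ H₂ H₃ (a ⊗ₜ (b ⊗ₜ c))) =
      hilbertTensorRight H₁ H₂ H₃ (S a ⊗ₜ (T b ⊗ₜ R c)) := by
  refine (opTensor_coe S (opTensor T R)
    (a ⊗ₜ[ℂ] ((b ⊗ₜ[ℂ] c : H₂ ⊗[ℂ] H₃) : HilbertTensor H₂ H₃))).trans ?_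
  refine congrArg _ (Eq.trans (TensorProduct.map_tmul _ _ _ _) ?_)
  exact congrArg (S a ⊗ₜ[ℂ] ·) (opTensor_coe T R (b ⊗ₜ c))

/-- `MinTensor₃` is represented on left-bracketed Hilbert spaces, whereas `id ⊗ Δ` produces
operators on `H₁ ⊗ (H₂ ⊗ H₃)`; conjugation by the associator passes from one to the other. The two
sides agree on the dense algebraic tensors. -/
theorem conj_opTensor (S : H₁ →L[ℂ] H₁) (T : H₂ →L[ℂ] H₂) (R : H₃ →L[ℂ] H₃) :
    (hilbertAssoc H₁ H₂ H₃).conjStarAlgEquiv (opTensor (opTensor S T) R) =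
      opTensor S (opTensor T R) := by
  rw [← (hilbertAssoc H₁ H₂ H₃).conjStarAlgEquiv.eq_symm_apply]
  ext ξ
  change _ = (hilbertAssoc H₁ H₂ H₃).symm
    (opTensor S (opTensor T R) (hilbertAssoc H₁ H₂ H₃ ξ))
  rw [LinearIsometryEquiv.eq_symm_apply]
  refine denseRange_hilbertTensorLeft.induction_on (p := fun ξ => hilbertAssoc H₁ H₂ H₃
    (opTensor (opTensor S T) R ξ) = opTensor S (opTensor T R) (hilbertAssoc H₁ H₂ H₃ ξ)) ξ
    (isClosed_eq (by fun_prop) (by fun_prop)) fun x => ?_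
  have key : (hilbertAssoc H₁ H₂ H₃).toContinuousLinearEquiv.toContinuousLinearMap.toLinearMap ∘ₗ
      (opTensor (opTensor S T) R).toLinearMap ∘ₗ (hilbertTensorLeft H₁ H₂ H₃).toLinearMap =
      (opTensor S (opTensor T R)).toLinearMap ∘ₗ
      (hilbertAssoc H₁ H₂ H₃).toContinuousLinearEquiv.toContinuousLinearMap.toLinearMap ∘ₗ
      (hilbertTensorLeft H₁ H₂ H₃).toLinearMap := by
    refine TensorProduct.ext_threefold fun a b c => ?_
    change hilbertAssoc H₁ H₂ H₃ (opTensor (opTensor S T) R (hilbertTensorLeft H₁ H₂ H₃ _)) =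
      opTensor S (opTensor T R) (hilbertAssoc H₁ H₂ H₃ (hilbertTensorLeft H₁ H₂ H₃ _))
    rw [opTensor_hilbertTensorLeft, hilbertAssoc_apply, hilbertAssoc_apply,
      TensorProduct.assoc_tmul, TensorProduct.assoc_tmul, opTensor_hilbertTensorRight]
  exact LinearMap.congr_fun key x

end HilbertAssoc

/-! ### Representations of the minimal tensor products -/

section MinTensorRep

variable {A B C D : Type u}
  [Ring A] [StarRing A] [Algebra ℂ A] [StarModule ℂ A] [TopologicalSpace A]
  [Ring B] [StarRing B] [Algebra ℂ B] [StarModule ℂ B] [TopologicalSpace B]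
  [Ring C] [StarRing C] [Algebra ℂ C] [StarModule ℂ C] [TopologicalSpace C]
  [Ring D] [StarRing D] [Algebra ℂ D] [StarModule ℂ D] [TopologicalSpace D]
  {H K L : Type u} [NormedAddCommGroup H] [InnerProductSpace ℂ H] [CompleteSpace H]
  [NormedAddCommGroup K] [InnerProductSpace ℂ K] [CompleteSpace K]
  [NormedAddCommGroup L] [InnerProductSpace ℂ L] [CompleteSpace L]

/-- The tensor product of two continuous representations, on the minimal tensor product. -/
def MinTensor.rep (π : A →⋆ₐ[ℂ] (H →L[ℂ] H)) (hπ : Continuous π) (ρ : B →⋆ₐ[ℂ] (K →L[ℂ] K))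
    (hρ : Continuous ρ) :
    MinTensor A B →⋆ₐ[ℂ] (HilbertTensor H K →L[ℂ] HilbertTensor H K) :=
  RepCompletion.rep (pairRep A B) (⟨H, π, hπ⟩, ⟨K, ρ, hρ⟩)

/-- The tensor product of three continuous representations, on the minimal tensor product. -/
def MinTensor₃.rep (π : A →⋆ₐ[ℂ] (H →L[ℂ] H)) (hπ : Continuous π) (ρ : B →⋆ₐ[ℂ] (K →L[ℂ] K))
    (hρ : Continuous ρ) (σ : C →⋆ₐ[ℂ] (L →L[ℂ] L)) (hσ : Continuous σ) :
    MinTensor₃ A B C →⋆ₐ[ℂ]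
      (HilbertTensor (HilbertTensor H K) L →L[ℂ] HilbertTensor (HilbertTensor H K) L) :=
  RepCompletion.rep (tripleRep A B C) (⟨H, π, hπ⟩, ⟨K, ρ, hρ⟩, ⟨L, σ, hσ⟩)

variable (π : A →⋆ₐ[ℂ] (H →L[ℂ] H)) (hπ : Continuous π) (ρ : B →⋆ₐ[ℂ] (K →L[ℂ] K))
  (hρ : Continuous ρ) (σ : C →⋆ₐ[ℂ] (L →L[ℂ] L)) (hσ : Continuous σ)

theorem MinTensor.rep_of (x : A ⊗[ℂ] B) :
    MinTensor.rep π hπ ρ hρ (RepCompletion.of _ x) = tensorRep π ρ x :=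
  RepCompletion.rep_of _ _ _

theorem MinTensor.rep_tmul (a : A) (b : B) :
    MinTensor.rep π hπ ρ hρ (tmul a b) = opTensor (π a) (ρ b) :=
  (RepCompletion.rep_of _ _ _).trans (tensorRep_tmul _ _ _ _)

theorem MinTensor.continuous_rep : Continuous (MinTensor.rep π hπ ρ hρ) :=
  RepCompletion.continuous_rep _ _

theorem MinTensor₃.rep_of (x : (A ⊗[ℂ] B) ⊗[ℂ] C) :
    MinTensor₃.rep π hπ ρ hρ σ hσ (RepCompletion.of _ x) = tensorRep (tensorRep π ρ) σ x :=
  RepCompletion.rep_of _ _ _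

theorem MinTensor₃.continuous_rep : Continuous (MinTensor₃.rep π hπ ρ hρ σ hσ) :=
  RepCompletion.continuous_rep _ _

theorem continuous_leg₁₂ : Continuous (leg₁₂ A B C) := RepCompletion.continuous_map _ _ _ _

theorem continuous_leg₂₃ : Continuous (leg₂₃ A B C) := RepCompletion.continuous_map _ _ _ _

theorem MinTensor₃.rep_leg₁₂ (x : MinTensor A B) :
    MinTensor₃.rep π hπ ρ hρ σ hσ (leg₁₂ A B C x) =
      opTensor (MinTensor.rep π hπ ρ hρ x) 1 := by
  refine congrFun (RepCompletion.eq_of_eq_on_range (pairRep A B)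
    (g := fun x => MinTensor₃.rep π hπ ρ hρ σ hσ (leg₁₂ A B C x))
    (g' := fun x => ampLeft _ _ (MinTensor.rep π hπ ρ hρ x))
    ((continuous_rep π hπ ρ hρ σ hσ).comp continuous_leg₁₂)
    ((continuous_ampLeft _ _).comp (MinTensor.continuous_rep π hπ ρ hρ)) fun x => ?_) x
  rw [leg₁₂_of, MinTensor₃.rep_of, MinTensor.rep_of, tensorRep_tmul, map_one]
  rfl

theorem MinTensor₃.rep_leg₃ (c : C) :
    MinTensor₃.rep π hπ ρ hρ σ hσ (leg₃ A B C c) = opTensor 1 (σ c) := by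
  change MinTensor₃.rep π hπ ρ hρ σ hσ (RepCompletion.of _ (1 ⊗ₜ c)) = _
  rw [MinTensor₃.rep_of, tensorRep_tmul, map_one]

theorem MinTensor₃.rep_leg₁ (a : A) :
    MinTensor₃.rep π hπ ρ hρ σ hσ (leg₁ A B C a) = opTensor (opTensor (π a) 1) 1 := by
  change MinTensor₃.rep π hπ ρ hρ σ hσ (RepCompletion.of _ ((a ⊗ₜ 1) ⊗ₜ 1)) = _
  rw [MinTensor₃.rep_of, tensorRep_tmul, tensorRep_tmul, map_one, map_one]

theorem MinTensor₃.conj_rep_leg₂₃ (x : MinTensor B C) :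
    (hilbertAssoc H K L).conjStarAlgEquiv (MinTensor₃.rep π hπ ρ hρ σ hσ (leg₂₃ A B C x)) =
      opTensor 1 (MinTensor.rep ρ hρ σ hσ x) := by
  refine congrFun (RepCompletion.eq_of_eq_on_range (pairRep B C)
    (g := fun x => (hilbertAssoc H K L).conjStarAlgEquiv
      (MinTensor₃.rep π hπ ρ hρ σ hσ (leg₂₃ A B C x)))
    (g' := fun x => ampRight _ _ (MinTensor.rep ρ hρ σ hσ x))
    ((hilbertAssoc H K L).toContinuousLinearEquiv.conjContinuousAlgEquiv.continuous.comp
      ((continuous_rep π hπ ρ hρ σ hσ).comp continuous_leg₂₃))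
    ((continuous_ampRight _ _).comp (MinTensor.continuous_rep ρ hρ σ hσ)) fun x => ?_) x
  rw [leg₂₃_of, MinTensor₃.rep_of, MinTensor.rep_of]
  have key : (hilbertAssoc H K L).conjStarAlgEquiv.toAlgEquiv.toLinearMap ∘ₗ
      (tensorRep (tensorRep π ρ) σ).toAlgHom.toLinearMap ∘ₗ
      (algMap inclRight (StarAlgHom.id ℂ C) : B ⊗[ℂ] C →⋆ₐ[ℂ] (A ⊗[ℂ] B) ⊗[ℂ] C
        ).toAlgHom.toLinearMap =
      (ampRight H (HilbertTensor K L)).toAlgHom.toLinearMap ∘ₗ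
      (tensorRep ρ σ).toAlgHom.toLinearMap := by
    refine TensorProduct.ext' fun b c => ?_
    change (hilbertAssoc H K L).conjStarAlgEquiv
      (tensorRep (tensorRep π ρ) σ ((1 ⊗ₜ b) ⊗ₜ c)) = ampRight _ _ (tensorRep ρ σ (b ⊗ₜ c))
    rw [tensorRep_tmul, tensorRep_tmul, tensorRep_tmul, map_one, conj_opTensor]
    rfl
  exact LinearMap.congr_fun key x

end MinTensorRep

/-! ### The maps `Δ ⊗ id` and `id ⊗ Δ` -/

section Comul

variable {A B C D : Type u}
  [Ring A] [StarRing A] [Algebra ℂ A] [StarModule ℂ A] [TopologicalSpace A]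
  [Ring B] [StarRing B] [Algebra ℂ B] [StarModule ℂ B] [TopologicalSpace B]
  [Ring C] [StarRing C] [Algebra ℂ C] [StarModule ℂ C] [TopologicalSpace C]
  [Ring D] [StarRing D] [Algebra ℂ D] [StarModule ℂ D] [TopologicalSpace D]
  {H K L : Type u} [NormedAddCommGroup H] [InnerProductSpace ℂ H] [CompleteSpace H]
  [NormedAddCommGroup K] [InnerProductSpace ℂ K] [CompleteSpace K]
  [NormedAddCommGroup L] [InnerProductSpace ℂ L] [CompleteSpace L]

theorem MinTensor.continuous_map (f : A →⋆ₐ[ℂ] C) (hf : Continuous f) (g : B →⋆ₐ[ℂ] D)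
    (hg : Continuous g) : Continuous (MinTensor.map f hf g hg) :=
  RepCompletion.continuous_map _ _ _ _

theorem MinTensor.map_of (f : A →⋆ₐ[ℂ] C) (hf : Continuous f) (g : B →⋆ₐ[ℂ] D)
    (hg : Continuous g) (x : A ⊗[ℂ] B) :
    MinTensor.map f hf g hg (RepCompletion.of _ x) = RepCompletion.of _ (algMap f g x) :=
  RepCompletion.map_of _ _ _ _ _

theorem MinTensor.rep_map (π : C →⋆ₐ[ℂ] (H →L[ℂ] H)) (hπ : Continuous π)
    (ρ : D →⋆ₐ[ℂ] (K →L[ℂ] K)) (hρ : Continuous ρ) (f : A →⋆ₐ[ℂ] C) (hf : Continuous f)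
    (g : B →⋆ₐ[ℂ] D) (hg : Continuous g) (x : MinTensor A B) :
    MinTensor.rep π hπ ρ hρ (MinTensor.map f hf g hg x) =
      MinTensor.rep (π.comp f) (hπ.comp hf) (ρ.comp g) (hρ.comp hg) x := by
  refine congrFun (RepCompletion.eq_of_eq_on_range (pairRep A B)
    (g := fun x => MinTensor.rep π hπ ρ hρ (MinTensor.map f hf g hg x))
    ((continuous_rep π hπ ρ hρ).comp (continuous_map f hf g hg))
    (continuous_rep _ _ _ _) fun x => ?_) x
  rw [map_of, rep_of]
  exact (tensorRep_algMap π ρ f g x).trans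
    (rep_of (π.comp f) (hπ.comp hf) (ρ.comp g) (hρ.comp hg) x).symm

theorem MinTensor.ext_rep {x y : MinTensor A B}
    (h : ∀ (p : Rep A) (r : Rep B), MinTensor.rep p.π p.continuous_π r.π r.continuous_π x =
      MinTensor.rep p.π p.continuous_π r.π r.continuous_π y) : x = y :=
  RepCompletion.ext_rep fun p => h p.1 p.2

theorem MinTensor₃.ext_rep {x y : MinTensor₃ A B C}
    (h : ∀ (p : Rep A) (r : Rep B) (s : Rep C),
      MinTensor₃.rep p.π p.continuous_π r.π r.continuous_π s.π s.continuous_π x =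
      MinTensor₃.rep p.π p.continuous_π r.π r.continuous_π s.π s.continuous_π y) : x = y :=
  RepCompletion.ext_rep fun p => h p.1 p.2.1 p.2.2

variable (π : A →⋆ₐ[ℂ] (H →L[ℂ] H)) (hπ : Continuous π) (ρ : A →⋆ₐ[ℂ] (K →L[ℂ] K))
  (hρ : Continuous ρ) (σ : A →⋆ₐ[ℂ] (L →L[ℂ] L)) (hσ : Continuous σ)
  (Δ : A →⋆ₐ[ℂ] MinTensor A A) (hΔ : Continuous Δ)

theorem comulIdAlg_tmul (a b : A) :
    comulIdAlg Δ (a ⊗ₜ b) = leg₁₂ A A A (Δ a) * leg₃ A A A b :=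
  liftCommute_tmul _ _ _ a b

theorem idComulAlg_tmul (a b : A) :
    idComulAlg Δ (a ⊗ₜ b) = leg₁ A A A a * leg₂₃ A A A (Δ b) :=
  liftCommute_tmul _ _ _ a b

/-- After `Δ ⊗ id`, a triple representation becomes the tensor product of the representations `(π ⊗
ρ)Δ` and `σ` of `A`. When `Δ` is continuous this is one of the representations that define the
topology of `A ⊗ A`, which is why `Δ ⊗ id` is continuous. -/
theorem MinTensor₃.rep_comulIdAlg (x : A ⊗[ℂ] A) :
    MinTensor₃.rep π hπ ρ hρ σ hσ (comulIdAlg Δ x) =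
      tensorRep ((MinTensor.rep π hπ ρ hρ).comp Δ) σ x := by
  have key : (MinTensor₃.rep π hπ ρ hρ σ hσ).toAlgHom.toLinearMap ∘ₗ
      (comulIdAlg Δ).toAlgHom.toLinearMap =
      (tensorRep ((MinTensor.rep π hπ ρ hρ).comp Δ) σ).toAlgHom.toLinearMap := by
    refine TensorProduct.ext' fun b c => ?_
    change MinTensor₃.rep π hπ ρ hρ σ hσ (comulIdAlg Δ (b ⊗ₜ c)) = tensorRep _ σ (b ⊗ₜ c)
    rw [tensorRep_tmul, comulIdAlg_tmul, map_mul, rep_leg₃]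
    rw [rep_leg₁₂, ← opTensor_mul, one_mul, mul_one]
    rfl
  exact LinearMap.congr_fun key x

/-- The counterpart for `id ⊗ Δ`; here the representation `(ρ ⊗ σ)Δ` sits in the second factor, so
the associator is needed. -/
theorem MinTensor₃.conj_rep_idComulAlg (x : A ⊗[ℂ] A) :
    (hilbertAssoc H K L).conjStarAlgEquiv (MinTensor₃.rep π hπ ρ hρ σ hσ (idComulAlg Δ x)) =
      tensorRep π ((MinTensor.rep ρ hρ σ hσ).comp Δ) x := by
  have key : (hilbertAssoc H K L).conjStarAlgEquiv.toAlgEquiv.toLinearMap ∘ₗ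
      (MinTensor₃.rep π hπ ρ hρ σ hσ).toAlgHom.toLinearMap ∘ₗ
      (idComulAlg Δ).toAlgHom.toLinearMap =
      (tensorRep π ((MinTensor.rep ρ hρ σ hσ).comp Δ)).toAlgHom.toLinearMap := by
    refine TensorProduct.ext' fun b c => ?_
    change (hilbertAssoc H K L).conjStarAlgEquiv
      (MinTensor₃.rep π hπ ρ hρ σ hσ (idComulAlg Δ (b ⊗ₜ c))) = tensorRep π _ (b ⊗ₜ c)
    rw [tensorRep_tmul, idComulAlg_tmul, map_mul, rep_leg₁]
    refine ((hilbertAssoc H K L).conjStarAlgEquiv.map_mul' _ _).trans ?_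
    refine (congrArg₂ (· * ·) (conj_opTensor (π b) 1 1)
      (conj_rep_leg₂₃ π hπ ρ hρ σ hσ (Δ c))).trans ?_
    change opTensor (π b) (opTensor 1 1) * _ = _
    rw [opTensor_one, ← opTensor_mul, one_mul, mul_one]
    rfl
  exact LinearMap.congr_fun key x

theorem continuous_comulIdAlg (Δ : A →⋆ₐ[ℂ] MinTensor A A) (hΔ : Continuous Δ) :
    Continuous fun x : WithReps (pairRep A A) => comulIdAlg Δ x := by
  refine RepCompletion.continuous_iff_rep.2 fun p => ?_
  refine (continuous_tensorRep (A := A) (B := A)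
    ((MinTensor.rep p.1.π p.1.continuous_π p.2.1.π p.2.1.continuous_π).comp Δ)
    ((MinTensor.continuous_rep _ _ _ _).comp hΔ) p.2.2.π p.2.2.continuous_π).congr fun x => ?_
  exact (MinTensor₃.rep_comulIdAlg _ _ _ _ _ _ Δ x).symm

theorem continuous_idComulAlg (Δ : A →⋆ₐ[ℂ] MinTensor A A) (hΔ : Continuous Δ) :
    Continuous fun x : WithReps (pairRep A A) => idComulAlg Δ x := by
  refine RepCompletion.continuous_iff_rep.2 fun p => ?_
  have hc := (hilbertAssoc p.1.H p.2.1.H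
    p.2.2.H).symm.toContinuousLinearEquiv.conjContinuousAlgEquiv.continuous
  refine (hc.comp (continuous_tensorRep (A := A) (B := A) p.1.π p.1.continuous_π
    ((MinTensor.rep p.2.1.π p.2.1.continuous_π p.2.2.π p.2.2.continuous_π).comp Δ)
    ((MinTensor.continuous_rep _ _ _ _).comp hΔ))).congr fun x => ?_
  have h := MinTensor₃.conj_rep_idComulAlg p.1.π p.1.continuous_π p.2.1.π p.2.1.continuous_π
    p.2.2.π p.2.2.continuous_π Δ x
  exact ((hilbertAssoc p.1.H p.2.1.H p.2.2.H).conjStarAlgEquiv.symm_apply_eq.2 h.symm)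

/-- The `*`-homomorphism `Δ ⊗ id`. -/
def comulIdHom : MinTensor A A →⋆ₐ[ℂ] MinTensor₃ A A A :=
  RepCompletion.lift (pairRep A A) (comulIdAlg Δ) (continuous_comulIdAlg Δ hΔ)

/-- The `*`-homomorphism `id ⊗ Δ`. -/
def idComulHom : MinTensor A A →⋆ₐ[ℂ] MinTensor₃ A A A :=
  RepCompletion.lift (pairRep A A) (idComulAlg Δ) (continuous_idComulAlg Δ hΔ)

theorem continuous_comulIdHom : Continuous (comulIdHom Δ hΔ) := RepCompletion.continuous_lift _ _ _

theorem continuous_idComulHom : Continuous (idComulHom Δ hΔ) := RepCompletion.continuous_lift _ _ _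

theorem comulIdHom_tmul (a b : A) :
    comulIdHom Δ hΔ (tmul a b) = leg₁₂ A A A (Δ a) * leg₃ A A A b :=
  (RepCompletion.lift_of _ _ _ _).trans (comulIdAlg_tmul Δ a b)

theorem idComulHom_tmul (a b : A) :
    idComulHom Δ hΔ (tmul a b) = leg₁ A A A a * leg₂₃ A A A (Δ b) :=
  (RepCompletion.lift_of _ _ _ _).trans (idComulAlg_tmul Δ a b)

theorem MinTensor₃.rep_comulId (x : MinTensor A A) :
    MinTensor₃.rep π hπ ρ hρ σ hσ (comulId Δ x) =
      MinTensor.rep ((MinTensor.rep π hπ ρ hρ).comp Δ)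
        ((MinTensor.continuous_rep π hπ ρ hρ).comp hΔ) σ hσ x := by
  -- `comulId Δ` is definitionally the underlying function of `comulIdHom Δ hΔ`, whose values on
  -- algebraic tensors are known thanks to the continuity of `Δ`.
  refine congrFun (RepCompletion.eq_of_eq_on_range (pairRep A A)
    (g := fun x => MinTensor₃.rep π hπ ρ hρ σ hσ (comulIdHom Δ hΔ x))
    ((continuous_rep π hπ ρ hρ σ hσ).comp (continuous_comulIdHom Δ hΔ))
    (MinTensor.continuous_rep _ _ _ _) fun x => ?_) x
  refine (congrArg _ (RepCompletion.lift_of _ _ _ _)).trans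
    ((rep_comulIdAlg π hπ ρ hρ σ hσ Δ x).trans (MinTensor.rep_of _ _ _ _ _).symm)

theorem MinTensor₃.conj_rep_idComul (x : MinTensor A A) :
    (hilbertAssoc H K L).conjStarAlgEquiv (MinTensor₃.rep π hπ ρ hρ σ hσ (idComul Δ x)) =
      MinTensor.rep π hπ ((MinTensor.rep ρ hρ σ hσ).comp Δ)
        ((MinTensor.continuous_rep ρ hρ σ hσ).comp hΔ) x := by
  refine congrFun (RepCompletion.eq_of_eq_on_range (pairRep A A)
    (g := fun x => (hilbertAssoc H K L).conjStarAlgEquiv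
      (MinTensor₃.rep π hπ ρ hρ σ hσ (idComulHom Δ hΔ x)))
    ((hilbertAssoc H K L).toContinuousLinearEquiv.conjContinuousAlgEquiv.continuous.comp
      ((continuous_rep π hπ ρ hρ σ hσ).comp (continuous_idComulHom Δ hΔ)))
    (MinTensor.continuous_rep _ _ _ _) fun x => ?_) x
  refine (congrArg _ (congrArg _ (RepCompletion.lift_of _ _ _ _))).trans
    ((conj_rep_idComulAlg π hπ ρ hρ σ hσ Δ x).trans (MinTensor.rep_of _ _ _ _ _).symm)

end Comul

/-! ### Generalities -/

section Generalities

/-- A family of maps that generates a generating family of uniform maps is generating. -/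
theorem isUniformInducing_of_factor {X I J : Type*} [UniformSpace X] {R : I → Type*}
    [∀ i, UniformSpace (R i)] {T : J → Type*} [∀ j, UniformSpace (T j)] {r : X → ∀ i, R i}
    (hr : IsUniformInducing r) {t : X → ∀ j, T j} (ht : ∀ j, UniformContinuous fun x => t x j)
    (h : ∀ i, ∃ j, ∃ g : T j → R i, UniformContinuous g ∧ ∀ x, r x i = g (t x j)) :
    IsUniformInducing t := by
  -- One inequality is the uniform continuity of the components of `t`. For the other, each `r i` is
  -- a uniform function of one component of `t`, so the uniformity pulled back along `t` is at least
  -- as fine as the one induced by `r`.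
  refine isUniformInducing_iff_uniformSpace.2 (le_antisymm ?_
    (uniformContinuous_iff_le_comap.1 (uniformContinuous_pi.2 ht)))
  refine le_of_le_of_eq ?_ (isUniformInducing_iff_uniformSpace.1 hr)
  conv_rhs => rw [Pi.uniformSpace_eq, UniformSpace.comap_iInf]
  refine le_iInf fun i => ?_
  rw [← UniformSpace.comap_comap]
  obtain ⟨j, g, hg, h⟩ := h i
  refine (UniformSpace.comap_mono (uniformContinuous_iff_le_comap.1
    (hg.comp (Pi.uniformContinuous_proj _ j)))).trans (le_of_eq ?_)
  exact UniformSpace.comap_comap.symm.trans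
    (congrArg (UniformSpace.comap · _) (funext fun x => (h x).symm))

/-- The `*`-homomorphism given by a family of `*`-homomorphisms whose values lie in the image of
a jointly injective family. -/
def liftAlong {P Q : Type*} [Ring P] [StarRing P] [Algebra ℂ P] [Ring Q] [StarRing Q] [Algebra ℂ Q]
    {J : Type*} {T : J → Type*} [∀ j, Ring (T j)] [∀ j, StarRing (T j)] [∀ j, Algebra ℂ (T j)]
    (t : ∀ j, Q →⋆ₐ[ℂ] T j) (ht : ∀ x y, (∀ j, t j x = t j y) → x = y) (g : ∀ j, P →⋆ₐ[ℂ] T j)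
    (h : ∀ a, ∃ x, ∀ j, t j x = g j a) : P →⋆ₐ[ℂ] Q :=
  -- Joint injectivity makes the chosen preimages unique, hence compatible with all operations.
  have hs := fun a => (h a).choose_spec
  { toFun := fun a => (h a).choose
    map_one' := ht _ _ fun n => by rw [hs, map_one, map_one]
    map_zero' := ht _ _ fun n => by rw [hs, map_zero, map_zero]
    map_mul' := fun a b => ht _ _ fun n => by rw [hs, map_mul, map_mul, hs, hs]
    map_add' := fun a b => ht _ _ fun n => by rw [hs, map_add, map_add, hs, hs]
    commutes' := fun c => ht _ _ fun n => by
      rw [hs, AlgHomClass.commutes, AlgHomClass.commutes]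
    map_star' := fun a => ht _ _ fun n => by rw [hs, map_star, map_star, hs] }

theorem apply_liftAlong {P Q : Type*} [Ring P] [StarRing P] [Algebra ℂ P] [Ring Q] [StarRing Q]
    [Algebra ℂ Q] {J : Type*} {T : J → Type*} [∀ j, Ring (T j)] [∀ j, StarRing (T j)]
    [∀ j, Algebra ℂ (T j)] (t : ∀ j, Q →⋆ₐ[ℂ] T j) (ht : ∀ x y, (∀ j, t j x = t j y) → x = y)
    (g : ∀ j, P →⋆ₐ[ℂ] T j) (h : ∀ a, ∃ x, ∀ j, t j x = g j a) (j : J) (a : P) :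
    t j (liftAlong t ht g h a) = g j a :=
  (h a).choose_spec j

theorem RepCompletion.uniformContinuous_of_continuous {F : Type u} [Ring F] [StarRing F]
    [Algebra ℂ F] [StarModule ℂ F] {ι : Type v} {H : ι → Type w} [∀ i, NormedAddCommGroup (H i)]
    [∀ i, InnerProductSpace ℂ (H i)] [∀ i, CompleteSpace (H i)]
    {f : ∀ i, F →⋆ₐ[ℂ] (H i →L[ℂ] H i)} {C : Type*} [Ring C] [UniformSpace C]
    [IsUniformAddGroup C] [StarRing C] [Algebra ℂ C] (g : RepCompletion f →⋆ₐ[ℂ] C)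
    (hg : Continuous g) : UniformContinuous g :=
  uniformContinuous_addMonoidHom_of_continuous (f := (g : RepCompletion f →+ C)) hg

variable {A B C D E G : Type u}
  [Ring A] [StarRing A] [Algebra ℂ A] [StarModule ℂ A]
  [Ring B] [StarRing B] [Algebra ℂ B] [StarModule ℂ B]
  [Ring C] [StarRing C] [Algebra ℂ C] [StarModule ℂ C]
  [Ring D] [StarRing D] [Algebra ℂ D] [StarModule ℂ D]
  [Ring E] [StarRing E] [Algebra ℂ E] [StarModule ℂ E]
  [Ring G] [StarRing G] [Algebra ℂ G] [StarModule ℂ G]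

theorem algMap_surjective {f : A →⋆ₐ[ℂ] C} {g : B →⋆ₐ[ℂ] D} (hf : Function.Surjective f)
    (hg : Function.Surjective g) : Function.Surjective (algMap f g) :=
  TensorProduct.map_surjective (g := f.toAlgHom.toLinearMap) (g' := g.toAlgHom.toLinearMap) hf hg

theorem algMap_algMap {f : A →⋆ₐ[ℂ] C} {g : B →⋆ₐ[ℂ] D} {f' : C →⋆ₐ[ℂ] E} {g' : D →⋆ₐ[ℂ] G}
    {f'' : A →⋆ₐ[ℂ] E} {g'' : B →⋆ₐ[ℂ] G} (hf : ∀ a, f' (f a) = f'' a) (hg : ∀ b, g' (g b) = g'' b)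
    (x : A ⊗[ℂ] B) : algMap f' g' (algMap f g x) = algMap f'' g'' x := by
  induction x using TensorProduct.induction_on with
  | zero => simp only [map_zero]
  | add x y hx hy => simp only [map_add, hx, hy]
  | tmul a b => rw [algMap_tmul, algMap_tmul, algMap_tmul, hf, hg]

variable [TopologicalSpace A] [TopologicalSpace B] [TopologicalSpace C] [TopologicalSpace D]
  [TopologicalSpace E] [TopologicalSpace G]

theorem MinTensor.map_map {f : A →⋆ₐ[ℂ] C} {g : B →⋆ₐ[ℂ] D} {f' : C →⋆ₐ[ℂ] E} {g' : D →⋆ₐ[ℂ] G}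
    {f'' : A →⋆ₐ[ℂ] E} {g'' : B →⋆ₐ[ℂ] G} (hfc : Continuous f) (hgc : Continuous g)
    (hfc' : Continuous f') (hgc' : Continuous g') (hfc'' : Continuous f'') (hgc'' : Continuous g'')
    (hf : ∀ a, f' (f a) = f'' a) (hg : ∀ b, g' (g b) = g'' b) (x : MinTensor A B) :
    MinTensor.map f' hfc' g' hgc' (MinTensor.map f hfc g hgc x) =
      MinTensor.map f'' hfc'' g'' hgc'' x := by
  refine congrFun (RepCompletion.eq_of_eq_on_range (pairRep A B)
    (g := fun x => MinTensor.map f' hfc' g' hgc' (MinTensor.map f hfc g hgc x))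
    ((continuous_map f' hfc' g' hgc').comp (continuous_map f hfc g hgc))
    (continuous_map f'' hfc'' g'' hgc'') fun x => ?_) x
  rw [map_of, map_of, map_of, algMap_algMap hf hg]

theorem MinTensor.rep_eq_rep_map {H K : Type u} [NormedAddCommGroup H] [InnerProductSpace ℂ H]
    [CompleteSpace H] [NormedAddCommGroup K] [InnerProductSpace ℂ K] [CompleteSpace K]
    {π : C →⋆ₐ[ℂ] (H →L[ℂ] H)} (hπ : Continuous π) {ρ : D →⋆ₐ[ℂ] (K →L[ℂ] K)} (hρ : Continuous ρ)
    {f : A →⋆ₐ[ℂ] C} (hf : Continuous f) {g : B →⋆ₐ[ℂ] D} (hg : Continuous g)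
    {π' : A →⋆ₐ[ℂ] (H →L[ℂ] H)} (hπ' : Continuous π') {ρ' : B →⋆ₐ[ℂ] (K →L[ℂ] K)}
    (hρ' : Continuous ρ') (h : π' = π.comp f) (h' : ρ' = ρ.comp g) (x : MinTensor A B) :
    MinTensor.rep π' hπ' ρ' hρ' x = MinTensor.rep π hπ ρ hρ (MinTensor.map f hf g hg x) := by
  subst h h'
  exact (MinTensor.rep_map π hπ ρ hρ f hf g hg x).symm

/-- The map is onto at the level of algebraic tensor products, and these are dense in the target. -/
theorem MinTensor.denseRange_map {f : A →⋆ₐ[ℂ] C} {g : B →⋆ₐ[ℂ] D} (hfc : Continuous f)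
    (hgc : Continuous g) (hf : Function.Surjective f) (hg : Function.Surjective g) :
    DenseRange (MinTensor.map f hfc g hgc) := by
  refine (RepCompletion.dense_range_of (pairRep C D)).mono ?_
  rintro _ ⟨z, rfl⟩
  obtain ⟨w, rfl⟩ := algMap_surjective hf hg z
  exact ⟨RepCompletion.of _ w, MinTensor.map_of _ _ _ _ _⟩

end Generalities

/-! ### Inverse limits of C⋆-algebras -/

section InverseLimit

variable {A : ℕ → Type u} [∀ n, CStarAlgebra (A n)] {θ : ∀ n, A (n + 1) →⋆ₐ[ℂ] A n}

/-- Above level `n` preimages are chosen successively; below it the values are forced. The system is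
quantified after `n` so that the induction can shift it by one level. -/
theorem exists_coherent_sequence (n : ℕ) : ∀ {X : ℕ → Type u} (f : ∀ k, X (k + 1) → X k)
    (_ : ∀ k, Function.Surjective (f k)) (a : X n),
    ∃ x : ∀ k, X k, (∀ k, f k (x (k + 1)) = x k) ∧ x n = a := by
  induction n with
  | zero =>
    intro X f hf a
    exact ⟨fun k => Nat.rec a (fun k y => Function.surjInv (hf k) y) k,
      fun k => Function.surjInv_eq (hf k) _, rfl⟩
  | succ n ih =>
    intro X f hf a
    obtain ⟨y, hy, rfl⟩ := ih (X := fun k => X (k + 1)) (fun k => f (k + 1)) (fun k => hf _) a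
    refine ⟨fun k => Nat.casesOn k (f 0 (y 0)) y, fun k => ?_, rfl⟩
    cases k with
    | zero => rfl
    | succ k => exact hy k

theorem proj_surjective (hθ : ∀ n, Function.Surjective (θ n)) (n : ℕ) :
    Function.Surjective (proj θ n) := fun a => by
  obtain ⟨x, hx, rfl⟩ := exists_coherent_sequence n (fun k => θ k) hθ a
  exact ⟨⟨x, hx⟩, rfl⟩

theorem connecting_proj (n : ℕ) (x : inverseLimit θ) : θ n (proj θ (n + 1) x) = proj θ n x :=
  x.2 n

theorem proj_eq_zero_of_le {m n : ℕ} (h : n ≤ m) {x : inverseLimit θ} (hx : proj θ m x = 0) :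
    proj θ n x = 0 := by
  induction m, h using Nat.le_induction with
  | base => exact hx
  | succ m _ ih => exact ih (by rw [← connecting_proj, hx, map_zero])

/-- A continuous representation of an inverse limit vanishes on the kernel of a projection. -/
theorem exists_proj_ker_le {E : Type*} [NormedRing E] [StarRing E] [NormedAlgebra ℂ E]
    (π : inverseLimit θ →⋆ₐ[ℂ] E) (hπ : Continuous π) :
    ∃ n, ∀ x, proj θ n x = 0 → π x = 0 := by
  -- Otherwise each `ker p_n` contains some `x n` with `π (x n) ≠ 0`, and rescaling gives the images
  -- norm one. The `k`-th coordinate of `x n` vanishes for `n ≥ k`, so the rescaled sequence tends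
  -- to zero in the product topology, against the continuity of `π`.
  by_contra! h
  choose x hx hπx using h
  have hlim : Filter.Tendsto (fun n => ((‖π (x n)‖⁻¹ : ℝ) : ℂ) • x n) Filter.atTop
      (nhds (0 : inverseLimit θ)) := by
    refine tendsto_subtype_rng.2 (tendsto_pi_nhds.2 fun k => ?_)
    refine tendsto_nhds_of_eventually_eq ?_
    filter_upwards [Filter.eventually_ge_atTop k] with n hn
    have : proj θ k (((‖π (x n)‖⁻¹ : ℝ) : ℂ) • x n) = 0 := by
      rw [map_smul, proj_eq_zero_of_le hn (hx n), smul_zero]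
    exact this
  have h1 := (hπ.tendsto 0).comp hlim
  rw [map_zero] at h1
  have h2 := h1.norm
  rw [norm_zero] at h2
  refine zero_ne_one (tendsto_nhds_unique h2 (tendsto_nhds_of_eventually_eq
    (Filter.Eventually.of_forall fun n => ?_)))
  change ‖π (_ • x n)‖ = 1
  rw [map_smul, norm_smul, Complex.norm_real, norm_inv, norm_norm,
    inv_mul_cancel₀ (norm_ne_zero_iff.2 (hπx n))]

/-- The homomorphism induced on the image of a surjective `*`-homomorphism by a `*`-homomorphism
that vanishes on the kernel. -/
def factorHom {B C D : Type*} [Ring B] [StarRing B] [Algebra ℂ B] [Ring C] [StarRing C]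
    [Algebra ℂ C] [Ring D] [StarRing D] [Algebra ℂ D] (p : B →⋆ₐ[ℂ] C)
    (hp : Function.Surjective p) (φ : B →⋆ₐ[ℂ] D) (h : ∀ x, p x = 0 → φ x = 0) : C →⋆ₐ[ℂ] D :=
  have key : ∀ x c, p x = c → φ (Function.surjInv hp c) = φ x := fun x c hx => by
    rw [← sub_eq_zero, ← map_sub]
    exact h _ (by rw [map_sub, Function.surjInv_eq hp, hx, sub_self])
  have hs := Function.surjInv_eq hp
  { toFun := fun c => φ (Function.surjInv hp c)
    map_one' := by rw [key 1 1 (map_one p), map_one]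
    map_zero' := by rw [key 0 0 (map_zero p), map_zero]
    map_mul' := fun c d => by
      rw [key (Function.surjInv hp c * Function.surjInv hp d) _ (by rw [map_mul, hs, hs]), map_mul]
    map_add' := fun c d => by
      rw [key (Function.surjInv hp c + Function.surjInv hp d) _ (by rw [map_add, hs, hs]), map_add]
    commutes' := fun z => by
      rw [key (algebraMap ℂ B z) _ (AlgHomClass.commutes p z), AlgHomClass.commutes]
    map_star' := fun c => by
      rw [key (star (Function.surjInv hp c)) _ (by rw [map_star, hs]), map_star] }

theorem factorHom_comp {B C D : Type*} [Ring B] [StarRing B] [Algebra ℂ B] [Ring C] [StarRing C]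
    [Algebra ℂ C] [Ring D] [StarRing D] [Algebra ℂ D] (p : B →⋆ₐ[ℂ] C)
    (hp : Function.Surjective p) (φ : B →⋆ₐ[ℂ] D) (h : ∀ x, p x = 0 → φ x = 0) :
    φ = (factorHom p hp φ h).comp p := by
  ext x
  change φ x = φ (Function.surjInv hp (p x))
  rw [← sub_eq_zero, ← map_sub]
  exact h _ (by rw [map_sub, Function.surjInv_eq hp, sub_self])

/-- A continuous representation of an inverse limit factors through almost all projections. -/
theorem exists_rep_factor (hθ : ∀ n, Function.Surjective (θ n)) {H : Type u}
    [NormedAddCommGroup H] [InnerProductSpace ℂ H] [CompleteSpace H]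
    (π : inverseLimit θ →⋆ₐ[ℂ] (H →L[ℂ] H)) (hπ : Continuous π) :
    ∃ n, ∀ m, n ≤ m → ∃ π' : A m →⋆ₐ[ℂ] (H →L[ℂ] H), Continuous π' ∧ π = π'.comp (proj θ m) := by
  obtain ⟨n, hn⟩ := exists_proj_ker_le π hπ
  exact ⟨n, fun m hm => ⟨factorHom (proj θ m) (proj_surjective hθ m) π fun x hx =>
    hn x (proj_eq_zero_of_le hm hx), continuous_cstarHom _, factorHom_comp _ _ _ _⟩⟩

end InverseLimit

/-! ### The minimal tensor square of an inverse limit -/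

section LimitCone

variable {A : ℕ → Type u} [∀ n, Ring (A n)] [∀ n, StarRing (A n)] [∀ n, Algebra ℂ (A n)]
  [∀ n, StarModule ℂ (A n)] [∀ n, TopologicalSpace (A n)]
  {P : Type u} [Ring P] [StarRing P] [Algebra ℂ P] [StarModule ℂ P] [TopologicalSpace P]

/-- The properties of the projections of an inverse limit that determine its minimal tensor
square: they are surjective, and continuous representations factor through them. -/
structure IsLimitCone (θ : ∀ n, A (n + 1) →⋆ₐ[ℂ] A n) (p : ∀ n, P →⋆ₐ[ℂ] A n) : Prop where
  continuous_connecting : ∀ n, Continuous (θ n)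
  continuous : ∀ n, Continuous (p n)
  surjective : ∀ n, Function.Surjective (p n)
  coherent : ∀ n x, θ n (p (n + 1) x) = p n x
  factor : ∀ r : Rep P, ∃ n, ∀ m, n ≤ m → ∃ π : A m →⋆ₐ[ℂ] (r.H →L[ℂ] r.H),
    Continuous π ∧ r.π = π.comp (p m)

namespace IsLimitCone

variable {θ : ∀ n, A (n + 1) →⋆ₐ[ℂ] A n} {p : ∀ n, P →⋆ₐ[ℂ] A n} (c : IsLimitCone θ p)

/-- The projections of the minimal tensor square. -/
def square (n : ℕ) : MinTensor P P →⋆ₐ[ℂ] MinTensor (A n) (A n) :=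
  MinTensor.map (p n) (c.continuous n) (p n) (c.continuous n)

/-- The connecting homomorphisms of the minimal tensor squares. -/
def squareConnecting (n : ℕ) : MinTensor (A (n + 1)) (A (n + 1)) →⋆ₐ[ℂ] MinTensor (A n) (A n) :=
  MinTensor.map (θ n) (c.continuous_connecting n) (θ n) (c.continuous_connecting n)

theorem continuous_square (n : ℕ) : Continuous (c.square n) :=
  MinTensor.continuous_map _ _ _ _

theorem continuous_squareConnecting (n : ℕ) : Continuous (c.squareConnecting n) :=
  MinTensor.continuous_map _ _ _ _

theorem square_tmul (n : ℕ) (a b : P) : c.square n (tmul a b) = tmul (p n a) (p n b) :=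
  MinTensor.map_tmul _ _ _ _ _ _

theorem squareConnecting_square (n : ℕ) (x : MinTensor P P) :
    c.squareConnecting n (c.square (n + 1) x) = c.square n x :=
  MinTensor.map_map _ _ _ _ _ _ (c.coherent n) (c.coherent n) x

/-- The canonical map of the minimal tensor square into the product. -/
def squares (x : MinTensor P P) (n : ℕ) : MinTensor (A n) (A n) := c.square n x

/-- Two representations can be moved to a common level because each factors through all sufficiently
late projections. Every defining representation of `P ⊗ P` thus lives on one `A m ⊗ A m`. -/
theorem exists_factor₂ (r s : Rep P) :
    ∃ m, ∃ (π : A m →⋆ₐ[ℂ] (r.H →L[ℂ] r.H)) (hπ : Continuous π)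
      (ρ : A m →⋆ₐ[ℂ] (s.H →L[ℂ] s.H)) (hρ : Continuous ρ), ∀ x,
        MinTensor.rep r.π r.continuous_π s.π s.continuous_π x =
          MinTensor.rep π hπ ρ hρ (c.square m x) := by
  obtain ⟨n₁, h₁⟩ := c.factor r
  obtain ⟨n₂, h₂⟩ := c.factor s
  obtain ⟨π, hπ, hp⟩ := h₁ (max n₁ n₂) (le_max_left _ _)
  obtain ⟨ρ, hρ, hr⟩ := h₂ (max n₁ n₂) (le_max_right _ _)
  exact ⟨_, π, hπ, ρ, hρ, fun x => MinTensor.rep_eq_rep_map hπ hρ (c.continuous _)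
    (c.continuous _) r.continuous_π s.continuous_π hp hr x⟩

theorem isUniformInducing_squares : IsUniformInducing c.squares := by
  refine isUniformInducing_of_factor (RepCompletion.isUniformInducing_rep (pairRep P P))
    (fun n => RepCompletion.uniformContinuous_of_continuous (c.square n)
      (c.continuous_square n)) fun r => ?_
  obtain ⟨m, π, hπ, ρ, hρ, h⟩ := c.exists_factor₂ r.1 r.2
  exact ⟨m, MinTensor.rep π hπ ρ hρ, RepCompletion.uniformContinuous_of_continuous _
    (MinTensor.continuous_rep π hπ ρ hρ), h⟩

theorem isEmbedding_squares : Topology.IsEmbedding c.squares :=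
  c.isUniformInducing_squares.isUniformEmbedding.isEmbedding

theorem ext_square {x y : MinTensor P P} (h : ∀ n, c.square n x = c.square n y) : x = y :=
  c.isEmbedding_squares.injective (funext h)

/-- The coherent sequences in the minimal tensor squares. -/
def Coherent (y : ∀ n, MinTensor (A n) (A n)) : Prop := ∀ n, c.squareConnecting n (y (n + 1)) = y n

theorem coherent_squares (x : MinTensor P P) : c.Coherent (c.squares x) :=
  fun n => c.squareConnecting_square n x

/-- This is the composite of the connecting maps from level `N` down to level `i`, recorded only
through its continuity and its effect on coherent sequences. -/
theorem exists_squareConnecting {i N : ℕ} (h : i ≤ N) :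
    ∃ f : MinTensor (A N) (A N) → MinTensor (A i) (A i), Continuous f ∧
      ∀ y, c.Coherent y → f (y N) = y i := by
  induction N, h using Nat.le_induction with
  | base => exact ⟨id, continuous_id, fun _ _ => rfl⟩
  | succ N _ ih =>
    obtain ⟨f, hf, hy⟩ := ih
    exact ⟨f ∘ c.squareConnecting N, hf.comp (c.continuous_squareConnecting N), fun y h => by
      rw [Function.comp_apply, h N, hy y h]⟩

/-- A neighbourhood of a coherent sequence contains one that is given by a single coordinate. -/
theorem exists_nhd {y : ∀ n, MinTensor (A n) (A n)} (hy : c.Coherent y)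
    {V : Set (∀ n, MinTensor (A n) (A n))} (hV : IsOpen V) (hyV : y ∈ V) :
    ∃ N, ∃ W : Set (MinTensor (A N) (A N)), IsOpen W ∧ y N ∈ W ∧
      ∀ z, c.Coherent z → z N ∈ W → z ∈ V := by
  obtain ⟨I, u, hu, hIV⟩ := isOpen_pi_iff.1 hV y hyV
  -- On coherent sequences the finitely many restricted coordinates are continuous functions of the
  -- coordinate at the largest index.
  choose f hf hfy using fun i : I =>
    c.exists_squareConnecting (Finset.le_sup (f := id) i.2)
  refine ⟨I.sup id, ⋂ i : I, f i ⁻¹' u i, isOpen_iInter_of_finite fun i =>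
    (hu i i.2).1.preimage (hf i), Set.mem_iInter.2 fun i => ?_, fun z hz hzW => hIV fun i hi => ?_⟩
  · rw [Set.mem_preimage, hfy i y hy]
    exact (hu i i.2).2
  · have := Set.mem_iInter.1 hzW ⟨i, hi⟩
    rwa [Set.mem_preimage, hfy ⟨i, hi⟩ z hz] at this

/-- The range is complete, as `P ⊗ P` is complete and the map is uniformly inducing, so it is
closed. It is dense in the coherent sequences because a neighbourhood of such a sequence need only
be met in one coordinate, where `p_N ⊗ p_N` has dense range. -/
theorem range_squares : Set.range c.squares = {y | c.Coherent y} := by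
  refine subset_antisymm (by rintro _ ⟨x, rfl⟩; exact c.coherent_squares x) fun y hy => ?_
  have hcl : IsClosed (Set.range c.squares) :=
    c.isUniformInducing_squares.isComplete_range.isClosed
  rw [← hcl.closure_eq]
  refine mem_closure_iff.2 fun V hV hyV => ?_
  obtain ⟨N, W, hW, hyW, h⟩ := c.exists_nhd hy hV hyV
  have hd : DenseRange (c.square N) :=
    MinTensor.denseRange_map _ _ (c.surjective N) (c.surjective N)
  obtain ⟨x, hx⟩ := hd.exists_mem_open hW ⟨_, hyW⟩
  exact ⟨c.squares x, h _ (c.coherent_squares x) hx, x, rfl⟩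

/-- A nonempty open set of `P ⊗ P` contains the preimage of an open set at some level that meets the
image of `P ⊗ P`. This reduces the density axioms for the limit to those of the single levels. -/
theorem dense_of_square {S : Set (MinTensor P P)} (h : ∀ n, Dense (c.square n '' S)) :
    Dense S := by
  refine dense_iff_inter_open.2 fun U hU ⟨x, hx⟩ => ?_
  obtain ⟨V, hV, rfl⟩ := c.isEmbedding_squares.isOpen_iff.1 hU
  obtain ⟨N, W, hW, hxW, hWV⟩ := c.exists_nhd (c.coherent_squares x) hV hx
  obtain ⟨_, hz, z, hzS, rfl⟩ := (h N).inter_open_nonempty W hW ⟨_, hxW⟩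
  exact ⟨z, hWV _ (c.coherent_squares z) hz, hzS⟩

/-! ### The inverse limit of a sequence of comultiplications -/

variable {Δ : ∀ n, A n →⋆ₐ[ℂ] MinTensor (A n) (A n)}

theorem exists_limit_value (hΔ : ∀ n a, c.squareConnecting n (Δ (n + 1) a) = Δ n (θ n a)) (a : P) :
    ∃ x, ∀ n, c.square n x = (Δ n).comp (p n) a := by
  have : (fun n => Δ n (p n a)) ∈ Set.range c.squares := by
    rw [c.range_squares]
    exact fun n => (hΔ n _).trans (congrArg _ (c.coherent n a))
  obtain ⟨x, hx⟩ := this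
  exact ⟨x, congrFun hx⟩

/-- The inverse limit of the homomorphisms `Δ n`. -/
def limitHom (hΔ : ∀ n a, c.squareConnecting n (Δ (n + 1) a) = Δ n (θ n a)) :
    P →⋆ₐ[ℂ] MinTensor P P :=
  liftAlong c.square (fun _ _ => c.ext_square) (fun n => (Δ n).comp (p n))
    (c.exists_limit_value hΔ)

theorem square_limitHom (hΔ : ∀ n a, c.squareConnecting n (Δ (n + 1) a) = Δ n (θ n a)) (n : ℕ)
    (a : P) : c.square n (c.limitHom hΔ a) = Δ n (p n a) :=
  apply_liftAlong c.square (fun _ _ => c.ext_square) (fun n => (Δ n).comp (p n))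
    (c.exists_limit_value hΔ) n a

variable {Δlim : P →⋆ₐ[ℂ] MinTensor P P} (h : ∀ n a, c.square n (Δlim a) = Δ n (p n a))
  (hΔc : ∀ n, Continuous (Δ n))

include h in
theorem eq_limitHom {Δ' : P →⋆ₐ[ℂ] MinTensor P P}
    (h' : ∀ n a, c.square n (Δ' a) = Δ n (p n a)) : Δ' = Δlim :=
  StarAlgHom.ext fun a => c.ext_square fun n => (h' n a).trans (h n a).symm

include h hΔc in
theorem continuous_limitHom : Continuous Δlim :=
  c.isEmbedding_squares.continuous_iff.2 (continuous_pi fun n =>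
    ((hΔc n).comp (c.continuous n)).congr fun a => (h n a).symm)

end IsLimitCone

end LimitCone

/-! ### Coassociativity and density for the limit comultiplication. -/

section LimitCone

variable {A : ℕ → Type u} [∀ n, Ring (A n)] [∀ n, StarRing (A n)] [∀ n, Algebra ℂ (A n)]
  [∀ n, StarModule ℂ (A n)] [∀ n, TopologicalSpace (A n)]
  {P : Type u} [Ring P] [StarRing P] [Algebra ℂ P] [StarModule ℂ P] [TopologicalSpace P]

namespace IsLimitCone

variable {θ : ∀ n, A (n + 1) →⋆ₐ[ℂ] A n} {p : ∀ n, P →⋆ₐ[ℂ] A n} (c : IsLimitCone θ p)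
  {Δ : ∀ n, A n →⋆ₐ[ℂ] MinTensor (A n) (A n)} {Δlim : P →⋆ₐ[ℂ] MinTensor P P}
  (h : ∀ n a, c.square n (Δlim a) = Δ n (p n a)) (hΔc : ∀ n, Continuous (Δ n))

section

variable (hc : Continuous Δlim)
  {H K L : Type u} [NormedAddCommGroup H] [InnerProductSpace ℂ H] [CompleteSpace H]
  [NormedAddCommGroup K] [InnerProductSpace ℂ K] [CompleteSpace K]
  [NormedAddCommGroup L] [InnerProductSpace ℂ L] [CompleteSpace L]
  {m : ℕ} {π : A m →⋆ₐ[ℂ] (H →L[ℂ] H)} (hπ : Continuous π) {π' : P →⋆ₐ[ℂ] (H →L[ℂ] H)}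
  (hπ' : Continuous π') (hp : π' = π.comp (p m))
  {ρ : A m →⋆ₐ[ℂ] (K →L[ℂ] K)} (hρ : Continuous ρ) {ρ' : P →⋆ₐ[ℂ] (K →L[ℂ] K)}
  (hρ' : Continuous ρ') (hr : ρ' = ρ.comp (p m))
  {σ : A m →⋆ₐ[ℂ] (L →L[ℂ] L)} (hσ : Continuous σ) {σ' : P →⋆ₐ[ℂ] (L →L[ℂ] L)}
  (hσ' : Continuous σ') (hs : σ' = σ.comp (p m))

-- The representation `(π' ⊗ ρ')Δlim` factors through the same projection `p m` as `π'` and `ρ'`. It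
-- can therefore serve as a factor of a further tensor product at that level.
include h hp hr in
theorem rep_comp_limit : (MinTensor.rep π' hπ' ρ' hρ').comp Δlim =
    ((MinTensor.rep π hπ ρ hρ).comp (Δ m)).comp (p m) := by
  refine StarAlgHom.ext fun a => ?_
  change MinTensor.rep π' hπ' ρ' hρ' (Δlim a) = MinTensor.rep π hπ ρ hρ (Δ m (p m a))
  rw [← h]
  exact MinTensor.rep_eq_rep_map hπ hρ (c.continuous m) (c.continuous m) hπ' hρ' hp hr _

include h hp hr hs hc hΔc in
theorem rep_comulId_limit (a : P) :
    MinTensor₃.rep π' hπ' ρ' hρ' σ' hσ' (comulId Δlim (Δlim a)) =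
      MinTensor₃.rep π hπ ρ hρ σ hσ (comulId (Δ m) (Δ m (p m a))) := by
  rw [MinTensor₃.rep_comulId _ _ _ _ _ _ _ hc, MinTensor₃.rep_comulId _ _ _ _ _ _ _ (hΔc m), ← h]
  exact MinTensor.rep_eq_rep_map _ hσ (c.continuous m) (c.continuous m) _ hσ'
    (c.rep_comp_limit h hπ hπ' hp hρ hρ' hr) hs _

include h hp hr hs hc hΔc in
theorem rep_idComul_limit (a : P) :
    MinTensor₃.rep π' hπ' ρ' hρ' σ' hσ' (idComul Δlim (Δlim a)) =
      MinTensor₃.rep π hπ ρ hρ σ hσ (idComul (Δ m) (Δ m (p m a))) := by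
  -- The values of `id ⊗ Δ` are known after conjugation by the associator, which is injective.
  refine EquivLike.injective (hilbertAssoc H K L).conjStarAlgEquiv ?_
  rw [MinTensor₃.conj_rep_idComul _ _ _ _ _ _ _ hc,
    MinTensor₃.conj_rep_idComul _ _ _ _ _ _ _ (hΔc m), ← h]
  exact MinTensor.rep_eq_rep_map hπ _ (c.continuous m) (c.continuous m) hπ' _ hp
    (c.rep_comp_limit h hρ hρ' hr hσ hσ' hs) _

end

include c in
theorem exists_factor₃ (r s t : Rep P) :
    ∃ m, (∃ π : A m →⋆ₐ[ℂ] (r.H →L[ℂ] r.H), Continuous π ∧ r.π = π.comp (p m)) ∧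
      (∃ ρ : A m →⋆ₐ[ℂ] (s.H →L[ℂ] s.H), Continuous ρ ∧ s.π = ρ.comp (p m)) ∧
      ∃ σ : A m →⋆ₐ[ℂ] (t.H →L[ℂ] t.H), Continuous σ ∧ t.π = σ.comp (p m) := by
  obtain ⟨n₁, h₁⟩ := c.factor r
  obtain ⟨n₂, h₂⟩ := c.factor s
  obtain ⟨n₃, h₃⟩ := c.factor t
  exact ⟨max n₁ (max n₂ n₃), h₁ _ (le_max_left _ _),
    h₂ _ ((le_max_left _ _).trans (le_max_right _ _)),
    h₃ _ ((le_max_right _ _).trans (le_max_right _ _))⟩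

include h hΔc in
theorem rep_coassoc_limit (hΔ : ∀ n a, comulId (Δ n) (Δ n a) = idComul (Δ n) (Δ n a)) (a : P)
    (r s t : Rep P) :
    MinTensor₃.rep r.π r.continuous_π s.π s.continuous_π t.π t.continuous_π
        (comulId Δlim (Δlim a)) =
      MinTensor₃.rep r.π r.continuous_π s.π s.continuous_π t.π t.continuous_π
        (idComul Δlim (Δlim a)) := by
  have hc := c.continuous_limitHom h hΔc
  obtain ⟨m, ⟨π, hπ, hp⟩, ⟨ρ, hρ, hr⟩, σ, hσ, hs⟩ := c.exists_factor₃ r s t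
  exact (c.rep_comulId_limit h hΔc hc hπ r.continuous_π hp hρ s.continuous_π hr hσ
    t.continuous_π hs a).trans ((congrArg _ (hΔ m (p m a))).trans
    (c.rep_idComul_limit h hΔc hc hπ r.continuous_π hp hρ s.continuous_π hr hσ
      t.continuous_π hs a).symm)

include h hΔc in
theorem coassoc_limit (hΔ : ∀ n a, comulId (Δ n) (Δ n a) = idComul (Δ n) (Δ n a)) (a : P) :
    comulId Δlim (Δlim a) = idComul Δlim (Δlim a) :=
  MinTensor₃.ext_rep fun r s t => c.rep_coassoc_limit h hΔc hΔ a r s t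

/-- The image of a span under the linear map `p_n ⊗ p_n` is the span of the image, so it contains
the dense span of `Y n`. -/
theorem dense_span_limit {X : Set (MinTensor P P)} {Y : ∀ n, Set (MinTensor (A n) (A n))}
    (hY : ∀ n, Dense (Submodule.span ℂ (Y n) : Set (MinTensor (A n) (A n))))
    (hXY : ∀ n, Y n ⊆ c.square n '' X) : Dense (Submodule.span ℂ X : Set (MinTensor P P)) := by
  refine c.dense_of_square fun n => (hY n).mono ?_
  have : Submodule.span ℂ (Y n) ≤
      (Submodule.span ℂ X).map (c.square n).toAlgHom.toLinearMap := by
    rw [Submodule.map_span]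
    exact Submodule.span_mono (hXY n)
  exact this

include h hΔc in
theorem isComultiplication_limit (hΔ : ∀ n, IsComultiplication (Δ n)) :
    IsComultiplication Δlim := by
  refine ⟨c.coassoc_limit h hΔc fun n => (hΔ n).1,
    c.dense_span_limit (fun n => (hΔ n).2.1) fun n => ?_,
    c.dense_span_limit (fun n => (hΔ n).2.2) fun n => ?_⟩
  · rintro _ ⟨a, b, rfl⟩
    obtain ⟨a, rfl⟩ := c.surjective n a
    obtain ⟨b, rfl⟩ := c.surjective n b
    exact ⟨_, ⟨a, b, rfl⟩, by rw [map_mul, h, c.square_tmul, map_one]⟩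
  · rintro _ ⟨a, b, rfl⟩
    obtain ⟨a, rfl⟩ := c.surjective n a
    obtain ⟨b, rfl⟩ := c.surjective n b
    exact ⟨_, ⟨a, b, rfl⟩, by rw [map_mul, h, c.square_tmul, map_one]⟩

end IsLimitCone

end LimitCone

/-! ### σ-C⋆-quantum groups from C⋆-compact quantum groups and from their inverse limits. -/

section QuantumGroups

theorem isLimitCone_inverseLimit {A : ℕ → Type u} [∀ n, CStarAlgebra (A n)]
    {θ : ∀ n, A (n + 1) →⋆ₐ[ℂ] A n} (hθ : ∀ n, Function.Surjective (θ n)) :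
    IsLimitCone θ (proj θ) where
  continuous_connecting := continuous_connecting θ
  continuous := continuous_proj θ
  surjective := proj_surjective hθ
  coherent := connecting_proj
  factor r := exists_rep_factor hθ r.π r.continuous_π

theorem isSigmaCStarAlgebra_inverseLimit {A : ℕ → Type u} [∀ n, CStarAlgebra (A n)]
    (θ : ∀ n, A (n + 1) →⋆ₐ[ℂ] A n) : IsSigmaCStarAlgebra (inverseLimit θ) :=
  ⟨A, inferInstance, θ, StarAlgEquiv.refl .., continuous_id, continuous_id⟩

/-- A C⋆-algebra as the inverse limit of a constant sequence. -/
def constantLimitEquiv (A : Type u) [CStarAlgebra A] :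
    A ≃⋆ₐ[ℂ] inverseLimit (A := fun _ : ℕ => A) (fun _ => StarAlgHom.id ℂ A) where
  toFun a := ⟨fun _ => a, fun _ => rfl⟩
  invFun x := x.1 0
  left_inv _ := rfl
  right_inv x := Subtype.ext (funext fun n => by
    induction n with
    | zero => rfl
    | succ n ih => exact ih.trans (x.2 n).symm)
  map_mul' _ _ := rfl
  map_add' _ _ := rfl
  map_star' _ := rfl
  map_smul' _ _ := rfl

theorem isSigmaCStarAlgebra_of_cstarAlgebra (A : Type u) [CStarAlgebra A] :
    IsSigmaCStarAlgebra A :=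
  ⟨fun _ => A, fun _ => inferInstance, fun _ => StarAlgHom.id ℂ A, constantLimitEquiv A,
    Continuous.subtype_mk (continuous_pi fun _ => continuous_id) _,
    (continuous_apply 0).comp continuous_subtype_val⟩

theorem IsCompactQuantumGroup.isSigmaCStarQuantumGroup {A : Type u} [CStarAlgebra A]
    {Δ : A →⋆ₐ[ℂ] MinTensor A A} (h : IsCompactQuantumGroup A Δ) : IsSigmaCStarQuantumGroup A Δ :=
  ⟨isSigmaCStarAlgebra_of_cstarAlgebra A, RepCompletion.continuous_of_cstarAlgebra _ Δ, h⟩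

theorem inverseLimit_quantumGroup {A : ℕ → Type u} [∀ n, CStarAlgebra (A n)]
    {θ : ∀ n, A (n + 1) →⋆ₐ[ℂ] A n} {Δ : ∀ n, A n →⋆ₐ[ℂ] MinTensor (A n) (A n)}
    (hθ : ∀ n, Function.Surjective (θ n)) (hΔ : ∀ n, IsCompactQuantumGroup (A n) (Δ n))
    (hs : IsSystemMorphism θ Δ) :
    TensorIsInverseLimit θ ∧
      ∃ Δlim : inverseLimit θ →⋆ₐ[ℂ] MinTensor (inverseLimit θ) (inverseLimit θ),
        IsLimitHom θ Δ Δlim ∧ (∀ Δ', IsLimitHom θ Δ Δ' → Δ' = Δlim) ∧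
        IsSigmaCStarQuantumGroup (inverseLimit θ) Δlim := by
  have c := isLimitCone_inverseLimit hθ
  have hc := fun n => RepCompletion.continuous_of_cstarAlgebra _ (Δ n)
  have hlim := c.square_limitHom hs
  exact ⟨⟨c.isEmbedding_squares, c.range_squares⟩, c.limitHom hs, hlim,
    fun Δ' h' => c.eq_limitHom hlim h', isSigmaCStarAlgebra_inverseLimit θ,
    c.continuous_limitHom hlim hc, c.isComultiplication_limit hlim hc hΔ⟩

end QuantumGroups

/-! ### Surjectivity of homomorphisms with dense range -/

section Surjective

variable {A B : Type*} [CStarAlgebra A] [CStarAlgebra B]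

/-- Functional calculus with the function that clips to `[-‖φ a‖, ‖φ a‖]` bounds the norm of the
lift. This function is the identity on the spectrum of `φ a`, so the image under `φ` does not
change. -/
theorem exists_norm_le_of_isSelfAdjoint (φ : A →⋆ₐ[ℂ] B) {a : A} (ha : IsSelfAdjoint a) :
    ∃ a', φ a' = φ a ∧ ‖a'‖ ≤ ‖φ a‖ := by
  have hφa : IsSelfAdjoint (φ a) := ha.map φ
  have hφ : Continuous φ := continuous_cstarHom φ
  let f : ℝ → ℝ := fun x => max (-‖φ a‖) (min x ‖φ a‖)
  have hf : Continuous f := by fun_prop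
  refine ⟨cfc f a, ?_, norm_cfc_le (norm_nonneg _) fun x _ => ?_⟩
  · rw [StarAlgHom.map_cfc φ f a hf.continuousOn hφ ha hφa]
    conv_rhs => rw [← cfc_id' ℝ (φ a)]
    refine cfc_congr fun x hx => ?_
    -- Only an inequality, since `B` may be the zero algebra.
    have h1 : ‖(1 : B)‖ ≤ 1 := by
      rcases subsingleton_or_nontrivial B with _ | _
      · rw [Subsingleton.elim (1 : B) 0, norm_zero]; exact zero_le_one
      · rw [CStarRing.norm_one]
    have hx' : |x| ≤ ‖φ a‖ := (spectrum.norm_le_norm_mul_of_mem hx).trans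
      (mul_le_of_le_one_right (norm_nonneg _) h1)
    obtain ⟨h2, h3⟩ := abs_le.1 hx'
    change max (-‖φ a‖) (min x ‖φ a‖) = x
    rw [min_eq_left h3, max_eq_right h2]
  · rw [Real.norm_eq_abs, abs_le]
    exact ⟨le_max_left _ _, max_le (by linarith [norm_nonneg (φ a)]) (min_le_right _ _)⟩

/-- Elements of the range have preimages of controlled norm, so a series of successive
approximations in the complete algebra `A` reaches every point of the closure of the range. -/
theorem surjective_of_denseRange (φ : A →⋆ₐ[ℂ] B) (h : DenseRange φ) : Function.Surjective φ := by
  let g : NormedAddGroupHom A B := AddMonoidHom.mkNormedAddGroupHom (φ : A →+ B) 1 fun x => by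
    simpa using NonUnitalStarAlgHom.norm_apply_le φ x
  -- The constant `2` comes from lifting the real and imaginary parts separately, each with norm at
  -- most `‖φ a‖`.
  have hg : g.SurjectiveOnWith (φ : A →+ B).range 2 := by
    rintro _ ⟨a, rfl⟩
    obtain ⟨b, hb, hb'⟩ := exists_norm_le_of_isSelfAdjoint φ (realPart a).2
    obtain ⟨c, hc, hc'⟩ := exists_norm_le_of_isSelfAdjoint φ (imaginaryPart a).2
    have hre : φ (realPart a) = realPart (φ a) := by
      simp [realPart_apply_coe, ← Complex.coe_smul]
      exact map_star φ a
    have him : φ (imaginaryPart a) = imaginaryPart (φ a) := by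
      simp [imaginaryPart_apply_coe, ← Complex.coe_smul]
      exact map_star φ a
    refine ⟨b + Complex.I • c, ?_, ?_⟩
    · change φ (b + Complex.I • c) = φ a
      rw [map_add, map_smul, hb, hc, ← map_smul, ← map_add, realPart_add_I_smul_imaginaryPart]
    · change _ ≤ 2 * ‖φ a‖
      have h1 : ‖b‖ ≤ ‖φ a‖ := hb'.trans (hre ▸ realPart.norm_le (φ a))
      have h2 : ‖c‖ ≤ ‖φ a‖ := hc'.trans (him ▸ imaginaryPart.norm_le (φ a))
      refine (norm_add_le _ _).trans ?_
      rw [norm_smul, Complex.norm_I, one_mul]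
      linarith
  intro b
  have hb : b ∈ (φ : A →+ B).range.topologicalClosure := h b
  obtain ⟨a, ha, -⟩ := controlled_closure_of_complete two_pos one_pos hg b hb
  exact ⟨a, ha⟩

end Surjective

/-! ### Matrices that satisfy the relations of `SU_q(n)` -/

section Relations

/-- Expand by distributivity and collect the factors `g` on the right. This is the multiplicativity
behind the determinant relation for a product of matrices. -/
theorem prod_ofFn_sum_mul {B : Type*} [Ring B] {ι : Type*} [Fintype ι] {N : ℕ}
    (f g : Fin N → ι → B) (h : ∀ k l k' l', Commute (f k l) (g k' l')) :
    (List.ofFn fun k => ∑ l, f k l * g k l).prod =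
      ∑ m : Fin N → ι,
        (List.ofFn fun k => f k (m k)).prod * (List.ofFn fun k => g k (m k)).prod := by
  induction N with
  | zero => simp
  | succ N ih =>
    rw [List.ofFn_succ, List.prod_cons, ih (fun k => f k.succ) (fun k => g k.succ)
      (fun _ _ _ _ => h _ _ _ _), Finset.sum_mul_sum,
      ← (Fin.consEquiv fun _ : Fin (N + 1) => ι).sum_comp, Fintype.sum_prod_type]
    refine Finset.sum_congr rfl fun x _ => Finset.sum_congr rfl fun m _ => ?_
    have hc : Commute (g 0 x) (List.ofFn fun k => f (Fin.succ k) (m k)).prod :=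
      Commute.list_prod_right _ _ fun y hy => by
        obtain ⟨k, rfl⟩ := List.mem_ofFn.1 hy
        exact (h _ _ _ _).symm
    simp only [Fin.consEquiv_apply, List.ofFn_succ, List.prod_cons, Fin.cons_zero, Fin.cons_succ]
    rw [mul_assoc, ← mul_assoc (g 0 x), hc.eq]
    simp only [mul_assoc]

theorem prod_ofFn_succAbove {M : Type*} [Monoid M] {n : ℕ} (f : Fin (n + 1) → M) (p : Fin (n + 1))
    (hp : f p = 1) : (List.ofFn f).prod = (List.ofFn fun k => f (p.succAbove k)).prod := by
  induction n with
  | zero => simpa [Fin.fin_one_eq_zero p] using hp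
  | succ n ih =>
    cases p using Fin.cases with
    | zero => simp [hp]
    | succ p =>
      rw [List.ofFn_succ, List.prod_cons, ih (fun k => f k.succ) p hp,
        List.ofFn_succ (f := fun k => f (p.succ.succAbove k)), List.prod_cons]
      simp

variable {q : ℝ} {n : ℕ} {B C : Type*} [Ring B] [StarRing B] [Algebra ℂ B]
  [Ring C] [StarRing C] [Algebra ℂ C]

theorem SUqRelations.map {u : Fin n → Fin n → B} (h : SUqRelations q u) (φ : B →⋆ₐ[ℂ] C) :
    SUqRelations q fun i j => φ (u i j) where
  mul_star i j := by
    simp only [← map_star, ← map_mul, ← map_sum, h.mul_star]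
    split_ifs <;> simp
  star_mul i j := by
    simp only [← map_star, ← map_mul, ← map_sum, h.star_mul]
    split_ifs <;> simp
  det j := by
    have := congrArg φ (h.det j)
    simpa only [map_sum, map_smul, map_list_prod, List.map_ofFn, map_one, Function.comp_def]
      using this

/-- The product of two matrices with commuting entries that satisfy the relations satisfies the
relations. -/
theorem SUqRelations.mul {a b : Fin n → Fin n → B} (ha : SUqRelations q a)
    (hb : SUqRelations q b) (h : ∀ i j k l, Commute (a i j) (b k l)) :
    SUqRelations q fun i j => ∑ k, a i k * b k j where
  mul_star i j := by
    calc ∑ k, (∑ l, a i l * b l k) * star (∑ m, a j m * b m k)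
        = ∑ l, ∑ m, a i l * (∑ k, b l k * star (b m k)) * star (a j m) := by
          simp only [star_sum, StarMul.star_mul, Finset.sum_mul_sum]
          rw [Finset.sum_comm]
          refine Finset.sum_congr rfl fun l _ => ?_
          rw [Finset.sum_comm]
          refine Finset.sum_congr rfl fun m _ => ?_
          simp only [Finset.mul_sum, Finset.sum_mul, mul_assoc]
      _ = _ := by simp [hb.mul_star, ha.mul_star]
  star_mul i j := by
    calc ∑ k, star (∑ l, a k l * b l i) * (∑ m, a k m * b m j)
        = ∑ l, ∑ m, star (b l i) * (∑ k, star (a k l) * a k m) * b m j := by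
          simp only [star_sum, StarMul.star_mul, Finset.sum_mul_sum]
          rw [Finset.sum_comm]
          refine Finset.sum_congr rfl fun l _ => ?_
          rw [Finset.sum_comm]
          refine Finset.sum_congr rfl fun m _ => ?_
          simp only [Finset.mul_sum, Finset.sum_mul, mul_assoc]
      _ = _ := by simp [hb.star_mul, ha.star_mul]
  det j := by
    -- After expansion, the sum over `i` is the determinant relation for `b` with rows `m`. It
    -- leaves `coeffE q m`, and the sum over `m` is then the determinant relation for `a`.
    calc ∑ i, coeffE q i • (List.ofFn fun k => ∑ l, a (j k) l * b l (i k)).prod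
        = ∑ m : Fin n → Fin n, (List.ofFn fun k => a (j k) (m k)).prod *
            ∑ i, coeffE q i • (List.ofFn fun k => b (m k) (i k)).prod := by
          simp only [Finset.mul_sum]
          rw [Finset.sum_comm]
          refine Finset.sum_congr rfl fun i _ => ?_
          rw [prod_ofFn_sum_mul (fun k l => a (j k) l) (fun k l => b l (i k))
            (fun _ _ _ _ => h _ _ _ _), Finset.smul_sum]
          simp only [mul_smul_comm]
      _ = _ := by
          simp only [hb.det, mul_smul_comm, mul_one, ha.det]

theorem coeffE_of_not_injective {i : Fin n → Fin n} (h : ¬ Function.Injective i) :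
    coeffE q i = 0 := if_neg h

theorem coeffE_ne_zero (hq : q ≠ 0) {i : Fin n → Fin n} (h : Function.Injective i) :
    coeffE q i ≠ 0 := by
  rw [coeffE, if_pos h]
  exact pow_ne_zero _ (by simpa using hq)

/-- The expansion of the quantum determinant along a row. -/
theorem SUqRelations.coeffE_smul_star {u : Fin (n + 1) → Fin (n + 1) → B} (h : SUqRelations q u)
    {j : Fin (n + 1) → Fin (n + 1)} (hj : Function.Injective j) (m : Fin (n + 1)) :
    coeffE q j • star (u (j 0) m) = ∑ i : Fin n → Fin (n + 1),
      coeffE q (Fin.cons m i : Fin (n + 1) → Fin (n + 1)) •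
        (List.ofFn fun k => u (j k.succ) (i k)).prod := by
  -- `J x` replaces the first entry of `j` by `x`. Since `j` is a permutation, any `x ≠ j 0` repeats
  -- a later entry and the coefficient vanishes.
  let J : Fin (n + 1) → Fin (n + 1) → Fin (n + 1) := fun x => Fin.cons x fun k => j k.succ
  have hJ : ∀ x, x ≠ j 0 → coeffE q (J x) = 0 := fun x hx => by
    obtain ⟨k, rfl⟩ := (Finite.injective_iff_surjective.1 hj) x
    obtain ⟨k, rfl⟩ := Fin.exists_succ_eq.2 fun h0 : k = 0 => hx (by rw [h0])
    refine coeffE_of_not_injective fun hinj => Fin.succ_ne_zero k (hinj ?_)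
    simp [J]
  have hJ0 : J (j 0) = j := Fin.cons_self_tail j
  -- Multiply the determinant relation for the rows `J x` on the left by `star (u x m)` and sum over
  -- `x`. The relation `∑ x, star (u x m) * u x y = δ_my` removes the first factor of each product
  -- and fixes its column to `m`.
  calc coeffE q j • star (u (j 0) m)
      = ∑ x, star (u x m) * (coeffE q (J x) • (1 : B)) := by
        rw [Finset.sum_eq_single (j 0), hJ0, mul_smul_comm, mul_one]
        · exact fun x _ hx => by rw [hJ x hx, zero_smul, mul_zero]
        · exact fun hx => absurd (Finset.mem_univ _) hx
    _ = ∑ x, star (u x m) * ∑ y, ∑ i : Fin n → Fin (n + 1),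
          coeffE q (Fin.cons y i : Fin (n + 1) → Fin (n + 1)) •
            (u x y * (List.ofFn fun k => u (j k.succ) (i k)).prod) := by
        refine Finset.sum_congr rfl fun x _ => ?_
        rw [← h.det (J x), ← (Fin.consEquiv fun _ : Fin (n + 1) => Fin (n + 1)).sum_comp,
          Fintype.sum_prod_type]
        simp [J, Fin.consEquiv]
    _ = ∑ y, ∑ i : Fin n → Fin (n + 1),
          coeffE q (Fin.cons y i : Fin (n + 1) → Fin (n + 1)) •
            ((∑ x, star (u x m) * u x y) * (List.ofFn fun k => u (j k.succ) (i k)).prod) := by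
        simp only [Finset.mul_sum, Finset.sum_mul, Finset.smul_sum, mul_smul_comm, mul_assoc]
        rw [Finset.sum_comm]
        exact Finset.sum_congr rfl fun y _ => Finset.sum_comm
    _ = _ := by
        simp only [h.star_mul, ite_mul, one_mul, zero_mul]
        rw [Finset.sum_eq_single m]
        · simp
        · exact fun y _ hy => by simp [hy.symm]
        · exact fun hm => absurd (Finset.mem_univ _) hm

/-- The adjoints of the matrix entries are polynomials in the matrix entries. -/
theorem SUqRelations.star_mem_adjoin (hq : q ≠ 0) {u : Fin n → Fin n → B}
    (h : SUqRelations q u) (i j : Fin n) :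
    star (u i j) ∈ Algebra.adjoin ℂ (Set.range fun p : Fin n × Fin n => u p.1 p.2) := by
  cases n with
  | zero => exact i.elim0
  | succ n =>
    -- The transposition puts the row `i` first. Its coefficient is a power of `-q`, hence
    -- invertible.
    have hinj := (Equiv.swap 0 i).injective
    have key := h.coeffE_smul_star hinj j
    rw [Equiv.swap_apply_left] at key
    rw [← inv_smul_smul₀ (coeffE_ne_zero hq hinj) (star (u i j)), key]
    refine Subalgebra.smul_mem _ (Subalgebra.sum_mem _ fun k _ => Subalgebra.smul_mem _
      (Subalgebra.list_prod_mem _ fun x hx => ?_) _) _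
    obtain ⟨l, rfl⟩ := List.mem_ofFn.1 hx
    exact Algebra.subset_adjoin ⟨(_, _), rfl⟩

/-- The matrix entries are polynomials in their adjoints. -/
theorem SUqRelations.mem_adjoin_star [StarModule ℂ B] (hq : q ≠ 0) {u : Fin n → Fin n → B}
    (h : SUqRelations q u) (i j : Fin n) :
    u i j ∈ Algebra.adjoin ℂ (Set.range fun p : Fin n × Fin n => star (u p.1 p.2)) := by
  have h1 := h.star_mem_adjoin hq i j
  rw [← Subalgebra.mem_star_iff, Subalgebra.star_adjoin_comm] at h1
  refine Algebra.adjoin_mono ?_ h1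
  rintro x ⟨p, hp⟩
  exact ⟨p, (congrArg star hp).trans (star_star x)⟩

end Relations

/-! ### The block matrix `diag(u, 1)` -/

section BlockMatrix

/-- The inserted value is the largest one, so it is inverted with every later position and with no
earlier one. -/
theorem inversions_insertNth {n : ℕ} (p : Fin (n + 1)) (i : Fin n → Fin n) :
    inversions (p.insertNth (Fin.last n) fun k => (i k).castSucc : Fin (n + 1) → Fin (n + 1)) =
      (∑ k, if p < p.succAbove k then 1 else 0) + inversions i := by
  simp only [inversions, Finset.card_filter, Fintype.sum_prod_type]
  rw [Fin.sum_univ_succAbove _ p]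
  simp only [Fin.sum_univ_succAbove _ p, Fin.insertNth_apply_same, Fin.insertNth_apply_succAbove,
    lt_irrefl, false_and, if_false, Fin.castSucc_lt_last, and_true, zero_add,
    Fin.castSucc_lt_castSucc_iff, Fin.succAbove_lt_succAbove_iff]
  congr 1
  refine Finset.sum_congr rfl fun x _ => ?_
  rw [if_neg fun h => (Fin.castSucc_lt_last _).not_gt h.2, zero_add]

theorem injective_insertNth_iff {n : ℕ} (p : Fin (n + 1)) (i : Fin n → Fin n) :
    Function.Injective
        (p.insertNth (Fin.last n) fun k => (i k).castSucc : Fin (n + 1) → Fin (n + 1)) ↔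
      Function.Injective i := by
  constructor
  · intro h a b hab
    refine p.succAbove_right_injective (h ?_)
    simp only [Fin.insertNth_apply_succAbove, hab]
  · intro h a b hab
    rcases Fin.eq_self_or_eq_succAbove p a with ha | ⟨a, rfl⟩ <;>
      rcases Fin.eq_self_or_eq_succAbove p b with hb | ⟨b, rfl⟩
    · exact ha.trans hb.symm
    · rw [ha, Fin.insertNth_apply_same, Fin.insertNth_apply_succAbove] at hab
      exact absurd hab.symm (Fin.castSucc_lt_last _).ne
    · rw [hb, Fin.insertNth_apply_same, Fin.insertNth_apply_succAbove] at hab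
      exact absurd hab (Fin.castSucc_lt_last _).ne
    · rw [Fin.insertNth_apply_succAbove, Fin.insertNth_apply_succAbove] at hab
      rw [h (Fin.castSucc_injective n hab)]

/-- The extra power of `-q` depends only on `p`, so it is common to both sides of the determinant
relation for `diag(u, 1)`. -/
theorem coeffE_insertNth (q : ℝ) {n : ℕ} (p : Fin (n + 1)) (i : Fin n → Fin n) :
    coeffE q (p.insertNth (Fin.last n) fun k => (i k).castSucc : Fin (n + 1) → Fin (n + 1)) =
      ((-q : ℝ) : ℂ) ^ (∑ k, if p < p.succAbove k then 1 else 0) * coeffE q i := by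
  rw [coeffE, coeffE, inversions_insertNth, pow_add, mul_ite, mul_zero]
  simp only [injective_insertNth_iff]

theorem exists_insertNth {n : ℕ} {j : Fin (n + 1) → Fin (n + 1)} {p : Fin (n + 1)}
    (hj : ∀ k, j k = Fin.last n ↔ k = p) :
    ∃ i : Fin n → Fin n, j = p.insertNth (Fin.last n) fun k => (i k).castSucc := by
  have h : ∀ k, j (p.succAbove k) ≠ Fin.last n := fun k hk => Fin.succAbove_ne p k ((hj _).1 hk)
  refine ⟨fun k => (j (p.succAbove k)).castPred (h k), ?_⟩
  rw [Fin.eq_insertNth_iff]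
  exact ⟨(hj p).2 rfl, funext fun k => (Fin.castSucc_castPred _ (h k)).symm⟩

variable {q : ℝ} {n : ℕ} {B : Type*} [Ring B]

/-- The block matrix `diag(u, 1)`. -/
def blockMatrix (u : Fin n → Fin n → B) (i j : Fin (n + 1)) : B :=
  if h : i.val < n ∧ j.val < n then u ⟨i.val, h.1⟩ ⟨j.val, h.2⟩ else if i = j then 1 else 0

variable (u : Fin n → Fin n → B)

@[simp]
theorem blockMatrix_castSucc (i j : Fin n) : blockMatrix u i.castSucc j.castSucc = u i j :=
  dif_pos ⟨i.2, j.2⟩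

@[simp]
theorem blockMatrix_last : blockMatrix u (Fin.last n) (Fin.last n) = 1 := by
  simp [blockMatrix]

@[simp]
theorem blockMatrix_castSucc_last (i : Fin n) : blockMatrix u i.castSucc (Fin.last n) = 0 := by
  simp [blockMatrix, (Fin.castSucc_lt_last i).ne]

@[simp]
theorem blockMatrix_last_castSucc (i : Fin n) : blockMatrix u (Fin.last n) i.castSucc = 0 := by
  simp [blockMatrix, (Fin.castSucc_lt_last i).ne']

theorem blockMatrix_eq_zero {i j : Fin (n + 1)} (h : ¬(i = Fin.last n ↔ j = Fin.last n)) :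
    blockMatrix u i j = 0 := by
  cases i using Fin.lastCases <;> cases j using Fin.lastCases <;>
    simp_all [(Fin.castSucc_lt_last _).ne]

variable [StarRing B] [Algebra ℂ B] {u}

theorem prod_blockMatrix_insertNth (p : Fin (n + 1)) (j i : Fin n → Fin n) :
    (List.ofFn fun k => blockMatrix u
      ((p.insertNth (Fin.last n) fun k => (j k).castSucc : Fin (n + 1) → Fin (n + 1)) k)
      ((p.insertNth (Fin.last n) fun k => (i k).castSucc : Fin (n + 1) → Fin (n + 1)) k)).prod =
      (List.ofFn fun k => u (j k) (i k)).prod := by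
  rw [prod_ofFn_succAbove _ p (by simp)]
  simp

theorem prod_blockMatrix_eq_zero {i j : Fin (n + 1) → Fin (n + 1)} {k : Fin (n + 1)}
    (h : ¬(j k = Fin.last n ↔ i k = Fin.last n)) :
    (List.ofFn fun k => blockMatrix u (j k) (i k)).prod = 0 :=
  List.prod_eq_zero (List.mem_ofFn.2 ⟨k, blockMatrix_eq_zero u h⟩)

/-- A tuple that does not take the last value exactly once is not a permutation, so its coefficient
vanishes. -/
theorem coeffE_smul_prod_blockMatrix_eq_zero {i j : Fin (n + 1) → Fin (n + 1)}
    (h : ∀ p, ¬∀ k, i k = Fin.last n ↔ k = p) :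
    coeffE q i • (List.ofFn fun k => blockMatrix u (j k) (i k)).prod = 0 := by
  rw [coeffE_of_not_injective, zero_smul]
  intro hi
  obtain ⟨p, hp⟩ := Finite.injective_iff_surjective.1 hi (Fin.last n)
  exact h p fun k => ⟨fun hk => hi (hk.trans hp.symm), fun hk => hk ▸ hp⟩

/-- If `j` takes the last value exactly once, at `p`, then only tuples `i` with the last value
exactly at `p` contribute, and the relation is a power of `-q` times the one for `u`. Otherwise `j`
is not injective and the right side is zero. On the left, either the coefficient of `i` vanishes, or
`i` and `j` take the last value at different positions and some entry of `diag(u, 1)` is zero. -/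
theorem SUqRelations.blockMatrix_det (h : SUqRelations q u) (j : Fin (n + 1) → Fin (n + 1)) :
    ∑ i : Fin (n + 1) → Fin (n + 1),
      coeffE q i • (List.ofFn fun k => blockMatrix u (j k) (i k)).prod = coeffE q j • (1 : B) := by
  by_cases hj : ∃ p, ∀ k, j k = Fin.last n ↔ k = p
  · obtain ⟨p, hp⟩ := hj
    obtain ⟨j, rfl⟩ := exists_insertNth hp
    rw [coeffE_insertNth, mul_smul, ← h.det j, Finset.smul_sum]
    symm
    refine Fintype.sum_of_injective
      (fun i => (p.insertNth (Fin.last n) fun k => (i k).castSucc : Fin (n + 1) → Fin (n + 1)))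
      (fun i i' hii => ?_) _ _ (fun i hi => ?_) fun i => ?_
    · exact funext fun k => Fin.castSucc_injective n
        (by simpa using congrFun hii (p.succAbove k))
    · by_cases hpi : ∀ k, i k = Fin.last n ↔ k = p
      · obtain ⟨i', hi'⟩ := exists_insertNth hpi
        exact absurd ⟨i', hi'.symm⟩ hi
      · obtain ⟨k, hk⟩ := not_forall.1 hpi
        rw [prod_blockMatrix_eq_zero (k := k) fun e => hk (e.symm.trans (hp k)), smul_zero]
    · rw [prod_blockMatrix_insertNth, coeffE_insertNth, mul_smul]
  · have hj' := not_exists.1 hj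
    have : ¬ Function.Injective j := fun hinj => by
      obtain ⟨p, hp⟩ := Finite.injective_iff_surjective.1 hinj (Fin.last n)
      exact hj' p fun k => ⟨fun hk => hinj (hk.trans hp.symm), fun hk => hk ▸ hp⟩
    rw [coeffE_of_not_injective this, zero_smul]
    refine Finset.sum_eq_zero fun i _ => ?_
    by_cases hi : ∃ p, ∀ k, i k = Fin.last n ↔ k = p
    · obtain ⟨p, hp⟩ := hi
      obtain ⟨k, hk⟩ := not_forall.1 (hj' p)
      rw [prod_blockMatrix_eq_zero (k := k) fun e => hk (e.trans (hp k)), smul_zero]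
    · exact coeffE_smul_prod_blockMatrix_eq_zero (not_exists.1 hi)

theorem SUqRelations.blockMatrix (h : SUqRelations q u) : SUqRelations q (blockMatrix u) where
  mul_star i j := by
    cases i using Fin.lastCases <;> cases j using Fin.lastCases <;>
      simp [Fin.sum_univ_castSucc, h.mul_star, (Fin.castSucc_lt_last _).ne,
        (Fin.castSucc_lt_last _).ne']
  star_mul i j := by
    cases i using Fin.lastCases <;> cases j using Fin.lastCases <;>
      simp [Fin.sum_univ_castSucc, h.star_mul, (Fin.castSucc_lt_last _).ne,
        (Fin.castSucc_lt_last _).ne']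
  det := h.blockMatrix_det

end BlockMatrix

/-! ### Homomorphisms on `C(SU_q(n))` -/

section CSUq

variable {q : ℝ} {n : ℕ}

/-- The generators of the free `*`-algebra. -/
def PreSUq.gen (q : ℝ) {n : ℕ} (i j : Fin n) : PreSUq q n := FreeStar.gen (i, j)

theorem PreSUq.eval_gen {B : Type*} [Ring B] [StarRing B] [Algebra ℂ B] [StarModule ℂ B]
    (u : Fin n → Fin n → B) (i j : Fin n) : PreSUq.eval u (PreSUq.gen q i j) = u i j :=
  FreeStar.lift_gen _ _

theorem PreSUq.mem_of_gen {R : Set (PreSUq q n)} (hc : ∀ c, algebraMap ℂ (PreSUq q n) c ∈ R)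
    (hg : ∀ i j, PreSUq.gen q i j ∈ R) (hs : ∀ i j, star (PreSUq.gen q i j) ∈ R)
    (hm : ∀ x y, x ∈ R → y ∈ R → x * y ∈ R) (ha : ∀ x y, x ∈ R → y ∈ R → x + y ∈ R)
    (x : PreSUq q n) : x ∈ R :=
  freeStar_induction (X := Fin n × Fin n) (P := fun x => (show PreSUq q n from x) ∈ R) hc
    (fun x => by
      rcases x with ⟨i, j⟩ | ⟨i, j⟩
      · exact hg i j
      · have := hs i j
        rwa [show star (PreSUq.gen q i j) = FreeStar.ι (Sum.inr (i, j)) from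
          freeStar_star_ι (Sum.inl (i, j))] at this) hm ha x

theorem PreSUq.hom_ext {B : Type*} [Ring B] [StarRing B] [Algebra ℂ B]
    {φ ψ : PreSUq q n →⋆ₐ[ℂ] B} (h : ∀ i j, φ (PreSUq.gen q i j) = ψ (PreSUq.gen q i j)) :
    φ = ψ :=
  StarAlgHom.ext fun x => PreSUq.mem_of_gen (R := {x | φ x = ψ x})
    (fun c => by simp only [Set.mem_ofPred_eq, AlgHomClass.commutes]) h
    (fun i j => by simp only [Set.mem_ofPred_eq, map_star, h])
    (fun x y hx hy => (map_mul φ x y).trans ((congrArg₂ _ hx hy).trans (map_mul ψ x y).symm))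
    (fun x y hx hy => (map_add φ x y).trans ((congrArg₂ _ hx hy).trans (map_add ψ x y).symm)) x

variable (q n) in
/-- The canonical map of the free `*`-algebra. -/
def CSUq.of : PreSUq q n →⋆ₐ[ℂ] CSUq q n where
  toFun x := (x : Completion (PreSUq q n))
  map_one' := coe_one _
  map_mul' := coe_mul
  map_zero' := coe_zero
  map_add' := coe_add
  commutes' _ := rfl
  map_star' := coe_star

theorem CSUq.of_gen (i j : Fin n) : CSUq.of q n (PreSUq.gen q i j) = CSUq.gen q n i j := rfl

theorem CSUq.denseRange_of : DenseRange (CSUq.of q n) :=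
  denseRange_coe (α := PreSUq q n)

/-- The norm of the image in the completion is the supremum of the norms in all models. Identities
that hold in every model, the defining relations among them, therefore hold in `CSUq q n`. -/
theorem CSUq.of_eq_zero {x : PreSUq q n}
    (h : ∀ (B : Type) [CStarAlgebra B] (u : Fin n → Fin n → B), SUqRelations q u →
      PreSUq.eval u x = 0) : CSUq.of q n x = 0 := by
  refine norm_le_zero_iff.1 ?_
  have h1 : ‖CSUq.of q n x‖ = suqSeminorm q n x := norm_coe x
  rw [h1]
  exact suqSeminorm_le le_rfl fun B _ u hu => by rw [h B u hu, norm_zero]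

theorem CSUq.of_eq {x y : PreSUq q n}
    (h : ∀ (B : Type) [CStarAlgebra B] (u : Fin n → Fin n → B), SUqRelations q u →
      PreSUq.eval u x = PreSUq.eval u y) : CSUq.of q n x = CSUq.of q n y := by
  rw [← sub_eq_zero, ← map_sub]
  exact CSUq.of_eq_zero fun B _ u hu => by rw [map_sub, h B u hu, sub_self]

variable (q n) in
theorem CSUq.relations : SUqRelations q (CSUq.gen q n) where
  mul_star i j := by
    have := CSUq.of_eq (x := ∑ k, PreSUq.gen q i k * star (PreSUq.gen q j k))
      (y := if i = j then 1 else 0) fun B _ u hu => by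
        simp only [map_sum, map_mul, map_star, PreSUq.eval_gen, hu.mul_star]
        split_ifs <;> simp
    simp only [map_sum, map_mul, map_star, CSUq.of_gen] at this
    rw [this]
    split_ifs <;> simp
  star_mul i j := by
    have := CSUq.of_eq (x := ∑ k, star (PreSUq.gen q k i) * PreSUq.gen q k j)
      (y := if i = j then 1 else 0) fun B _ u hu => by
        simp only [map_sum, map_mul, map_star, PreSUq.eval_gen, hu.star_mul]
        split_ifs <;> simp
    simp only [map_sum, map_mul, map_star, CSUq.of_gen] at this
    rw [this]
    split_ifs <;> simp
  det j := by
    have := CSUq.of_eq (x := ∑ i : Fin n → Fin n,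
        coeffE q i • (List.ofFn fun k => PreSUq.gen q (j k) (i k)).prod)
      (y := coeffE q j • (1 : PreSUq q n)) fun B _ u hu => by
        simpa only [map_sum, map_smul, map_list_prod, List.map_ofFn, map_one, Function.comp_def,
          PreSUq.eval_gen] using hu.det j
    simpa only [map_sum, map_smul, map_list_prod, List.map_ofFn, map_one, Function.comp_def,
      CSUq.of_gen] using this

theorem CSUq.mem_of_gen {R : Subalgebra ℂ (CSUq q n)} (hg : ∀ i j, CSUq.gen q n i j ∈ R)
    (hs : ∀ i j, star (CSUq.gen q n i j) ∈ R) (x : PreSUq q n) : CSUq.of q n x ∈ R :=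
  PreSUq.mem_of_gen (R := {x | CSUq.of q n x ∈ R})
    (fun c => by
      rw [Set.mem_ofPred_eq, AlgHomClass.commutes]
      exact R.algebraMap_mem c) hg
    (fun i j => by
      rw [Set.mem_ofPred_eq, map_star]
      exact hs i j)
    (fun x y hx hy => by
      rw [Set.mem_ofPred_eq, map_mul]
      exact R.mul_mem hx hy)
    (fun x y hx hy => by
      rw [Set.mem_ofPred_eq, map_add]
      exact R.add_mem hx hy) x

theorem CSUq.dense_of_gen {R : Subalgebra ℂ (CSUq q n)} (hg : ∀ i j, CSUq.gen q n i j ∈ R)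
    (hs : ∀ i j, star (CSUq.gen q n i j) ∈ R) : Dense (R : Set (CSUq q n)) :=
  CSUq.denseRange_of.mono (by rintro _ ⟨x, rfl⟩; exact CSUq.mem_of_gen hg hs x)

theorem CSUq.hom_ext {C : Type*} [Ring C] [StarRing C] [Algebra ℂ C] [TopologicalSpace C]
    [T2Space C] {φ ψ : CSUq q n →⋆ₐ[ℂ] C} (hφ : Continuous φ) (hψ : Continuous ψ)
    (h : ∀ i j, φ (CSUq.gen q n i j) = ψ (CSUq.gen q n i j)) : φ = ψ := by
  have key : φ.comp (CSUq.of q n) = ψ.comp (CSUq.of q n) := PreSUq.hom_ext h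
  exact DFunLike.coe_injective (CSUq.denseRange_of.equalizer hφ hψ
    (funext fun x => DFunLike.congr_fun key x))

section lift

variable {C : Type*} [Ring C] [UniformSpace C] [IsUniformAddGroup C] [StarRing C]
  [ContinuousStar C] [IsTopologicalRing C] [Algebra ℂ C] [StarModule ℂ C] [CompleteSpace C]
  [T0Space C] (v : Fin n → Fin n → C)

/-- The homomorphism that maps the generators to the entries of `v`. -/
def CSUq.lift (hc : Continuous (PreSUq.eval (q := q) v)) : CSUq q n →⋆ₐ[ℂ] C :=
  completionLift (PreSUq.eval (q := q) v) hc

theorem CSUq.lift_gen (hc : Continuous (PreSUq.eval (q := q) v)) (i j : Fin n) :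
    CSUq.lift v hc (CSUq.gen q n i j) = v i j :=
  (completionLift_coe (PreSUq.eval (q := q) v) hc _).trans (PreSUq.eval_gen v i j)

end lift

theorem PreSUq.continuous_eval {B : Type} [CStarAlgebra B] {v : Fin n → Fin n → B}
    (hv : SUqRelations q v) : Continuous (PreSUq.eval (q := q) v) :=
  AddMonoidHomClass.continuous_of_bound (PreSUq.eval (q := q) v) 1 fun x =>
    (norm_le_suqSeminorm hv x).trans (one_mul ‖x‖).ge

theorem CSUq.existsUnique_hom {B : Type} [CStarAlgebra B] {v : Fin n → Fin n → B}
    (hv : SUqRelations q v) :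
    ∃! φ : CSUq q n →⋆ₐ[ℂ] B, ∀ i j, φ (CSUq.gen q n i j) = v i j := by
  refine ⟨CSUq.lift v (PreSUq.continuous_eval hv), CSUq.lift_gen v _, fun ψ hψ => ?_⟩
  exact CSUq.hom_ext (continuous_cstarHom _) (continuous_cstarHom _) fun i j =>
    (hψ i j).trans (CSUq.lift_gen v _ i j).symm

/-- The target is treated only as a topological `*`-algebra, so the universal seminorm bound is
applied in each operator algebra `H i →L[ℂ] H i` separately. This provides the comultiplication with
values in `MinTensor`. -/
theorem PreSUq.continuous_eval_repCompletion {F : Type} [Ring F] [StarRing F] [Algebra ℂ F]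
    [StarModule ℂ F] {ι : Type v} {H : ι → Type} [∀ i, NormedAddCommGroup (H i)]
    [∀ i, InnerProductSpace ℂ (H i)] [∀ i, CompleteSpace (H i)]
    {f : ∀ i, F →⋆ₐ[ℂ] (H i →L[ℂ] H i)} {w : Fin n → Fin n → RepCompletion f}
    (hw : SUqRelations q w) : Continuous (PreSUq.eval (q := q) w) := by
  refine RepCompletion.continuous_iff_rep.2 fun i => ?_
  have hc := PreSUq.continuous_eval (hw.map (RepCompletion.rep f i))
  have h : PreSUq.eval (q := q) (fun k l => RepCompletion.rep f i (w k l)) =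
      (RepCompletion.rep f i).comp (PreSUq.eval w) :=
    PreSUq.hom_ext fun k l => by
      rw [PreSUq.eval_gen, StarAlgHom.comp_apply, PreSUq.eval_gen]
  rw [h] at hc
  exact hc

end CSUq

/-! ### The comultiplication of `C(SU_q(n))` -/

section Tmul

variable {A B : Type u} [Ring A] [StarRing A] [Algebra ℂ A] [StarModule ℂ A] [TopologicalSpace A]
  [Ring B] [StarRing B] [Algebra ℂ B] [StarModule ℂ B] [TopologicalSpace B]

variable (A B) in
/-- The homomorphism `a ↦ a ⊗ 1`. -/
def tmulLeft : A →⋆ₐ[ℂ] MinTensor A B := (RepCompletion.of (pairRep A B)).comp inclLeft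

variable (A B) in
/-- The homomorphism `b ↦ 1 ⊗ b`. -/
def tmulRight : B →⋆ₐ[ℂ] MinTensor A B := (RepCompletion.of (pairRep A B)).comp inclRight

theorem tmulLeft_apply (a : A) : tmulLeft A B a = tmul a 1 := rfl

theorem tmulRight_apply (b : B) : tmulRight A B b = tmul 1 b := rfl

theorem tmul_mul_tmul (a a' : A) (b b' : B) : tmul a b * tmul a' b' = tmul (a * a') (b * b') := by
  rw [tmul, tmul, tmul, ← map_mul, Algebra.TensorProduct.tmul_mul_tmul]

theorem tmulLeft_mul_tmulRight (a : A) (b : B) : tmulLeft A B a * tmulRight A B b = tmul a b := by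
  rw [tmulLeft_apply, tmulRight_apply, tmul_mul_tmul, mul_one, one_mul]

theorem commute_tmulLeft_tmulRight (a : A) (b : B) :
    Commute (tmulLeft A B a) (tmulRight A B b) := by
  rw [Commute, SemiconjBy, tmulLeft_apply, tmulRight_apply, tmul_mul_tmul, tmul_mul_tmul]
  simp only [mul_one, one_mul]

theorem continuous_tmulLeft : Continuous (tmulLeft A B) := by
  refine RepCompletion.continuous_iff_rep.2 fun p => ?_
  refine ((continuous_ampLeft p.1.H p.2.H).comp p.1.continuous_π).congr fun a => ?_
  refine Eq.trans ?_ (MinTensor.rep_tmul p.1.π p.1.continuous_π p.2.π p.2.continuous_π a 1).symm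
  rw [map_one]
  rfl

theorem continuous_tmulRight : Continuous (tmulRight A B) := by
  refine RepCompletion.continuous_iff_rep.2 fun p => ?_
  refine ((continuous_ampRight p.1.H p.2.H).comp p.2.continuous_π).congr fun a => ?_
  refine Eq.trans ?_ (MinTensor.rep_tmul p.1.π p.1.continuous_π p.2.π p.2.continuous_π 1 a).symm
  rw [map_one]
  rfl

end Tmul

/-! ### A subalgebra criterion for the density of products. -/

section Density

variable {A M : Type*} [Ring A] [StarRing A] [Algebra ℂ A] [TopologicalSpace A]
  [Ring M] [StarRing M] [Algebra ℂ M] [TopologicalSpace M] [IsTopologicalRing M]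
  (Δ κ κ' : A →⋆ₐ[ℂ] M)

/-- The linear span of the products `Δ(a) κ(b)`. -/
def productSpan : Submodule ℂ M := Submodule.span ℂ {x | ∃ a b, x = Δ a * κ b}

variable {Δ κ κ'}

theorem mul_mul_mem_productSpan (a b : A) {x : M} (hx : x ∈ productSpan Δ κ) :
    Δ a * x * κ b ∈ productSpan Δ κ := by
  induction hx using Submodule.span_induction with
  | mem x hx =>
    obtain ⟨c, d, rfl⟩ := hx
    refine Submodule.subset_span ⟨a * c, d * b, ?_⟩
    simp only [map_mul, mul_assoc]
  | zero => rw [mul_zero, zero_mul]; exact Submodule.zero_mem _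
  | add x y _ _ hx hy => rw [mul_add, add_mul]; exact Submodule.add_mem _ hx hy
  | smul c x _ hx => rw [mul_smul_comm, smul_mul_assoc]; exact Submodule.smul_mem _ c hx

/-- For `x = Δ(c)κ(d)` the commutation gives `x κ'(b) = Δ(c) κ'(b) κ(d)`, and the span is stable
under `Δ(c)` on the left and `κ(d)` on the right. Hence the elements `a` with `κ'(a)` in the span
are closed under multiplication. In the application `κ` and `κ'` are the two embeddings of `A` into
`A ⊗ A`. -/
theorem mul_mem_productSpan (h : ∀ a b, Commute (κ a) (κ' b)) {x : M}
    (hx : x ∈ productSpan Δ κ) {b : A} (hb : κ' b ∈ productSpan Δ κ) :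
    x * κ' b ∈ productSpan Δ κ := by
  induction hx using Submodule.span_induction with
  | mem x hx =>
    obtain ⟨c, d, rfl⟩ := hx
    rw [mul_assoc, (h d b).eq, ← mul_assoc]
    exact mul_mul_mem_productSpan c d hb
  | zero => rw [zero_mul]; exact Submodule.zero_mem _
  | add x y _ _ hx hy => rw [add_mul]; exact Submodule.add_mem _ hx hy
  | smul c x _ hx => rw [smul_mul_assoc]; exact Submodule.smul_mem _ c hx

variable (Δ) in
/-- The algebra of the elements `a` for which `κ'(a)` is a linear combination of products
`Δ(b) κ(c)`. -/
def productSpanSubalgebra (h : ∀ a b, Commute (κ a) (κ' b)) : Subalgebra ℂ A where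
  carrier := {a | κ' a ∈ productSpan Δ κ}
  mul_mem' {a b} ha hb := by
    rw [Set.mem_ofPred_eq, map_mul]
    exact mul_mem_productSpan h ha hb
  add_mem' {a b} ha hb := by
    rw [Set.mem_ofPred_eq, map_add]
    exact Submodule.add_mem _ ha hb
  algebraMap_mem' c := by
    refine Submodule.subset_span ⟨algebraMap ℂ A c, 1, ?_⟩
    rw [AlgHomClass.commutes, AlgHomClass.commutes, map_one, mul_one]

theorem mul_mem_closure_productSpan (h : ∀ a b, Commute (κ a) (κ' b)) (hκ' : Continuous κ')
    (hd : Dense (productSpanSubalgebra Δ h : Set A)) (a b : A) :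
    κ' a * κ b ∈ closure (productSpan Δ κ : Set M) :=
  map_mem_closure (f := fun a => κ' a * κ b) (hκ'.mul continuous_const) (hd a) fun c hc => by
    have := mul_mul_mem_productSpan (1 : A) b hc
    rwa [map_one, one_mul] at this

theorem dense_of_tmul_mem_closure {A B : Type u} [Ring A] [StarRing A] [Algebra ℂ A]
    [StarModule ℂ A] [TopologicalSpace A] [Ring B] [StarRing B] [Algebra ℂ B] [StarModule ℂ B]
    [TopologicalSpace B] {T : Submodule ℂ (MinTensor A B)}
    (h : ∀ a b, tmul a b ∈ closure (T : Set (MinTensor A B))) :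
    Dense (T : Set (MinTensor A B)) := by
  rw [← dense_closure]
  refine (RepCompletion.dense_range_of (pairRep A B)).mono ?_
  rintro _ ⟨z, rfl⟩
  change _ ∈ T.toAddSubgroup.topologicalClosure
  induction z using TensorProduct.induction_on with
  | zero => rw [map_zero]; exact AddSubgroup.zero_mem _
  | add x y hx hy => rw [map_add]; exact AddSubgroup.add_mem _ hx hy
  | tmul a b => exact h a b

end Density

/-! ### The quantum group `SU_q(n)` -/

section SUqQuantumGroup

variable (q : ℝ) (n : ℕ)

theorem CSUq.comul_relations : SUqRelations q fun i j : Fin n =>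
    ∑ k, tmul (CSUq.gen q n i k) (CSUq.gen q n k j) := by
  have h := ((CSUq.relations q n).map (tmulLeft (CSUq q n) (CSUq q n))).mul
    ((CSUq.relations q n).map (tmulRight (CSUq q n) (CSUq q n)))
    fun i j k l => commute_tmulLeft_tmulRight _ _
  simpa only [tmulLeft_mul_tmulRight] using h

/-- The comultiplication of `C(SU_q(n))`. -/
def CSUq.comul : CSUq q n →⋆ₐ[ℂ] MinTensor (CSUq q n) (CSUq q n) :=
  CSUq.lift _ (PreSUq.continuous_eval_repCompletion (CSUq.comul_relations q n))

variable {q n}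

theorem CSUq.comul_gen (i j : Fin n) : CSUq.comul q n (CSUq.gen q n i j) =
    ∑ k, tmul (CSUq.gen q n i k) (CSUq.gen q n k j) :=
  CSUq.lift_gen _ _ i j

theorem CSUq.continuous_comul : Continuous (CSUq.comul q n) :=
  RepCompletion.continuous_of_cstarAlgebra _ _

theorem leg₁₂_tmul {A B C : Type u} [Ring A] [StarRing A] [Algebra ℂ A] [StarModule ℂ A]
    [TopologicalSpace A] [Ring B] [StarRing B] [Algebra ℂ B] [StarModule ℂ B] [TopologicalSpace B]
    [Ring C] [StarRing C] [Algebra ℂ C] [StarModule ℂ C] [TopologicalSpace C]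
    (a : A) (b : B) (c : C) : leg₁₂ A B C (tmul a b) * leg₃ A B C c =
      leg₁ A B C a * leg₂₃ A B C (tmul b c) := by
  rw [tmul, tmul, leg₁₂_of, leg₂₃_of]
  change _ * RepCompletion.of (tripleRep A B C) ((1 : A ⊗[ℂ] B) ⊗ₜ[ℂ] c) =
    RepCompletion.of (tripleRep A B C) ((a ⊗ₜ[ℂ] (1 : B)) ⊗ₜ[ℂ] (1 : C)) *
      RepCompletion.of (tripleRep A B C) (((1 : A) ⊗ₜ[ℂ] b) ⊗ₜ[ℂ] c)
  rw [← map_mul, ← map_mul]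
  simp only [Algebra.TensorProduct.tmul_mul_tmul, mul_one, one_mul]

theorem CSUq.coassoc (a : CSUq q n) :
    comulId (CSUq.comul q n) (CSUq.comul q n a) = idComul (CSUq.comul q n) (CSUq.comul q n a) := by
  have hc := CSUq.continuous_comul (q := q) (n := n)
  have key : (comulIdHom _ hc).comp (CSUq.comul q n) = (idComulHom _ hc).comp (CSUq.comul q n) := by
    refine CSUq.hom_ext ((continuous_comulIdHom _ hc).comp hc)
      ((continuous_idComulHom _ hc).comp hc) fun i j => ?_
    rw [StarAlgHom.comp_apply, StarAlgHom.comp_apply, CSUq.comul_gen, map_sum, map_sum]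
    simp only [comulIdHom_tmul, idComulHom_tmul, CSUq.comul_gen, map_sum, Finset.sum_mul,
      Finset.mul_sum, leg₁₂_tmul]
    -- Both sides are the double sum of `u_ik ⊗ u_kl ⊗ u_lj`, in different orders of summation.
    exact Finset.sum_comm
  exact DFunLike.congr_fun key a

/-- `R` need not be closed under adjoints: the determinant expansion already places the adjoints of
the generators in it. -/
theorem CSUq.adjoin_dense (hq : q ≠ 0) {R : Subalgebra ℂ (CSUq q n)}
    (hg : ∀ i j, CSUq.gen q n i j ∈ R) : Dense (R : Set (CSUq q n)) :=
  CSUq.dense_of_gen hg fun i j => Algebra.adjoin_le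
    (by rintro _ ⟨p, rfl⟩; exact hg p.1 p.2) ((CSUq.relations q n).star_mem_adjoin hq i j)

theorem CSUq.adjoin_star_dense (hq : q ≠ 0) {R : Subalgebra ℂ (CSUq q n)}
    (hg : ∀ i j, star (CSUq.gen q n i j) ∈ R) : Dense (R : Set (CSUq q n)) :=
  CSUq.dense_of_gen (fun i j => Algebra.adjoin_le
    (by rintro _ ⟨p, rfl⟩; exact hg p.1 p.2) ((CSUq.relations q n).mem_adjoin_star hq i j)) hg

/-- The right side is `∑ l, u_il ⊗ (∑ k, u_lk u_jk^*)`, and the inner sum is `δ_lj`. -/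
theorem CSUq.tmulLeft_gen (i j : Fin n) : tmulLeft (CSUq q n) (CSUq q n) (CSUq.gen q n i j) =
    ∑ k, CSUq.comul q n (CSUq.gen q n i k) *
      tmulRight (CSUq q n) (CSUq q n) (star (CSUq.gen q n j k)) := by
  have h := (CSUq.relations q n).mul_star
  simp only [CSUq.comul_gen, tmulRight_apply, Finset.sum_mul, tmul_mul_tmul, mul_one]
  rw [Finset.sum_comm]
  simp only [← tmulLeft_mul_tmulRight, ← Finset.mul_sum, ← map_sum, h]
  rw [Finset.sum_eq_single j]
  · simp
  · exact fun l _ hl => by simp [hl]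
  · exact fun hj => absurd (Finset.mem_univ _) hj

/-- The right side is `∑ l, (∑ k, u_kl^* u_ki) ⊗ u_lj^*`, and the inner sum is `δ_li`. Adjoints
appear because the column relation has the adjoint as its left factor. -/
theorem CSUq.tmulRight_star_gen (i j : Fin n) :
    tmulRight (CSUq q n) (CSUq q n) (star (CSUq.gen q n i j)) =
      ∑ k, CSUq.comul q n (star (CSUq.gen q n k j)) *
        tmulLeft (CSUq q n) (CSUq q n) (CSUq.gen q n k i) := by
  have h := (CSUq.relations q n).star_mul
  simp only [map_star, CSUq.comul_gen, ← tmulLeft_mul_tmulRight, star_sum, star_mul]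
  simp only [← map_star, Finset.sum_mul, mul_assoc, ← map_mul]
  rw [Finset.sum_comm]
  simp only [← Finset.mul_sum, ← map_sum, h]
  rw [Finset.sum_eq_single i]
  · simp
  · exact fun l _ hl => by simp [hl]
  · exact fun hj => absurd (Finset.mem_univ _) hj

theorem CSUq.isCompactQuantumGroup (hq : q ≠ 0) :
    IsCompactQuantumGroup (CSUq q n) (CSUq.comul q n) := by
  have hcomm := commute_tmulLeft_tmulRight (A := CSUq q n) (B := CSUq q n)
  have hcomm' : ∀ a b, Commute (tmulRight (CSUq q n) (CSUq q n) a)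
      (tmulLeft (CSUq q n) (CSUq q n) b) := fun a b => (hcomm b a).symm
  refine ⟨CSUq.coassoc, dense_of_tmul_mem_closure fun a b => ?_,
    dense_of_tmul_mem_closure fun a b => ?_⟩
  -- For `Δ(A)(A ⊗ 1)`: the algebra of all `b` with `1 ⊗ b` in the span contains the adjoints of the
  -- generators, so it is dense.
  · rw [← tmulLeft_mul_tmulRight, (hcomm a b).eq]
    refine mul_mem_closure_productSpan hcomm continuous_tmulRight
      (CSUq.adjoin_star_dense hq fun i j => ?_) b a
    change tmulRight (CSUq q n) (CSUq q n) _ ∈ productSpan _ _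
    rw [CSUq.tmulRight_star_gen]
    exact Submodule.sum_mem _ fun k _ => Submodule.subset_span ⟨_, _, rfl⟩
  -- For `Δ(A)(1 ⊗ A)`: the algebra of all `a` with `a ⊗ 1` in the span contains the generators, so
  -- it is dense.
  · rw [← tmulLeft_mul_tmulRight]
    refine mul_mem_closure_productSpan hcomm' continuous_tmulLeft
      (CSUq.adjoin_dense hq fun i j => ?_) a b
    change tmulLeft (CSUq q n) (CSUq q n) _ ∈ productSpan _ _
    rw [CSUq.tmulLeft_gen]
    exact Submodule.sum_mem _ fun k _ => Submodule.subset_span ⟨_, _, rfl⟩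

variable (q n) in
/-- The homomorphism `C(SU_q(n + 1)) → C(SU_q(n))` that belongs to the matrix `diag(u, 1)`. -/
def CSUq.restrict : CSUq q (n + 1) →⋆ₐ[ℂ] CSUq q n :=
  CSUq.lift _ (PreSUq.continuous_eval (CSUq.relations q n).blockMatrix)

theorem CSUq.restrict_gen (i j : Fin (n + 1)) :
    CSUq.restrict q n (CSUq.gen q (n + 1) i j) = blockMatrix (CSUq.gen q n) i j :=
  CSUq.lift_gen _ _ i j

theorem CSUq.continuous_restrict : Continuous (CSUq.restrict q n) :=
  continuous_completionLift _ _

theorem CSUq.restrict_surjective : Function.Surjective (CSUq.restrict q n) := by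
  refine surjective_of_denseRange _ ?_
  refine CSUq.dense_of_gen (R := (CSUq.restrict q n).toAlgHom.range) (fun i j => ?_) fun i j => ?_
  · exact ⟨CSUq.gen q (n + 1) i.castSucc j.castSucc,
      (CSUq.restrict_gen _ _).trans (blockMatrix_castSucc _ i j)⟩
  · exact ⟨star (CSUq.gen q (n + 1) i.castSucc j.castSucc), (map_star (CSUq.restrict q n) _).trans
      (congrArg star ((CSUq.restrict_gen _ _).trans (blockMatrix_castSucc _ i j)))⟩

theorem CSUq.map_restrict_comul (a : CSUq q (n + 1)) :
    MinTensor.map (CSUq.restrict q n) CSUq.continuous_restrict (CSUq.restrict q n)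
      CSUq.continuous_restrict (CSUq.comul q (n + 1) a) =
    CSUq.comul q n (CSUq.restrict q n a) := by
  have key : (MinTensor.map (CSUq.restrict q n) CSUq.continuous_restrict (CSUq.restrict q n)
      CSUq.continuous_restrict).comp (CSUq.comul q (n + 1)) =
      (CSUq.comul q n).comp (CSUq.restrict q n) := by
    refine CSUq.hom_ext ((MinTensor.continuous_map (CSUq.restrict q n)
      CSUq.continuous_restrict (CSUq.restrict q n) CSUq.continuous_restrict).comp
      CSUq.continuous_comul)
      (CSUq.continuous_comul.comp CSUq.continuous_restrict) fun i j => ?_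
    rw [StarAlgHom.comp_apply, StarAlgHom.comp_apply, CSUq.comul_gen, map_sum,
      CSUq.restrict_gen]
    simp only [MinTensor.map_tmul, CSUq.restrict_gen, Fin.sum_univ_castSucc]
    cases i using Fin.lastCases <;> cases j using Fin.lastCases <;>
      simp [CSUq.comul_gen, ← tmulLeft_mul_tmulRight]
  exact DFunLike.congr_fun key a

end SUqQuantumGroup

/-! ### The σ-C⋆-quantum group `C(SU_q(∞))`; the index is shifted by two because the system starts
at `SU_q(2)`. -/

section Infinity

variable {q : ℝ}

theorem CSUq.isSystemMorphism : IsSystemMorphism (A := fun n => CSUq q (n + 2))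
    (fun n => CSUq.restrict q (n + 2)) (fun n => CSUq.comul q (n + 2)) :=
  fun _ a => CSUq.map_restrict_comul a

set_option maxHeartbeats 1000000 in
theorem CSUq.inverseLimit_quantumGroup (hq : q ≠ 0) :
    ∃ Δlim : inverseLimit (A := fun n => CSUq q (n + 2)) (fun n => CSUq.restrict q (n + 2)) →⋆ₐ[ℂ]
        MinTensor (inverseLimit (A := fun n => CSUq q (n + 2)) fun n => CSUq.restrict q (n + 2))
          (inverseLimit (A := fun n => CSUq q (n + 2)) fun n => CSUq.restrict q (n + 2)),
      IsLimitHom (A := fun n => CSUq q (n + 2)) (fun n => CSUq.restrict q (n + 2))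
        (fun n => CSUq.comul q (n + 2)) Δlim ∧
      IsSigmaCStarQuantumGroup (inverseLimit (A := fun n => CSUq q (n + 2))
        fun n => CSUq.restrict q (n + 2)) Δlim := by
  obtain ⟨-, Δlim, hlim, -, hqg⟩ := SigmaCStar.inverseLimit_quantumGroup
    (A := fun n => CSUq q (n + 2)) (θ := fun n => CSUq.restrict q (n + 2))
    (fun n => CSUq.restrict_surjective) (fun n => CSUq.isCompactQuantumGroup hq)
    CSUq.isSystemMorphism
  exact ⟨Δlim, hlim, hqg⟩

end Infinity

end

end SigmaCStar

theorem mainTheorem7 :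
    -- a C⋆-compact quantum group is a σ-C⋆-quantum group
    (∀ (A : Type*) [CStarAlgebra A] (Δ : A →⋆ₐ[ℂ] MinTensor A A),
      IsCompactQuantumGroup A Δ → IsSigmaCStarQuantumGroup A Δ) ∧
    -- inverse limits of C⋆-compact quantum groups
    (∀ (A : ℕ → Type*) [∀ n, CStarAlgebra (A n)] (θ : ∀ n, A (n + 1) →⋆ₐ[ℂ] A n)
      (Δ : ∀ n, A n →⋆ₐ[ℂ] MinTensor (A n) (A n)),
      (∀ n, Function.Surjective (θ n)) →
      (∀ n, IsCompactQuantumGroup (A n) (Δ n)) →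
      IsSystemMorphism θ Δ →
      TensorIsInverseLimit θ ∧
      ∃ Δlim : inverseLimit θ →⋆ₐ[ℂ] MinTensor (inverseLimit θ) (inverseLimit θ),
        IsLimitHom θ Δ Δlim ∧ (∀ Δ', IsLimitHom θ Δ Δ' → Δ' = Δlim) ∧
        IsSigmaCStarQuantumGroup (inverseLimit θ) Δlim) ∧
    -- the σ-C⋆-quantum group `C(SU_q(∞))`
    (∀ q : ℝ, 0 < q → q < 1 →
      (∀ n : ℕ, SUqRelations q (CSUq.gen q n) ∧
        ∀ (B : Type) [CStarAlgebra B] (v : Fin n → Fin n → B), SUqRelations q v →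
          ∃! φ : CSUq q n →⋆ₐ[ℂ] B, ∀ i j, φ (CSUq.gen q n i j) = v i j) ∧
      ∃ (Δ : ∀ n, CSUq q (n + 2) →⋆ₐ[ℂ] MinTensor (CSUq q (n + 2)) (CSUq q (n + 2)))
        (θ : ∀ n, CSUq q (n + 1 + 2) →⋆ₐ[ℂ] CSUq q (n + 2)),
        (∀ n i j, Δ n (CSUq.gen q (n + 2) i j) =
          ∑ k, tmul (CSUq.gen q (n + 2) i k) (CSUq.gen q (n + 2) k j)) ∧
        (∀ n i j, θ n (CSUq.gen q (n + 1 + 2) i j) =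
          if h : i.val < n + 2 ∧ j.val < n + 2 then
            CSUq.gen q (n + 2) ⟨i.val, h.1⟩ ⟨j.val, h.2⟩
          else if i = j then 1 else 0) ∧
        (∀ n, IsCompactQuantumGroup (CSUq q (n + 2)) (Δ n)) ∧
        (∀ n, Function.Surjective (θ n)) ∧
        IsSystemMorphism (A := fun n => CSUq q (n + 2)) θ Δ ∧
        ∃ Δlim : inverseLimit (A := fun n => CSUq q (n + 2)) θ →⋆ₐ[ℂ]
            MinTensor (inverseLimit (A := fun n => CSUq q (n + 2)) θ)
              (inverseLimit (A := fun n => CSUq q (n + 2)) θ),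
          IsLimitHom (A := fun n => CSUq q (n + 2)) θ Δ Δlim ∧
          IsSigmaCStarQuantumGroup (inverseLimit (A := fun n => CSUq q (n + 2)) θ) Δlim) := by
  refine ⟨fun A _ Δ h => h.isSigmaCStarQuantumGroup,
    fun A _ θ Δ hθ hΔ hs => inverseLimit_quantumGroup hθ hΔ hs, fun q hq _ =>
    ⟨fun n => ⟨CSUq.relations q n, fun B _ v hv => CSUq.existsUnique_hom hv⟩,
      fun n => CSUq.comul q (n + 2), fun n => CSUq.restrict q (n + 2),
      fun n i j => CSUq.comul_gen i j, fun n i j => CSUq.restrict_gen (n := n + 2) i j,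
      fun n => CSUq.isCompactQuantumGroup hq.ne', fun n => CSUq.restrict_surjective,
      CSUq.isSystemMorphism, CSUq.inverseLimit_quantumGroup hq.ne'⟩⟩
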